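/- Let $(M^m,c)$ be a conformal manifold and $N^n\subset M$ an embedded submanifold with the induced conformal structure (also denoted $c$), where $m>n\ge 2$. Let $L$ be the weight bundle, so that $c$ is an $L^2$-valued inner product on the tangent bundle, and identify the weight bundle $L_N$ of $N$ with $L|_N$. Write $A_0$ for the part of a bilinear form $A$ on $TN$ that is trace-free with respect to $c|_N$, and $v=v^N+v^\perp$ for the tangential and normal components of $v\in TM|_N$. For a Weyl structure $\nabla$ (torsion-free connection with $\nabla c=0$) on a conformal manifold of dimension $d\ge 2$ let $\mathrm{Ric}(X,Y)=\operatorname{tr}(R_{\cdot,X}Y)$, $\mathrm{scal}=\operatorname{tr}_c\mathrm{Ric}$, let $F$ be the Faraday form ($R_{X,Y}=(R_{X,Y})^{skew}+F(X,Y)\,\mathrm{Id}$), and, if $d\ge3$, let $h^{\nabla,s}=\frac1{d-2}\mathrm{Ric}^{sym}_0+\frac1{2d(d-1)}\mathrm{scal}\,c$ and let $h^\nabla=h^{\nabla,s}-\frac12F$ be the Schouten-Weyl tensor. Let $\mathrm{Hess}^\nabla(X,Y)l=\nabla_X\nabla_Yl-\nabla_{\nabla_XY}l$ on sections $l$ of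 $L$, and let $\mathrm{Hess}^\nabla_0$ be its symmetric trace-free part. A Möbius structure is an operator $\mathcal M:C^\infty(L)\to C^\infty(S^2_0\otimes L)$ such that $\mathcal M-\mathrm{Hess}^\nabla_0$ is the multiplication with a section of $S^2_0$, for some Weyl structure $\nabla$. If $d\geq3$, the canonical one is $\mathrm{Hess}_0^\nabla+h_0^{\nabla,s}$, for any Weyl structure $\nabla$. Let $\nabla$ be a Weyl structure on $M$. Put $B^\nabla(X,Y)=(\nabla_XY)^\perp$ for $X,Y\in TN$, with $B^\nabla=H^\nabla\cdot c+B_0$ its decomposition into the trace part, which defines the mean curvature $H^\nabla\in\nu^*\simeq L^{-2}\otimes\nu$ ($\nu$ the normal bundle), and the trace-free part $B_0$. Let $$P(X,Y)l=\nabla_X\nabla_Yl-\nabla_{(\nabla_XY)^N}l+h^\nabla(X,Y)l\qquad(X,Y\in TN,\ l\in C^\infty(L_N)),$$ and let $P_0$ be the trace-free part of $P$. Define $$\mathcal M^{ind}(X,Y)l=P_0(X,Y)l+H^\nabla(B_0(X,Y))\,l .$$ 1. For every extension of $l$ near the given point to a section of $L$ over $M$, again denoted $l$, $$\mathcal M^{ind}(X,Y)l=\big(\mathrm{Hess}^\nabla_{0,N}(X,Y)l+\nabla_{B_0(X,Y)}l\big)+h^\nabla_{0,N}(X,Y)l+H^\nabla(B_0(X,Y))l,$$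 where the subscript $0,N$ denotes the trace-free part along $TN$ of the restriction to $TN$. 2. $\mathcal M^{ind}$ does not depend on the choice of the Weyl structure $\nabla$ on $M$, and it is a Möbius structure on $N$. 3. Let $\mathcal M^N$ be the canonical Möbius structure of $N$ if $n\ge3$, or any Möbius structure on $(N,c)$ if $n=2$. Let $\nabla^N_XY=(\nabla_XY)^N$ be the induced Weyl structure, and let $h^N$ be its Schouten-Weyl tensor if $n\ge 3$, and $h^N=(\mathcal M^N-\mathrm{Hess}_0^{\nabla^N})+\frac14\mathrm{scal}^{\nabla^N}c-\frac12F^{\nabla^N}$ if $n=2$. Let $$\rho(X,Y)=(h^\nabla-h^N)(X,Y)+\tfrac12c(H^\nabla,H^\nabla)\,c(X,Y)+H^\nabla(B_0(X,Y))\qquad(X,Y\in TN)$$ be the relative Schouten-Weyl tensor. Then $$\mathcal M^{ind}-\mathcal M^N=\rho_0 .$$ -/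

import Mathlib

open scoped Manifold ContDiff Bundle Topology
open Bundle

noncomputable section

namespace ConfGeom

/-! ### Metrics, conformal structures, the weight bundle

A manifold of dimension `m` is modelled on `EuclideanSpace ℝ (Fin m)`; its tangent space at `x` is
`TangentSpace (𝓡 m) x`. -/

/-- Smooth Riemannian metrics on `M`. -/
abbrev Metric (m : ℕ) (M : Type*) [TopologicalSpace M] [ChartedSpace (EuclideanSpace ℝ (Fin m)) M]
    [IsManifold (𝓡 m) ∞ M] :=
  ContMDiffRiemannianMetric (𝓡 m) ∞ (EuclideanSpace ℝ (Fin m))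
    (fun x : M => TangentSpace (𝓡 m) x)

/-- The underlying function of a connection on `TM`: `D Y x X` is `(∇_X Y)(x)`. -/
abbrev Conn (m : ℕ) (M : Type*) [TopologicalSpace M] [ChartedSpace (EuclideanSpace ℝ (Fin m)) M] :=
  (Π x : M, TangentSpace (𝓡 m) x) →
    (Π x : M, TangentSpace (𝓡 m) x →L[ℝ] TangentSpace (𝓡 m) x)

section Intrinsic

variable {m : ℕ} {M : Type*} [TopologicalSpace M] [ChartedSpace (EuclideanSpace ℝ (Fin m)) M]

/-- The standard basis of the tangent space at `x`. -/
def basisVec (x : M) (i : Fin m) : TangentSpace (𝓡 m) x :=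
  (EuclideanSpace.single i (1 : ℝ) : EuclideanSpace ℝ (Fin m))

/-- The `i`-th coordinate of a tangent vector in the basis `basisVec x`. -/
def coordAt (x : M) (i : Fin m) (v : TangentSpace (𝓡 m) x) : ℝ :=
  (show EuclideanSpace ℝ (Fin m) from v) i

/-- The trace of an endomorphism of the tangent space at `x`. -/
def endTrace (x : M) (f : TangentSpace (𝓡 m) x → TangentSpace (𝓡 m) x) : ℝ :=
  ∑ i, coordAt x i (f (basisVec x i))

/-- The Gram matrix of an inner product on the tangent space at `x`. -/
def gram (x : M) (G : TangentSpace (𝓡 m) x → TangentSpace (𝓡 m) x → ℝ) :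
    Matrix (Fin m) (Fin m) ℝ :=
  Matrix.of fun i j => G (basisVec x i) (basisVec x j)

/-- The trace `∑ G^{ij} A_{ij}` of a (possibly vector valued) bilinear form `A` with respect to an
inner product `G`. -/
def trG {V : Type*} [AddCommGroup V] [Module ℝ V] (x : M)
    (G : TangentSpace (𝓡 m) x → TangentSpace (𝓡 m) x → ℝ)
    (A : TangentSpace (𝓡 m) x → TangentSpace (𝓡 m) x → V) : V :=
  ∑ i, ∑ j, (gram x G)⁻¹ i j • A (basisVec x i) (basisVec x j)

/-- The symmetric part of a bilinear form. -/
def symPart {x : M} (A : TangentSpace (𝓡 m) x → TangentSpace (𝓡 m) x → ℝ)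
    (X Y : TangentSpace (𝓡 m) x) : ℝ :=
  (A X Y + A Y X) / 2

/-- A smooth field of bilinear forms. -/
def IsSmoothBilin [IsManifold (𝓡 m) ∞ M]
    (b : Π x : M, TangentSpace (𝓡 m) x →L[ℝ] TangentSpace (𝓡 m) x →L[ℝ] ℝ) : Prop :=
  ContMDiff (𝓡 m) ((𝓡 m).prod
      𝓘(ℝ, EuclideanSpace ℝ (Fin m) →L[ℝ] EuclideanSpace ℝ (Fin m) →L[ℝ] ℝ)) ∞
    (fun x => TotalSpace.mk' (EuclideanSpace ℝ (Fin m) →L[ℝ] EuclideanSpace ℝ (Fin m) →L[ℝ] ℝ)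
      (E := fun x : M => TangentSpace (𝓡 m) x →L[ℝ] TangentSpace (𝓡 m) x →L[ℝ] ℝ) x (b x))

variable [IsManifold (𝓡 m) ∞ M]

/-- The part of the bilinear form `A` at `x` that is trace-free with respect to `g`. -/
def traceFree (g : Metric m M) (x : M)
    (A : TangentSpace (𝓡 m) x → TangentSpace (𝓡 m) x → ℝ) (X Y : TangentSpace (𝓡 m) x) : ℝ :=
  A X Y - (1 / (m : ℝ)) * trG x (fun v w => g.inner x v w) A * g.inner x X Y

/-- `g' = e^{2φ} g`. -/
def IsRescaling (g g' : Metric m M) (φ : M → ℝ) : Prop :=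
  ∀ (x : M) (X Y : TangentSpace (𝓡 m) x),
    g'.inner x X Y = Real.exp (2 * φ x) * g.inner x X Y

variable (m M) in
/-- A conformal structure, as the class of all Riemannian metrics that are conformal to a given
one; in terms of an `L²`-valued inner product `c`, the class consists of the metrics
`l⁻² c`, for `l` a positive section of the weight bundle `L`. -/
structure ConformalStructure where
  metrics : Set (Metric m M)
  nonempty : metrics.Nonempty
  mem_iff : ∀ g ∈ metrics, ∀ g' : Metric m M,
    g' ∈ metrics ↔ ∃ φ : M → ℝ, ContMDiff (𝓡 m) 𝓘(ℝ, ℝ) ∞ φ ∧ IsRescaling g g' φ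

/-- Smooth sections of the weight bundle `L` of a conformal manifold: conformal densities of weight
one. A metric `g` of the class corresponds to a positive section `u` of `L`, by `g = u⁻² c`, and
the function `l.toFun g` is the quotient `l / u`. If `g' = e^{2φ} g`, then `u' = e^{-φ} u`. -/
structure LSection (c : ConformalStructure m M) where
  toFun : c.metrics → M → ℝ
  smooth : ∀ g, ContMDiff (𝓡 m) 𝓘(ℝ, ℝ) ∞ (toFun g)
  weight : ∀ (g g' : c.metrics) (φ : M → ℝ), IsRescaling g.1 g'.1 φ →
    ∀ x, toFun g' x = Real.exp (φ x) * toFun g x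

/-- Not necessarily smooth sections of `T*M ⊗ T*M ⊗ L`, described through their components with
respect to the metrics of the class. -/
abbrev LForm (c : ConformalStructure m M) :=
  c.metrics → Π x : M, TangentSpace (𝓡 m) x → TangentSpace (𝓡 m) x → ℝ

/-- `A` is a smooth section of `S²₀M ⊗ L`. -/
def IsSmoothTraceFreeSymm (c : ConformalStructure m M) (A : LForm c) : Prop :=
  ∃ B : c.metrics → Π x : M, TangentSpace (𝓡 m) x →L[ℝ] TangentSpace (𝓡 m) x →L[ℝ] ℝ,
    (∀ g x X Y, A g x X Y = B g x X Y) ∧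
    (∀ g, IsSmoothBilin (B g)) ∧
    (∀ g x X Y, B g x X Y = B g x Y X) ∧
    (∀ g x, trG x (fun v w => g.1.inner x v w) (fun v w => B g x v w) = 0) ∧
    ∀ (g g' : c.metrics) (φ : M → ℝ), IsRescaling g.1 g'.1 φ →
      ∀ x X Y, B g' x X Y = Real.exp (φ x) * B g x X Y

/-! ### Weyl structures -/

/-- The covariant derivative `(∇_v g)(Y, Z)` of a metric. -/
def nablaMetric (D : Conn m M) (g : Metric m M) (x : M) (v Y Z : TangentSpace (𝓡 m) x) : ℝ :=
  mvfderiv (𝓡 m) (fun y => g.inner y (FiberBundle.extend (EuclideanSpace ℝ (Fin m)) Y y)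
      (FiberBundle.extend (EuclideanSpace ℝ (Fin m)) Z y)) x v
    - g.inner x (D (FiberBundle.extend (EuclideanSpace ℝ (Fin m)) Y) x v) Z
    - g.inner x Y (D (FiberBundle.extend (EuclideanSpace ℝ (Fin m)) Z) x v)

/-- The connection form of the connection induced on the weight bundle `L`, in the trivialization
given by the metric `g`: if `g = u⁻² c`, then `∇ u = lForm ⊗ u`. As `u^{-m}` is the volume density
of `g`, this form is `-1/(2m)` times the trace of `∇ g`. -/
def lForm (D : Conn m M) (g : Metric m M) (x : M) (v : TangentSpace (𝓡 m) x) : ℝ :=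
  -(1 / (2 * (m : ℝ))) * trG x (fun Y Z => g.inner x Y Z) (fun Y Z => nablaMetric D g x v Y Z)

/-- A Weyl structure: a smooth torsion-free connection on `TM` with `∇ c = 0`, where `c = g ⊗ u²`,
for each metric `g` of the class and the corresponding section `u` of `L`. -/
structure WeylStructure (c : ConformalStructure m M) where
  cov : CovariantDerivative (𝓡 m) (EuclideanSpace ℝ (Fin m)) (fun x : M => TangentSpace (𝓡 m) x)
  smooth : CovariantDerivative.ContMDiffCovariantDerivative cov ∞
  torsion_free : cov.torsion = 0
  conformal : ∀ g ∈ c.metrics, ∀ (x : M) (v Y Z : TangentSpace (𝓡 m) x),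
    nablaMetric cov.toFun g x v Y Z + 2 * lForm cov.toFun g x v * g.inner x Y Z = 0

/-- Covariant derivative of the section `f ⊗ u` of a line bundle, where `∇ u = β ⊗ u`, as a
multiple of `u`. -/
def lineDeriv (β : Π x : M, TangentSpace (𝓡 m) x → ℝ) (f : M → ℝ) (x : M)
    (v : TangentSpace (𝓡 m) x) : ℝ :=
  mvfderiv (𝓡 m) f x v + β x v * f x

/-- The Hessian `∇_X ∇_Y l - ∇_{∇_X Y} l` of the section `l = f ⊗ u` of a line bundle, where
`∇ u = β ⊗ u`, as a multiple of `u`. -/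
def hessian (β : Π x : M, TangentSpace (𝓡 m) x → ℝ) (D : Conn m M) (f : M → ℝ) (x : M)
    (X Y : TangentSpace (𝓡 m) x) : ℝ :=
  lineDeriv β
      (fun y => lineDeriv β f y (FiberBundle.extend (EuclideanSpace ℝ (Fin m)) Y y)) x X
    - lineDeriv β f x (D (FiberBundle.extend (EuclideanSpace ℝ (Fin m)) Y) x X)

/-- The symmetric trace-free Hessian `Hess₀ l` of a section of `L`. -/
def hessZero {c : ConformalStructure m M} (D : Conn m M) (l : LSection c) : LForm c :=
  fun g x X Y => traceFree (g : Metric m M) x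
    (symPart (hessian (lForm D g) D (l.toFun g) x)) X Y

/-! ### Curvature -/

/-- `R_{X,Y} Z = ∇_X ∇_Y Z - ∇_Y ∇_X Z - ∇_{[X,Y]} Z`. -/
def curvature (D : Conn m M) (x : M) (X Y Z : TangentSpace (𝓡 m) x) : TangentSpace (𝓡 m) x :=
  D (fun y => D (FiberBundle.extend (EuclideanSpace ℝ (Fin m)) Z) y
      (FiberBundle.extend (EuclideanSpace ℝ (Fin m)) Y y)) x X
    - D (fun y => D (FiberBundle.extend (EuclideanSpace ℝ (Fin m)) Z) y
      (FiberBundle.extend (EuclideanSpace ℝ (Fin m)) X y)) x Y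
    - D (FiberBundle.extend (EuclideanSpace ℝ (Fin m)) Z) x
      (VectorField.mlieBracket (𝓡 m) (FiberBundle.extend (EuclideanSpace ℝ (Fin m)) X)
        (FiberBundle.extend (EuclideanSpace ℝ (Fin m)) Y) x)

/-- The Ricci tensor `Ric(X, Y) = tr (Z ↦ R_{Z,X} Y)`. -/
def ricci (D : Conn m M) (x : M) (X Y : TangentSpace (𝓡 m) x) : ℝ :=
  endTrace x fun Z => curvature D x Z X Y

/-- The Faraday form: the identity component of `R_{X,Y}`. -/
def faraday (D : Conn m M) (x : M) (X Y : TangentSpace (𝓡 m) x) : ℝ :=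
  (1 / (m : ℝ)) * endTrace x fun Z => curvature D x X Y Z

/-- The scalar curvature `tr_c Ric`, a section of `L⁻²`, in the trivialization given by `g`. -/
def scal (D : Conn m M) (g : Metric m M) (x : M) : ℝ :=
  trG x (fun v w => g.inner x v w) (ricci D x)

/-- The symmetric Schouten-Weyl tensor, in dimension `m ≥ 3`. It depends only on the conformal
class of `g`. -/
def schoutenSym (D : Conn m M) (g : Metric m M) (x : M) (X Y : TangentSpace (𝓡 m) x) : ℝ :=
  (1 / ((m : ℝ) - 2)) * traceFree g x (symPart (ricci D x)) X Y
    + (1 / (2 * (m : ℝ) * ((m : ℝ) - 1))) * scal D g x * g.inner x X Y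

/-- The full Schouten-Weyl tensor `h = hˢ - F / 2`, in dimension `m ≥ 3`. -/
def schouten (D : Conn m M) (g : Metric m M) (x : M) (X Y : TangentSpace (𝓡 m) x) : ℝ :=
  schoutenSym D g x X Y - (1 / 2) * faraday D x X Y

/-! ### Möbius structures -/

/-- A Möbius structure: an operator from sections of `L` to sections of `S²₀M ⊗ L` that differs
from the trace-free Hessian of some Weyl structure by a scalar operator, i.e. by the
multiplication with a section of `S²₀M`. (It is then a linear differential operator of second
order.) -/
def IsMobiusStructure (c : ConformalStructure m M) (P : LSection c → LForm c) : Prop :=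
  (∀ l, IsSmoothTraceFreeSymm c (P l)) ∧
  ∃ (W : WeylStructure c)
    (b : Π x : M, TangentSpace (𝓡 m) x →L[ℝ] TangentSpace (𝓡 m) x →L[ℝ] ℝ),
    IsSmoothBilin b ∧ (∀ x X Y, b x X Y = b x Y X) ∧
    (∀ g ∈ c.metrics, ∀ x, trG x (fun v w => g.inner x v w) (fun v w => b x v w) = 0) ∧
    ∀ l g x X Y, P l g x X Y = hessZero W.cov.toFun l g x X Y + b x X Y * l.toFun g x

/-- The canonical Möbius operator `Hess₀ l + h₀ l`, with `h₀` the symmetric trace-free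
Schouten-Weyl tensor, in dimension `m ≥ 3`. -/
def canonicalMobius {c : ConformalStructure m M} (D : Conn m M) (l : LSection c) : LForm c :=
  fun g x X Y => hessZero D l g x X Y
    + traceFree (g : Metric m M) x (schoutenSym D g x) X Y * l.toFun g x

open Classical in
/-- The tensor `h₀ = P - Hess₀` that a Möbius structure `P` associates to a Weyl structure. -/
def mobiusSchoutenZero {c : ConformalStructure m M} (P : LSection c → LForm c) (D : Conn m M) :
    Π x : M, TangentSpace (𝓡 m) x →L[ℝ] TangentSpace (𝓡 m) x →L[ℝ] ℝ :=
  if hb : ∃ b : Π x : M, TangentSpace (𝓡 m) x →L[ℝ] TangentSpace (𝓡 m) x →L[ℝ] ℝ,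
      ∀ l g x X Y, P l g x X Y = hessZero D l g x X Y + b x X Y * l.toFun g x
  then hb.choose else 0

/-- The Schouten-Weyl tensor of a Weyl structure on a Möbius surface: its trace-free symmetric part
is given by the Möbius structure, its trace part is `(1/4) scal c`, its skew part is `-F / 2`. -/
def surfaceSchouten {c : ConformalStructure m M} (P : LSection c → LForm c) (D : Conn m M)
    (g : Metric m M) (x : M) (X Y : TangentSpace (𝓡 m) x) : ℝ :=
  mobiusSchoutenZero P D x X Y + (1 / 4) * scal D g x * g.inner x X Y
    - (1 / 2) * faraday D x X Y

end Intrinsic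

/-! ### Submanifolds

In this part `g` is a metric of the conformal class of `M`. -/

section Extrinsic

variable {m n : ℕ}
  {M : Type*} [TopologicalSpace M] [ChartedSpace (EuclideanSpace ℝ (Fin m)) M]
  [IsManifold (𝓡 m) ∞ M]
  {N : Type*} [TopologicalSpace N] [ChartedSpace (EuclideanSpace ℝ (Fin n)) N]

/-- The differential of `ι : N → M` at `x`. -/
abbrev dmap (ι : N → M) (x : N) : TangentSpace (𝓡 n) x →L[ℝ] TangentSpace (𝓡 m) (ι x) :=
  mfderiv (𝓡 n) (𝓡 m) ι x

/-- The pulled back inner product on the tangent space of `N` at `x`. -/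
def pullInner (g : Metric m M) (ι : N → M) (x : N) (X Y : TangentSpace (𝓡 n) x) : ℝ :=
  g.inner (ι x) (dmap ι x X) (dmap ι x Y)

/-- The orthogonal projection from the tangent space of `M` to the tangent space of `N`. -/
def tanProj (g : Metric m M) (ι : N → M) (x : N) :
    TangentSpace (𝓡 m) (ι x) →L[ℝ] TangentSpace (𝓡 n) x :=
  ∑ i : Fin n, (∑ j : Fin n, (gram (m := n) x (pullInner g ι x))⁻¹ i j •
    g.inner (ι x) (dmap (m := m) (n := n) ι x (basisVec x j))).smulRight (basisVec x i)

/-- The normal component of a tangent vector of `M` at a point of `N`. -/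
def norProj (g : Metric m M) (ι : N → M) (x : N) (v : TangentSpace (𝓡 m) (ι x)) :
    TangentSpace (𝓡 m) (ι x) :=
  v - dmap ι x (tanProj (n := n) g ι x v)

/-- The covariant derivative along `ι` of a vector field `V` of `M` along `N`, that is, of a
section of the pulled back bundle `ι^* TM`: the components of `V` in a local frame of `TM` are
differentiated on `N`, and the frame is differentiated by means of the connection `D` on `M`. -/
def alongDeriv (ι : N → M) (D : Conn m M) (V : Π y : N, TangentSpace (𝓡 m) (ι y)) (x : N) :
    TangentSpace (𝓡 n) x →L[ℝ] TangentSpace (𝓡 m) (ι x) :=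
  ((trivializationAt (EuclideanSpace ℝ (Fin m))
      (fun p : M => TangentSpace (𝓡 m) p) (ι x)).symmL ℝ (ι x)).comp
    (mvfderiv (𝓡 n) (fun y => (trivializationAt (EuclideanSpace ℝ (Fin m))
      (fun p : M => TangentSpace (𝓡 m) p) (ι x) ⟨ι y, V y⟩).2) x)
  + (D (FiberBundle.extend (EuclideanSpace ℝ (Fin m)) (V x)) (ι x)).comp (dmap ι x)

/-- The induced connection `∇^N_X Y = (∇_X Y)^N` on `N`. -/
def inducedConn (g : Metric m M) (ι : N → M) (D : Conn m M) : Conn n N :=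
  fun Y x => (tanProj g ι x).comp (alongDeriv ι D (fun y => dmap ι y (Y y)) x)

variable [IsManifold (𝓡 n) ∞ N]

/-- `cN` is the conformal structure that `c` induces on `N`. -/
def IsInducedConformal (ι : N → M) (c : ConformalStructure m M) (cN : ConformalStructure n N) :
    Prop :=
  ∀ g ∈ c.metrics, ∀ h ∈ cN.metrics, ∃ φ : N → ℝ, ContMDiff (𝓡 n) 𝓘(ℝ, ℝ) ∞ φ ∧
    ∀ (x : N) (X Y : TangentSpace (𝓡 n) x),
      h.inner x X Y = Real.exp (2 * φ x) * pullInner g ι x X Y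

/-- The fundamental form `B(X, Y) = (∇_X Y)^⊥`. -/
def fundForm (g : Metric m M) (ι : N → M) (D : Conn m M) (x : N) (X Y : TangentSpace (𝓡 n) x) :
    TangentSpace (𝓡 m) (ι x) :=
  norProj (n := n) g ι x (alongDeriv ι D
    (fun y => dmap ι y (FiberBundle.extend (EuclideanSpace ℝ (Fin n)) Y y)) x X)

/-- The mean curvature vector `(1/n) tr_g B`. The mean curvature `H`, a section of the dual of the
normal bundle that does not depend on the choice of `g` in the class, is `g(meanVec, ·)`. -/
def meanVec (g : Metric m M) (ι : N → M) (D : Conn m M) (x : N) : TangentSpace (𝓡 m) (ι x) :=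
  (1 / (n : ℝ)) • trG (m := n) x (pullInner g ι x) (fundForm g ι D x)

/-- The mean curvature `H`, as a linear form on normal vectors. -/
def meanCurv (g : Metric m M) (ι : N → M) (D : Conn m M) (x : N)
    (ξ : TangentSpace (𝓡 m) (ι x)) : ℝ :=
  g.inner (ι x) (meanVec (n := n) g ι D x) ξ

/-- The trace-free fundamental form `B₀ = B - H · c`. -/
def fundFormZero (g : Metric m M) (ι : N → M) (D : Conn m M) (x : N)
    (X Y : TangentSpace (𝓡 n) x) : TangentSpace (𝓡 m) (ι x) :=
  fundForm g ι D x X Y - pullInner g ι x X Y • meanVec (n := n) g ι D x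

/-- The function `φ` with `h = e^{2φ} ι^* g`. -/
def logFactor (g : Metric m M) (ι : N → M) (h : Metric n N) (x : N) : ℝ :=
  (1 / 2) * Real.log ((1 / (n : ℝ)) * trG (m := n) x (pullInner g ι x) (fun v w => h.inner x v w))

/-- The connection form of the restriction of `∇^L` to the weight bundle of `N`, which is the
restriction of the weight bundle of `M`, in the trivialization given by a metric `h` of the induced
class: if `g = u⁻² c` and `h = e^{2φ} ι^* g`, then this trivialization is `e^{-φ} u`. -/
def restrictedLForm (g : Metric m M) (ι : N → M) (D : Conn m M) (h : Metric n N) (x : N)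
    (v : TangentSpace (𝓡 n) x) : ℝ :=
  lForm D g (ι x) (dmap ι x v) - mvfderiv (𝓡 n) (logFactor g ι h) x v

/-- The operator `P(X, Y) l = (∇_X ∇_Y - ∇_{(∇_X Y)^N}) l + h(X, Y) l` on sections of the weight
bundle of `N`. -/
def opP (g : Metric m M) (ι : N → M) (D : Conn m M) {cN : ConformalStructure n N}
    (l : LSection cN) : LForm cN :=
  fun h x X Y => hessian (restrictedLForm g ι D h) (inducedConn g ι D) (l.toFun h) x X Y
    + schouten D g (ι x) (dmap ι x X) (dmap ι x Y) * l.toFun h x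

/-- The induced Möbius operator `M^ind(X, Y) l = P₀(X, Y) l + H(B₀(X, Y)) l`. -/
def inducedMobius (g : Metric m M) (ι : N → M) (D : Conn m M) {cN : ConformalStructure n N}
    (l : LSection cN) : LForm cN :=
  fun h x X Y => traceFree (h : Metric n N) x (opP g ι D l h x) X Y
    + meanCurv (n := n) g ι D x (fundFormZero g ι D x X Y) * l.toFun h x

/-- The section `lM` of the weight bundle of `M` restricts to the section `l` of the weight bundle
of `N` in a neighbourhood of `x`. -/
def RestrictsNear {c : ConformalStructure m M} {cN : ConformalStructure n N} (ι : N → M)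
    (lM : LSection c) (l : LSection cN) (x : N) : Prop :=
  ∀ (g : c.metrics) (h : cN.metrics), ∀ᶠ y in 𝓝 x,
    l.toFun h y = Real.exp (logFactor g.1 ι h.1 y) * lM.toFun g (ι y)

/-- The second expression of the induced Möbius operator, at `x`, through the Hessian on `M`
of a section `lM` of the weight bundle of `M`: the sum
`Hess_{0,N}(X, Y) lM + ∇_{B₀(X, Y)} lM + h_{0,N}(X, Y) lM + H(B₀(X, Y)) lM`, where `0,N` is the
trace-free part along `TN`. It is a multiple of the weight one section `u` of `L` with
`g = u⁻² c`; the exponential converts this into a multiple of the section given by `h`. -/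
def ambientMobius (ι : N → M) (D : Conn m M) {c : ConformalStructure m M} (lM : LSection c)
    (g : c.metrics) (h : Metric n N) (x : N) (X Y : TangentSpace (𝓡 n) x) : ℝ :=
  Real.exp (logFactor (g : Metric m M) ι h x) *
    (traceFree h x (fun v w => hessian (lForm D g) D (lM.toFun g) (ι x)
        (dmap ι x v) (dmap ι x w)) X Y
      + lineDeriv (lForm D g) (lM.toFun g) (ι x) (fundFormZero (g : Metric m M) ι D x X Y)
      + traceFree h x (fun v w => schouten D g (ι x) (dmap ι x v) (dmap ι x w)) X Y
        * lM.toFun g (ι x)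
      + meanCurv (n := n) (g : Metric m M) ι D x (fundFormZero (g : Metric m M) ι D x X Y)
        * lM.toFun g (ι x))

/-- The relative Schouten-Weyl tensor
`ρ(X, Y) = (h^M - h^N)(X, Y) + (1/2) c(H, H) c(X, Y) + H(B₀(X, Y))`, where `hN` is the
Schouten-Weyl tensor on `N` of the induced Weyl structure. -/
def relSchouten (g : Metric m M) (ι : N → M) (D : Conn m M) (x : N)
    (hN : TangentSpace (𝓡 n) x → TangentSpace (𝓡 n) x → ℝ) (X Y : TangentSpace (𝓡 n) x) : ℝ :=
  schouten D g (ι x) (dmap ι x X) (dmap ι x Y) - hN X Y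
    + (1 / 2) * g.inner (ι x) (meanVec (n := n) g ι D x) (meanVec (n := n) g ι D x) * pullInner g ι x X Y
    + meanCurv (n := n) g ι D x (fundFormZero g ι D x X Y)

end Extrinsic

end ConfGeom

end

/-!
The proof is a comparison of the geometry of `N` with that of `M` by means of the induced Weyl
structure `∇^N = (∇)^N`.

**The induced Weyl structure.** Functions and vector fields along an embedded submanifold extend
locally to `M` (`exists_smoothFun_extension`, `exists_smoothField_extension`), so the derivative
along `N` is the ambient derivative of an extension (`alongDeriv_eq`). Hence the tangential part of
`∇` is a smooth torsion-free connection, the normal part is a symmetric bilinear form `B`, and the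
Gauss formula (`gauss_formula`) holds. The induced connection is a Weyl structure (`inducedWeyl`),
and the connection that it defines on the weight bundle is the restriction of the ambient one
(`lForm_inducedConn`). In particular its Faraday form, which is the curvature of the weight bundle
(`Compat.faraday_eq`), is the restriction of the ambient one (`faraday_inducedConn`).

**The shape of the operator.** Therefore the skew parts of the Hessian on `N` and of the ambient
Schouten-Weyl tensor cancel, and the induced operator is the trace-free Hessian of `∇^N` plus the
multiplication with the trace-free part of `hˢ|_N + H ∘ B` (`inducedMobius_eq`), which makes it a
Möbius structure (`inducedMobius_isMobiusStructure`). For the ambient expression, the Gauss formula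
gives `Hess^N l = Hess l|_N + ∇_B l` (`hessian_restrict`), and the trace-free part of the second
term is `∇_{B₀} l` (`traceFree_fundForm`).

**Independence of the Weyl structure.** Two Weyl structures differ by a one-form `θ`
(`exists_connChange`). Up to pure trace, the Hessian changes by `sym ∇θ - θ ⊗ θ`
(`ConnChange.hessian_eq`) and `hˢ` by the opposite (`ConnChange.exists_schoutenSym_eq`). On `N` the
first of these is applied to `∇^N` and to the restriction of `θ`; as
`∇^N (θ|_N) = (∇θ)|_N + θ ∘ B` (`nablaForm_pullback`), there remains `θ(B₀)`, and this is the amount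
by which `H(B₀)` decreases (`ConnChange.meanCurv_fundFormZero_eq`).

**The comparison with a Möbius structure of `N`.** Both operators are scalar perturbations of the
Hessian of the same Weyl structure `∇^N` (`canonicalMobius_eq`, `IsMobiusStructure.exists_eq`), so
the Hessians cancel. In the relative Schouten-Weyl tensor the Faraday forms cancel as well, and the
term with `c(H, H)` has no trace-free part (`traceFree_relSchouten`).
-/

namespace ConfGeom

set_option linter.unusedSectionVars false

/-! ### Inner products on a tangent space -/

/-- A positive definite inner product on a vector space, as an unbundled function. -/
structure IsInner {V : Type*} [AddCommGroup V] [Module ℝ V] (G : V → V → ℝ) : Prop where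
  bilin : IsBilinearMap ℝ G
  symm : ∀ v w, G v w = G w v
  pos : ∀ v, v ≠ 0 → 0 < G v v

section Bilinear

variable {V : Type*} [AddCommGroup V] [Module ℝ V]

theorem IsInner.eq_zero {G : V → V → ℝ} (hG : IsInner G) {v : V} (h : ∀ w, G v w = 0) : v = 0 := by
  by_contra hv
  exact (hG.pos v hv).ne' (h v)

theorem IsInner.ext {G : V → V → ℝ} (hG : IsInner G) {v w : V} (h : ∀ u, G v u = G w u) :
    v = w := by
  rw [← sub_eq_zero]
  refine hG.eq_zero fun u => ?_
  have := hG.bilin.toLinearMap.map_sub₂ v w u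
  change G (v - w) u = G v u - G w u at this
  rw [this, h, sub_self]

theorem IsInner.exists_orthonormal {G : V → V → ℝ} (hG : IsInner G) [FiniteDimensional ℝ V]
    {m : ℕ} (hm : Module.finrank ℝ V = m) :
    ∃ b : Module.Basis (Fin m) ℝ V, ∀ i j, G (b i) (b j) = if i = j then 1 else 0 := by
  subst hm
  have hs : LinearMap.IsSymm (hG.bilin.toLinearMap) := ⟨fun v w => hG.symm v w⟩
  obtain ⟨b, hb⟩ := LinearMap.BilinForm.exists_orthogonal_basis hs
  have hpos : ∀ i, 0 < G (b i) (b i) := fun i => hG.pos _ (b.ne_zero i)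
  have hu : ∀ i, IsUnit ((Real.sqrt (G (b i) (b i)))⁻¹) := fun i =>
    (isUnit_iff_ne_zero.2 (inv_ne_zero (Real.sqrt_ne_zero'.2 (hpos i))))
  refine ⟨b.isUnitSMul hu, fun i j => ?_⟩
  rw [Module.Basis.isUnitSMul_apply, Module.Basis.isUnitSMul_apply, hG.bilin.smul_left,
    hG.bilin.smul_right]
  split_ifs with h
  · subst h
    have := Real.mul_self_sqrt (hpos i).le
    have h0 := (Real.sqrt_ne_zero'.2 (hpos i))
    simp only [smul_eq_mul]
    field_simp
    rw [pow_two, this]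
  · have : G (b i) (b j) = 0 := hb h
    simp [this]

theorem IsBilinearMap.sum_left {W : Type*} [AddCommGroup W] [Module ℝ W] {A : V → V → W}
    (hA : IsBilinearMap ℝ A) {κ : Type*} (s : Finset κ) (f : κ → V) (w : V) :
    A (∑ i ∈ s, f i) w = ∑ i ∈ s, A (f i) w :=
  map_sum (hA.toLinearMap.flip w) f s

theorem IsBilinearMap.sum_right {W : Type*} [AddCommGroup W] [Module ℝ W] {A : V → V → W}
    (hA : IsBilinearMap ℝ A) {κ : Type*} (s : Finset κ) (f : κ → V) (w : V) :
    A w (∑ i ∈ s, f i) = ∑ i ∈ s, A w (f i) :=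
  map_sum (hA.toLinearMap w) f s

/-- The expansion of a vector in an orthonormal basis. -/
theorem IsInner.repr_eq {G : V → V → ℝ} (hG : IsInner G) {κ : Type*} [Fintype κ] [DecidableEq κ]
    {b : Module.Basis κ ℝ V} (hb : ∀ i j, G (b i) (b j) = if i = j then 1 else 0) (v : V) (i : κ) :
    b.repr v i = G v (b i) := by
  conv_rhs => rw [← b.sum_repr v, IsBilinearMap.sum_left hG.bilin]
  simp [hG.bilin.smul_left, hb]

theorem IsInner.sum_smul {G : V → V → ℝ} (hG : IsInner G) {κ : Type*} [Fintype κ] [DecidableEq κ]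
    {b : Module.Basis κ ℝ V} (hb : ∀ i j, G (b i) (b j) = if i = j then 1 else 0) (v : V) :
    ∑ i, G v (b i) • b i = v := by
  conv_rhs => rw [← b.sum_repr v]
  simp only [hG.repr_eq hb]

theorem IsInner.smul {G : V → V → ℝ} (hG : IsInner G) {a : ℝ} (ha : 0 < a) :
    IsInner (fun v w => a * G v w) where
  bilin := ⟨fun _ _ _ => by simp [hG.bilin.add_left, mul_add],
    fun _ _ _ => by simp [hG.bilin.smul_left, mul_left_comm],
    fun _ _ _ => by simp [hG.bilin.add_right, mul_add],
    fun _ _ _ => by simp [hG.bilin.smul_right, mul_left_comm]⟩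
  symm v w := by rw [hG.symm]
  pos v hv := mul_pos ha (hG.pos v hv)

end Bilinear

section Trace

variable {m : ℕ} {M : Type*} [TopologicalSpace M] [ChartedSpace (EuclideanSpace ℝ (Fin m)) M]
  {x : M}

instance finiteDimensional_tangentSpace : FiniteDimensional ℝ (TangentSpace (𝓡 m) x) :=
  inferInstanceAs (FiniteDimensional ℝ (EuclideanSpace ℝ (Fin m)))

theorem finrank_tangentSpace : Module.finrank ℝ (TangentSpace (𝓡 m) x) = m :=
  finrank_euclideanSpace_fin (𝕜 := ℝ) (n := m)

/-- The standard basis of the tangent space, as a bundled basis. -/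
noncomputable def stdBasis (x : M) : Module.Basis (Fin m) ℝ (TangentSpace (𝓡 m) x) :=
  (EuclideanSpace.basisFun (Fin m) ℝ).toBasis

theorem stdBasis_apply (i : Fin m) : stdBasis x i = basisVec x i :=
  EuclideanSpace.basisFun_apply (Fin m) ℝ i

theorem stdBasis_repr (v : TangentSpace (𝓡 m) x) (i : Fin m) :
    (stdBasis x).repr v i = coordAt x i v := rfl

theorem sum_coordAt (v : TangentSpace (𝓡 m) x) : ∑ i, coordAt x i v • basisVec x i = v := by
  simpa [stdBasis_apply, stdBasis_repr] using (stdBasis x).sum_repr v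

variable {V : Type*} [AddCommGroup V] [Module ℝ V]
  {G : TangentSpace (𝓡 m) x → TangentSpace (𝓡 m) x → ℝ}

theorem IsBilinearMap.apply_sum_smul {E W κ : Type*} [AddCommGroup E] [Module ℝ E]
    [AddCommGroup W] [Module ℝ W] [Fintype κ] {C : E → E → W} (hC : IsBilinearMap ℝ C)
    (p q : κ → ℝ) (e : κ → E) :
    C (∑ k, p k • e k) (∑ l, q l • e l) = ∑ k, ∑ l, (p k * q l) • C (e k) (e l) := by
  rw [IsBilinearMap.sum_left hC]
  refine Finset.sum_congr rfl fun k _ => ?_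
  rw [IsBilinearMap.sum_right hC]
  refine Finset.sum_congr rfl fun l _ => ?_
  rw [hC.smul_left, hC.smul_right, smul_smul]

/-- The trace of a bilinear form can be computed in any basis. -/
theorem trG_eq_of_basis (hG : IsBilinearMap ℝ G)
    {A : TangentSpace (𝓡 m) x → TangentSpace (𝓡 m) x → V} (hA : IsBilinearMap ℝ A)
    (b : Module.Basis (Fin m) ℝ (TangentSpace (𝓡 m) x)) :
    trG x G A = ∑ i, ∑ j, (Matrix.of fun i j => G (b i) (b j))⁻¹ i j • A (b i) (b j) := by
  -- `P` is the change of basis matrix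
  obtain ⟨P, Q, hPQ, hbe⟩ : ∃ P Q : Matrix (Fin m) (Fin m) ℝ, P * Q = 1 ∧
      ∀ j, b j = ∑ k, P k j • basisVec x k := by
    refine ⟨(stdBasis x).toMatrix b, b.toMatrix (stdBasis x),
      (stdBasis x).toMatrix_mul_toMatrix_flip b, fun j => ?_⟩
    simpa [stdBasis_apply] using ((stdBasis x).sum_toMatrix_smul_self b j).symm
  have hgram : (Matrix.of fun i j => G (b i) (b j)) = P.transpose * gram x G * P := by
    ext i j
    rw [Matrix.of_apply, hbe i, hbe j, IsBilinearMap.apply_sum_smul hG, Matrix.mul_apply,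
      Finset.sum_comm]
    refine Finset.sum_congr rfl fun l _ => ?_
    rw [Matrix.mul_apply, Finset.sum_mul]
    refine Finset.sum_congr rfl fun k _ => ?_
    simp only [Matrix.transpose_apply, gram, Matrix.of_apply, smul_eq_mul]
    ring
  have hPu : IsUnit P.det := by
    have := congrArg Matrix.det hPQ
    rw [Matrix.det_mul, Matrix.det_one] at this
    exact IsUnit.of_mul_eq_one _ this
  obtain ⟨R, hR⟩ : ∃ R, R = (Matrix.of fun i j => G (b i) (b j))⁻¹ := ⟨_, rfl⟩
  have hinv : (gram x G)⁻¹ = P * R * P.transpose := by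
    have hPt : IsUnit P.transpose.det := by rwa [Matrix.det_transpose]
    rw [hR, hgram, Matrix.mul_inv_rev, Matrix.mul_inv_rev, ← Matrix.mul_assoc, ← Matrix.mul_assoc,
      Matrix.mul_nonsing_inv _ hPu, Matrix.one_mul, Matrix.mul_assoc,
      Matrix.nonsing_inv_mul _ hPt, Matrix.mul_one]
  have hentry : ∀ k l, (gram x G)⁻¹ k l = ∑ i, ∑ j, R i j * (P k i * P l j) := by
    intro k l
    rw [hinv, Matrix.mul_apply, Finset.sum_comm]
    refine Finset.sum_congr rfl fun j _ => ?_
    rw [Matrix.mul_apply, Finset.sum_mul]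
    refine Finset.sum_congr rfl fun i _ => ?_
    rw [Matrix.transpose_apply]; ring
  have e1 : ∀ F : Fin m → Fin m → Fin m → Fin m → V,
      ∑ k, ∑ l, ∑ i, ∑ j, F k l i j = ∑ i, ∑ j, ∑ k, ∑ l, F k l i j := by
    intro F
    calc _ = ∑ k, ∑ i, ∑ l, ∑ j, F k l i j := Finset.sum_congr rfl fun l _ => Finset.sum_comm
      _ = ∑ i, ∑ k, ∑ l, ∑ j, F k l i j := Finset.sum_comm
      _ = ∑ i, ∑ k, ∑ j, ∑ l, F k l i j := Finset.sum_congr rfl fun i _ =>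
        Finset.sum_congr rfl fun j _ => Finset.sum_comm
      _ = _ := Finset.sum_congr rfl fun i _ => Finset.sum_comm
  rw [← hR]
  unfold trG
  simp_rw [hentry, Finset.sum_smul]
  rw [e1]
  refine Finset.sum_congr rfl fun i _ => Finset.sum_congr rfl fun j _ => ?_
  rw [hbe i, hbe j, IsBilinearMap.apply_sum_smul hA, Finset.smul_sum]
  refine Finset.sum_congr rfl fun k _ => ?_
  rw [Finset.smul_sum]
  refine Finset.sum_congr rfl fun l _ => ?_
  rw [smul_smul]

theorem trG_eq_of_orthonormal (hG : IsBilinearMap ℝ G)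
    {A : TangentSpace (𝓡 m) x → TangentSpace (𝓡 m) x → V} (hA : IsBilinearMap ℝ A)
    {b : Module.Basis (Fin m) ℝ (TangentSpace (𝓡 m) x)}
    (hb : ∀ i j, G (b i) (b j) = if i = j then 1 else 0) :
    trG x G A = ∑ i, A (b i) (b i) := by
  rw [trG_eq_of_basis hG hA b]
  have : (Matrix.of fun i j => G (b i) (b j)) = 1 := by
    ext i j; simp [hb, Matrix.one_apply]
  rw [this, inv_one]
  simp [Matrix.one_apply, ite_smul]

theorem trG_self (hG : IsInner G) : trG x G G = (m : ℝ) := by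
  obtain ⟨b, hb⟩ := hG.exists_orthonormal finrank_tangentSpace
  rw [trG_eq_of_orthonormal hG.bilin hG.bilin hb]
  simp [hb]

theorem trG_add (A B : TangentSpace (𝓡 m) x → TangentSpace (𝓡 m) x → V) :
    trG x G (fun X Y => A X Y + B X Y) = trG x G A + trG x G B := by
  simp [trG, smul_add, Finset.sum_add_distrib]

theorem trG_sub (A B : TangentSpace (𝓡 m) x → TangentSpace (𝓡 m) x → V) :
    trG x G (fun X Y => A X Y - B X Y) = trG x G A - trG x G B := by
  simp [trG, smul_sub, Finset.sum_sub_distrib]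

theorem trG_smul (a : ℝ) (A : TangentSpace (𝓡 m) x → TangentSpace (𝓡 m) x → V) :
    trG x G (fun X Y => a • A X Y) = a • trG x G A := by
  simp [trG, Finset.smul_sum, smul_comm a]

theorem trG_map {V' : Type*} [AddCommGroup V'] [Module ℝ V'] (L : V →ₗ[ℝ] V')
    (A : TangentSpace (𝓡 m) x → TangentSpace (𝓡 m) x → V) :
    trG x G (fun X Y => L (A X Y)) = L (trG x G A) := by
  simp [trG]

/-- A metric trace is homogeneous of degree `-1` in the inner product; this also holds for the junk
values at `a = 0` and for degenerate forms. -/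
theorem trG_rescale {a : ℝ} (A : TangentSpace (𝓡 m) x → TangentSpace (𝓡 m) x → V) :
    trG x (fun v w => a * G v w) A = a⁻¹ • trG x G A := by
  have : gram x (fun v w => a * G v w) = a • gram x G := by ext i j; simp [gram]
  unfold trG
  rw [this]
  rcases eq_or_ne a 0 with rfl | ha
  · -- the inverse of the zero matrix is zero
    simp
  · have := Matrix.inv_smul' (A := gram x G) (Units.mk0 a ha)
    by_cases hd : IsUnit (gram x G).det
    · have h2 := Matrix.inv_smul' (A := gram x G) (Units.mk0 a ha) hd
      have h3 : (a • gram x G)⁻¹ = a⁻¹ • (gram x G)⁻¹ := h2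
      rw [h3]
      simp [Finset.smul_sum, smul_smul]
    · -- both Gram matrices are singular, so that both inverses are zero
      have h3 : (a • gram x G)⁻¹ = 0 := by
        apply Matrix.nonsing_inv_apply_not_isUnit
        rw [Matrix.det_smul]
        intro h
        exact hd (isUnit_of_mul_isUnit_right h)
      rw [h3, Matrix.nonsing_inv_apply_not_isUnit _ hd]
      simp

/-- The trace of an endomorphism is the metric trace of the associated bilinear form. -/
theorem endTrace_eq_trG (hG : IsInner G) {f : TangentSpace (𝓡 m) x → TangentSpace (𝓡 m) x}
    (hf : IsLinearMap ℝ f) : endTrace x f = trG x G (fun v w => G (f v) w) := by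
  obtain ⟨b, hb⟩ := hG.exists_orthonormal finrank_tangentSpace
  have hbil : IsBilinearMap ℝ (fun v w => G (f v) w) :=
    ⟨fun _ _ _ => by rw [hf.map_add, hG.bilin.add_left],
      fun _ _ _ => by rw [hf.map_smul, hG.bilin.smul_left],
      fun _ _ _ => by rw [hG.bilin.add_right], fun _ _ _ => by rw [hG.bilin.smul_right]⟩
  rw [trG_eq_of_orthonormal hG.bilin hbil hb]
  have h1 := LinearMap.trace_eq_matrix_trace ℝ (stdBasis x) (IsLinearMap.mk' f hf)
  rw [LinearMap.trace_eq_matrix_trace ℝ b] at h1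
  simp only [Matrix.trace, Matrix.diag, LinearMap.toMatrix_apply, IsLinearMap.mk'_apply,
    hG.repr_eq hb] at h1
  rw [h1]
  simp [endTrace, stdBasis_repr, stdBasis_apply]

theorem endTrace_eq_sum (hG : IsInner G) {f : TangentSpace (𝓡 m) x → TangentSpace (𝓡 m) x}
    (hf : IsLinearMap ℝ f) {b : Module.Basis (Fin m) ℝ (TangentSpace (𝓡 m) x)}
    (hb : ∀ i j, G (b i) (b j) = if i = j then 1 else 0) :
    endTrace x f = ∑ i, G (f (b i)) (b i) := by
  have hbil : IsBilinearMap ℝ (fun v w => G (f v) w) :=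
    ⟨fun _ _ _ => by rw [hf.map_add, hG.bilin.add_left],
      fun _ _ _ => by rw [hf.map_smul, hG.bilin.smul_left],
      fun _ _ _ => by rw [hG.bilin.add_right], fun _ _ _ => by rw [hG.bilin.smul_right]⟩
  rw [endTrace_eq_trG hG hf, trG_eq_of_orthonormal hG.bilin hbil hb]

theorem isBilinearMap_symPart {A : TangentSpace (𝓡 m) x → TangentSpace (𝓡 m) x → ℝ}
    (hA : IsBilinearMap ℝ A) : IsBilinearMap ℝ (symPart A) :=
  ⟨fun _ _ _ => by simp only [symPart, hA.add_left, hA.add_right]; ring,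
    fun _ _ _ => by simp only [symPart, hA.smul_left, hA.smul_right, smul_eq_mul]; ring,
    fun _ _ _ => by simp only [symPart, hA.add_left, hA.add_right]; ring,
    fun _ _ _ => by simp only [symPart, hA.smul_left, hA.smul_right, smul_eq_mul]; ring⟩

end Trace

section TraceFree

variable {m : ℕ} {M : Type*} [TopologicalSpace M] [ChartedSpace (EuclideanSpace ℝ (Fin m)) M]
  [IsManifold (𝓡 m) ∞ M] {x : M}

theorem isInner_metric (g : Metric m M) (x : M) : IsInner (fun v w => g.inner x v w) where
  bilin := ⟨by simp, by simp, by simp, by simp⟩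
  symm := g.symm x
  pos := g.pos x

theorem traceFree_add (g : Metric m M) (A B : TangentSpace (𝓡 m) x → TangentSpace (𝓡 m) x → ℝ)
    (X Y : TangentSpace (𝓡 m) x) :
    traceFree g x (fun v w => A v w + B v w) X Y = traceFree g x A X Y + traceFree g x B X Y := by
  simp only [traceFree, trG_add]; ring

theorem traceFree_sub (g : Metric m M) (A B : TangentSpace (𝓡 m) x → TangentSpace (𝓡 m) x → ℝ)
    (X Y : TangentSpace (𝓡 m) x) :
    traceFree g x (fun v w => A v w - B v w) X Y = traceFree g x A X Y - traceFree g x B X Y := by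
  simp only [traceFree, trG_sub]; ring

theorem traceFree_mul (g : Metric m M) (a : ℝ)
    (A : TangentSpace (𝓡 m) x → TangentSpace (𝓡 m) x → ℝ) (X Y : TangentSpace (𝓡 m) x) :
    traceFree g x (fun v w => a * A v w) X Y = a * traceFree g x A X Y := by
  have := trG_smul (G := fun v w => g.inner x v w) a A
  simp only [smul_eq_mul] at this
  simp only [traceFree, this]; ring

theorem traceFree_metric (hm : m ≠ 0) (g : Metric m M) (X Y : TangentSpace (𝓡 m) x) :
    traceFree g x (fun v w => g.inner x v w) X Y = 0 := by
  have : (m : ℝ) ≠ 0 := Nat.cast_ne_zero.2 hm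
  rw [traceFree, trG_self (isInner_metric g x)]
  field_simp; ring

/-- The trace-free part does not see multiples of the metric. -/
theorem traceFree_congr_mod (hm : m ≠ 0) (g : Metric m M)
    {A B : TangentSpace (𝓡 m) x → TangentSpace (𝓡 m) x → ℝ} {κ : ℝ}
    (h : ∀ X Y, A X Y = B X Y + κ * g.inner x X Y) (X Y : TangentSpace (𝓡 m) x) :
    traceFree g x A X Y = traceFree g x B X Y := by
  have : A = fun v w => B v w + κ * (fun v w => g.inner x v w) v w := by ext; exact h _ _
  rw [this, traceFree_add, traceFree_mul, traceFree_metric hm]; ring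

theorem traceFree_of_trG_eq_zero (g : Metric m M)
    {A : TangentSpace (𝓡 m) x → TangentSpace (𝓡 m) x → ℝ}
    (h : trG x (fun v w => g.inner x v w) A = 0) (X Y : TangentSpace (𝓡 m) x) :
    traceFree g x A X Y = A X Y := by
  simp [traceFree, h]

theorem trG_traceFree (hm : m ≠ 0) (g : Metric m M)
    (A : TangentSpace (𝓡 m) x → TangentSpace (𝓡 m) x → ℝ) :
    trG x (fun v w => g.inner x v w) (traceFree g x A) = 0 := by
  have hm' : (m : ℝ) ≠ 0 := Nat.cast_ne_zero.2 hm
  have h1 := trG_smul (G := fun v w => g.inner x v w)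
    ((1 / (m : ℝ)) * trG x (fun v w => g.inner x v w) A) (fun v w => g.inner x v w)
  have : traceFree g x A = fun v w => A v w - ((1 / (m : ℝ)) *
    trG x (fun v w => g.inner x v w) A) • (fun v w => g.inner x v w) v w := by
    ext; simp [traceFree]
  rw [this, trG_sub, h1, trG_self (isInner_metric g x)]
  simp only [smul_eq_mul]; field_simp; ring

theorem isBilinearMap_traceFree (g : Metric m M)
    {A : TangentSpace (𝓡 m) x → TangentSpace (𝓡 m) x → ℝ}
    (hA : IsBilinearMap ℝ A) : IsBilinearMap ℝ (traceFree g x A) :=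
  ⟨fun _ _ _ => by simp only [traceFree, hA.add_left, map_add, add_apply]; ring,
    fun _ _ _ => by
      simp only [traceFree, hA.smul_left, map_smul, smul_eq_mul, smul_apply]
      ring,
    fun _ _ _ => by simp only [traceFree, hA.add_right, map_add]; ring,
    fun _ _ _ => by simp only [traceFree, hA.smul_right, map_smul, smul_eq_mul]; ring⟩

theorem traceFree_symm (g : Metric m M)
    {A : TangentSpace (𝓡 m) x → TangentSpace (𝓡 m) x → ℝ} (hA : ∀ v w, A v w = A w v)
    (X Y : TangentSpace (𝓡 m) x) : traceFree g x A X Y = traceFree g x A Y X := by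
  simp only [traceFree, hA X Y, g.symm x X Y]

/-- The trace-free part depends only on the conformal class of the metric. -/
theorem traceFree_rescale {g g' : Metric m M} {a : ℝ} (ha : a ≠ 0)
    (h : ∀ X Y, g'.inner x X Y = a * g.inner x X Y)
    (A : TangentSpace (𝓡 m) x → TangentSpace (𝓡 m) x → ℝ) : traceFree g' x A = traceFree g x A := by
  ext X Y
  have : (fun v w => g'.inner x v w) = fun v w => a * (fun v w => g.inner x v w) v w := by
    ext; exact h _ _
  simp only [traceFree]
  rw [h X Y, this, trG_rescale]
  simp only [smul_eq_mul]
  field_simp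

end TraceFree

/-! ### Smooth functions and vector fields -/

section Fields

variable {m : ℕ} {M : Type*} [TopologicalSpace M] [ChartedSpace (EuclideanSpace ℝ (Fin m)) M]

/-- Smooth real functions on `M`. -/
abbrev SmoothFun (f : M → ℝ) : Prop := ContMDiff (𝓡 m) 𝓘(ℝ, ℝ) ∞ f

variable [IsManifold (𝓡 m) ∞ M]

/-- Smooth vector fields on `M`, as smooth sections of the tangent bundle. -/
abbrev SmoothField (X : Π x : M, TangentSpace (𝓡 m) x) : Prop :=
  ContMDiff (𝓡 m) ((𝓡 m).prod 𝓘(ℝ, EuclideanSpace ℝ (Fin m))) ∞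
    (fun x => TotalSpace.mk' (EuclideanSpace ℝ (Fin m)) (E := fun x : M => TangentSpace (𝓡 m) x)
      x (X x))

theorem SmoothField.add {X Y : Π x : M, TangentSpace (𝓡 m) x} (hX : SmoothField X)
    (hY : SmoothField Y) : SmoothField (fun y => X y + Y y) :=
  ContMDiff.add_section hX hY

theorem SmoothField.sub {X Y : Π x : M, TangentSpace (𝓡 m) x} (hX : SmoothField X)
    (hY : SmoothField Y) : SmoothField (fun y => X y - Y y) :=
  ContMDiff.sub_section hX hY

theorem SmoothField.smul {f : M → ℝ} {X : Π x : M, TangentSpace (𝓡 m) x}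
    (hf : SmoothFun (m := m) f) (hX : SmoothField X) : SmoothField (fun y => f y • X y) :=
  ContMDiff.smul_section hf hX

theorem SmoothField.sum {κ : Type*} {s : Finset κ} {X : κ → Π x : M, TangentSpace (𝓡 m) x}
    (hX : ∀ i, SmoothField (X i)) : SmoothField (fun y => ∑ i ∈ s, X i y) :=
  ContMDiff.sum_section fun i _ => hX i

theorem SmoothField.mdiff {X : Π x : M, TangentSpace (𝓡 m) x} (hX : SmoothField X) (x : M) :
    MDifferentiableAt (𝓡 m) ((𝓡 m).prod 𝓘(ℝ, EuclideanSpace ℝ (Fin m)))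
      (fun x => TotalSpace.mk' (EuclideanSpace ℝ (Fin m)) (E := fun x : M => TangentSpace (𝓡 m) x)
        x (X x)) x :=
  (hX x).mdifferentiableAt (by simp)

theorem SmoothFun.mdiff {f : M → ℝ} (hf : SmoothFun (m := m) f) (x : M) :
    MDifferentiableAt (𝓡 m) 𝓘(ℝ, ℝ) f x :=
  (hf x).mdifferentiableAt (by simp)

variable [T2Space M]

/-- A smooth function that is `1` near `x` and supported in a given neighbourhood of `x`. -/
theorem exists_bump {x : M} {u : Set M} (hu : u ∈ 𝓝 x) :
    ∃ χ : M → ℝ, SmoothFun (m := m) χ ∧ (∀ᶠ y in 𝓝 x, χ y = 1) ∧ tsupport χ ⊆ u := by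
  obtain ⟨χ, -, hχ⟩ := (SmoothBumpFunction.nhds_basis_tsupport (I := 𝓡 m) x).mem_iff.1 hu
  exact ⟨χ, χ.contMDiff, χ.eventuallyEq_one, hχ⟩

/-- A locally defined smooth function agrees near `x` with a smooth function on all of `M`. -/
theorem exists_smoothFun_eventuallyEq {f : M → ℝ} {x : M} {u : Set M} (hu : u ∈ 𝓝 x)
    (hf : ContMDiffOn (𝓡 m) 𝓘(ℝ, ℝ) ∞ f u) :
    ∃ f' : M → ℝ, SmoothFun (m := m) f' ∧ f' =ᶠ[𝓝 x] f := by
  obtain ⟨v, hvu, hvo, hxv⟩ := mem_nhds_iff.1 hu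
  obtain ⟨χ, hχ, hχ1, hχs⟩ := exists_bump (m := m) (hvo.mem_nhds hxv)
  refine ⟨fun y => χ y * f y, ?_, by filter_upwards [hχ1] with y hy; simp [hy]⟩
  refine contMDiff_of_tsupport fun y hy => ?_
  have hyv : y ∈ v := hχs (tsupport_mul_subset_left hy)
  exact hχ.contMDiffAt.mul ((hf.mono hvu).contMDiffAt (hvo.mem_nhds hyv))

/-- A locally defined smooth vector field agrees near `x` with a smooth vector field on all of `M`.
-/
theorem exists_smoothField_eventuallyEq {X : Π x : M, TangentSpace (𝓡 m) x} {x : M} {u : Set M}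
    (hu : u ∈ 𝓝 x)
    (hX : ContMDiffOn (𝓡 m) ((𝓡 m).prod 𝓘(ℝ, EuclideanSpace ℝ (Fin m))) ∞
      (fun x => TotalSpace.mk' (EuclideanSpace ℝ (Fin m)) (E := fun x : M => TangentSpace (𝓡 m) x)
      x (X x)) u) :
    ∃ X' : Π x : M, TangentSpace (𝓡 m) x, SmoothField X' ∧ ∀ᶠ y in 𝓝 x, X' y = X y := by
  obtain ⟨v, hvu, hvo, hxv⟩ := mem_nhds_iff.1 hu
  obtain ⟨χ, hχ, hχ1, hχs⟩ := exists_bump (m := m) (hvo.mem_nhds hxv)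
  refine ⟨fun y => χ y • X y, ?_, by filter_upwards [hχ1] with y hy; simp [hy]⟩
  exact ContMDiffOn.smul_section_of_tsupport hχ.contMDiffOn hvo hχs (hX.mono hvu)

/-- Every tangent vector extends to a smooth vector field that agrees near `x` with
`FiberBundle.extend`, the local extension that the definitions of the covariant derivatives of
tensors use. -/
theorem exists_smoothField_extend {x : M} (v : TangentSpace (𝓡 m) x) :
    ∃ X : Π x : M, TangentSpace (𝓡 m) x, SmoothField X ∧
      (∀ᶠ y in 𝓝 x, X y = FiberBundle.extend (EuclideanSpace ℝ (Fin m)) v y) ∧ X x = v := by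
  obtain ⟨u, hu, hX⟩ := FiberBundle.exists_contMDiffOn_extend (k := ∞) (𝓡 m)
    (EuclideanSpace ℝ (Fin m)) v
  obtain ⟨X, hX, hXe⟩ := exists_smoothField_eventuallyEq hu hX
  exact ⟨X, hX, hXe, by simpa using hXe.self_of_nhds⟩

/-- There are smooth vector fields on `M` that form a frame near `x`, and every smooth vector field
is near `x` a combination of them with smooth coefficients. -/
theorem exists_frame (x : M) : ∃ e : Fin m → Π y : M, TangentSpace (𝓡 m) y,
    (∀ i, SmoothField (e i)) ∧
    (∀ᶠ y in 𝓝 x, ∃ b : Module.Basis (Fin m) ℝ (TangentSpace (𝓡 m) y), ∀ i, b i = e i y) ∧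
    ∀ X : Π y : M, TangentSpace (𝓡 m) y, SmoothField X →
      ∃ c : Fin m → M → ℝ, (∀ i, SmoothFun (m := m) (c i)) ∧
        ∀ᶠ y in 𝓝 x, X y = ∑ i, c i y • e i y := by
  set t := trivializationAt (EuclideanSpace ℝ (Fin m)) (fun y : M => TangentSpace (𝓡 m) y) x
  have hx : x ∈ t.baseSet := FiberBundle.mem_baseSet_trivializationAt' x
  have ht : t.baseSet ∈ 𝓝 x := t.open_baseSet.mem_nhds hx
  let b : Module.Basis (Fin m) ℝ (EuclideanSpace ℝ (Fin m)) :=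
    (EuclideanSpace.basisFun (Fin m) ℝ).toBasis
  have h0 : ∀ i, ∃ X' : Π y : M, TangentSpace (𝓡 m) y, SmoothField X' ∧
      ∀ᶠ y in 𝓝 x, X' y = t.localFrame b i y := fun i =>
    exists_smoothField_eventuallyEq ht (t.contMDiffOn_localFrame_baseSet ∞ b i)
  choose e he hee using h0
  have hall : ∀ᶠ y in 𝓝 x, ∀ i, e i y = t.localFrame b i y := Filter.eventually_all.2 hee
  refine ⟨e, he, ?_, fun X hX => ?_⟩
  · filter_upwards [hall, ht] with y hy hyt
    exact ⟨t.basisAt b hyt, fun i => by rw [hy i, t.localFrame_apply_of_mem_baseSet b hyt]⟩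
  · have h1 : ∀ i, ∃ c : M → ℝ, SmoothFun (m := m) c ∧
        c =ᶠ[𝓝 x] (LinearMap.piApply (t.localFrameCoeff (𝓡 m) b i)) X := fun i =>
      exists_smoothFun_eventuallyEq ht
        (contMDiffOn_baseSet_localFrameCoeff b hX.contMDiffOn i)
    choose c hc hce using h1
    refine ⟨c, hc, ?_⟩
    filter_upwards [hall, ht, Filter.eventually_all.2 hce] with y hy hyt hcy
    rw [t.eq_sum_localFrameCoeff_smul (I := 𝓡 m) (b := b) (s := X) hyt]
    refine Finset.sum_congr rfl fun i _ => ?_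
    rw [hy i, hcy i]; rfl

/-- The tensoriality criterion: an additive operation on smooth vector fields that is linear over
the smooth functions at `x` depends only on the value of the field at `x`. Nothing is assumed about
fields that are not smooth. -/
theorem eq_of_tensorial {A : Type*} [AddCommGroup A] [Module ℝ A] {x : M}
    {Φ : (Π y : M, TangentSpace (𝓡 m) y) → A}
    (hadd : ∀ X Y, SmoothField X → SmoothField Y → Φ (fun y => X y + Y y) = Φ X + Φ Y)
    (hsmul : ∀ (f : M → ℝ) X, SmoothFun (m := m) f → SmoothField X →
      Φ (fun y => f y • X y) = f x • Φ X)
    {X Y : Π y : M, TangentSpace (𝓡 m) y} (hX : SmoothField X) (hY : SmoothField Y)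
    (hXY : X x = Y x) : Φ X = Φ Y := by
  -- multiplication by a bump function shows that `Φ` is local
  have hlocal : ∀ {X Y : Π y : M, TangentSpace (𝓡 m) y}, SmoothField X → SmoothField Y →
      (∀ᶠ y in 𝓝 x, X y = Y y) → Φ X = Φ Y := by
    intro X Y hX hY h
    obtain ⟨χ, hχ, hχ1, hχs⟩ := exists_bump (m := m) h
    have h1 := hsmul χ X hχ hX
    have h2 := hsmul χ Y hχ hY
    have h3 : (fun y => χ y • X y) = fun y => χ y • Y y := by
      ext1 y
      by_cases hy : y ∈ tsupport χ
      · rw [show X y = Y y from hχs hy]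
      · simp [image_eq_zero_of_notMem_tsupport hy]
    rw [h3, h2, hχ1.self_of_nhds, one_smul, one_smul] at h1
    exact h1.symm
  obtain ⟨e, he, ⟨hb, hframe⟩⟩ := exists_frame (m := m) x
  have hzero : Φ (fun y => (0 : TangentSpace (𝓡 m) y)) = 0 := by
    have := hsmul (fun _ => 0) X contMDiff_const hX
    simpa using this
  have hsum : ∀ (c : Fin m → M → ℝ), (∀ i, SmoothFun (m := m) (c i)) → ∀ s : Finset (Fin m),
      Φ (fun y => ∑ i ∈ s, c i y • e i y) = ∑ i ∈ s, c i x • Φ (e i) := by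
    intro c hc s
    induction s using Finset.induction_on with
    | empty => simpa using hzero
    | insert i s hi ih =>
      simp only [Finset.sum_insert hi]
      rw [hadd _ _ ((he i).smul (hc i)) (SmoothField.sum fun j => (he j).smul (hc j)), ih,
        hsmul _ _ (hc i) (he i)]
  obtain ⟨c, hc, hcX⟩ := hframe X hX
  obtain ⟨d, hd, hdY⟩ := hframe Y hY
  rw [hlocal hX (SmoothField.sum fun j => (he j).smul (hc j)) hcX,
    hlocal hY (SmoothField.sum fun j => (he j).smul (hd j)) hdY, hsum c hc, hsum d hd]
  obtain ⟨b, hb⟩ := hb.self_of_nhds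
  have hcd : ∑ i, c i x • b i = ∑ i, d i x • b i := by
    simp only [hb]
    rw [← hcX.self_of_nhds, ← hdY.self_of_nhds, hXY]
  refine Finset.sum_congr rfl fun i _ => ?_
  have : c i x = d i x := by
    have := congrArg (fun v => b.repr v i) hcd
    simpa [Finsupp.single_apply] using this
  rw [this]

/-- The map that a tensorial operation induces on the tangent space is linear. -/
theorem isLinearMap_of_tensorial {A : Type*} [AddCommGroup A] [Module ℝ A] {x : M}
    {Φ : (Π y : M, TangentSpace (𝓡 m) y) → A}
    (hadd : ∀ X Y, SmoothField X → SmoothField Y → Φ (fun y => X y + Y y) = Φ X + Φ Y)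
    (hsmul : ∀ (f : M → ℝ) X, SmoothFun (m := m) f → SmoothField X →
      Φ (fun y => f y • X y) = f x • Φ X)
    {φ : TangentSpace (𝓡 m) x → A} (hφ : ∀ X, SmoothField X → φ (X x) = Φ X) :
    IsLinearMap ℝ φ where
  map_add v w := by
    obtain ⟨X, hX, -, rfl⟩ := exists_smoothField_extend v
    obtain ⟨Y, hY, -, rfl⟩ := exists_smoothField_extend w
    rw [hφ X hX, hφ Y hY, ← hadd X Y hX hY, ← hφ _ (hX.add hY)]
  map_smul a v := by
    obtain ⟨X, hX, -, rfl⟩ := exists_smoothField_extend v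
    rw [hφ X hX, ← hsmul (fun _ => a) X contMDiff_const hX, ← hφ _ (SmoothField.smul contMDiff_const hX)]

end Fields

section Smoothness

variable {m : ℕ} {M : Type*} [TopologicalSpace M] [ChartedSpace (EuclideanSpace ℝ (Fin m)) M]
  [IsManifold (𝓡 m) ∞ M]

/-- A smooth section of the trivial line bundle along a map is a smooth function. -/
theorem contMDiff_of_trivial {n : ℕ} {N : Type*} [TopologicalSpace N]
    [ChartedSpace (EuclideanSpace ℝ (Fin n)) N] {b : N → M} {f : N → ℝ}
    (h : ContMDiff (𝓡 n) ((𝓡 m).prod 𝓘(ℝ, ℝ)) ∞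
      (fun y => TotalSpace.mk' ℝ (E := Bundle.Trivial M ℝ) (b y) (f y))) :
    ContMDiff (𝓡 n) 𝓘(ℝ, ℝ) ∞ f := by
  intro x
  have := h x
  rw [contMDiffAt_totalSpace] at this
  simpa using this.2

/-- The derivative of a smooth function in the direction of a smooth vector field is smooth. -/
theorem contMDiff_mvfderiv {F : Type*} [NormedAddCommGroup F] [NormedSpace ℝ F] {f : M → F}
    (hf : ContMDiff (𝓡 m) 𝓘(ℝ, F) ∞ f) {X : Π x : M, TangentSpace (𝓡 m) x} (hX : SmoothField X) :
    ContMDiff (𝓡 m) 𝓘(ℝ, F) ∞ (fun y => mvfderiv (𝓡 m) f y (X y)) := by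
  have h1 : ContMDiff (𝓡 m).tangent 𝓘(ℝ, F).tangent ∞ (tangentMap (𝓡 m) 𝓘(ℝ, F) f) :=
    hf.contMDiff_tangentMap (by simp)
  exact (contMDiff_snd_tangentBundle_modelSpace F 𝓘(ℝ, F)).comp (h1.comp hX)

theorem SmoothField.mvfderiv {f : M → ℝ} (hf : SmoothFun (m := m) f)
    {X : Π x : M, TangentSpace (𝓡 m) x} (hX : SmoothField X) :
    SmoothFun (m := m) (fun y => mvfderiv (𝓡 m) f y (X y)) :=
  contMDiff_mvfderiv hf hX

theorem smoothFun_inner (g : Metric m M) {X Y : Π x : M, TangentSpace (𝓡 m) x}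
    (hX : SmoothField X) (hY : SmoothField Y) :
    SmoothFun (m := m) (fun y => g.inner y (X y) (Y y)) := by
  refine contMDiff_of_trivial (m := m) (b := fun y : M => y) ?_
  exact ContMDiff.clm_bundle_apply₂ (F₁ := EuclideanSpace ℝ (Fin m))
    (F₂ := EuclideanSpace ℝ (Fin m)) g.contMDiff hX hY

theorem SmoothField.mlieBracket {X Y : Π x : M, TangentSpace (𝓡 m) x} (hX : SmoothField X)
    (hY : SmoothField Y) : SmoothField (VectorField.mlieBracket (𝓡 m) X Y) := by
  have : IsManifold (𝓡 m) ((⊤ : ℕ∞) + 1) M := inferInstanceAs (IsManifold (𝓡 m) ∞ M)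
  have : IsManifold (𝓡 m) (minSmoothness ℝ 2) M := by
    rw [minSmoothness_of_isRCLikeNormedField]
    infer_instance
  exact ContDiff.mlieBracket_vectorField (n := ⊤) (m := ⊤) hX hY (by simp)

/-- A smooth connection maps smooth vector fields to smooth vector fields. -/
theorem SmoothField.cov {D : CovariantDerivative (𝓡 m) (EuclideanSpace ℝ (Fin m))
    (fun x : M => TangentSpace (𝓡 m) x)} (hD : D.ContMDiffCovariantDerivative ∞)
    {X Y : Π x : M, TangentSpace (𝓡 m) x} (hX : SmoothField X) (hY : SmoothField Y) :
    SmoothField (fun y => D.toFun Y y (X y)) := by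
  have h := hD.contMDiff.contMDiff (σ := Y) (by simpa using hY.contMDiffOn)
  exact ContMDiff.clm_bundle_apply (contMDiffOn_univ.1 h) hX

theorem mvfderiv_congr {F : Type*} [NormedAddCommGroup F] [NormedSpace ℝ F] {f f' : M → F} {x : M}
    (h : f =ᶠ[𝓝 x] f') : mvfderiv (𝓡 m) f x = mvfderiv (𝓡 m) f' x := by
  unfold mvfderiv
  rw [h.mfderiv_eq, h.self_of_nhds]

variable [T2Space M]

theorem contMDiffAt_matrix_det {κ : Type*} [Fintype κ] [DecidableEq κ]
    {A : M → Matrix κ κ ℝ} {x : M}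
    (hA : ∀ i j, ContMDiffAt (𝓡 m) 𝓘(ℝ, ℝ) ∞ (fun y => A y i j) x) :
    ContMDiffAt (𝓡 m) 𝓘(ℝ, ℝ) ∞ (fun y => (A y).det) x := by
  simp only [Matrix.det_apply']
  exact contMDiffAt_finsetSum fun σ _ =>
    contMDiffAt_const.mul (contMDiffAt_finsetProd fun i _ => hA _ _)

theorem contMDiffAt_matrix_inv {κ : Type*} [Fintype κ] [DecidableEq κ]
    {A : M → Matrix κ κ ℝ} {x : M}
    (hA : ∀ i j, ContMDiffAt (𝓡 m) 𝓘(ℝ, ℝ) ∞ (fun y => A y i j) x) (hx : (A x).det ≠ 0) (i j : κ) :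
    ContMDiffAt (𝓡 m) 𝓘(ℝ, ℝ) ∞ (fun y => (A y)⁻¹ i j) x := by
  simp only [Matrix.inv_def, Matrix.smul_apply, smul_eq_mul, Ring.inverse_eq_inv',
    Matrix.adjugate_apply]
  refine ContMDiffAt.mul ((contMDiffAt_matrix_det hA).inv₀ hx) ?_
  refine contMDiffAt_matrix_det fun k l => ?_
  by_cases hk : k = j
  · subst hk
    simpa using! contMDiffAt_const
  · simpa [Matrix.updateRow_ne hk] using hA k l

/-- The Gram matrix of an inner product is invertible. -/
theorem IsInner.det_ne_zero {V : Type*} [AddCommGroup V] [Module ℝ V] {G : V → V → ℝ}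
    (hG : IsInner G) {κ : Type*} [Fintype κ] [DecidableEq κ] (b : Module.Basis κ ℝ V) :
    (Matrix.of fun i j => G (b i) (b j)).det ≠ 0 := by
  intro h
  obtain ⟨c, hc, hc0⟩ := Matrix.exists_mulVec_eq_zero_iff.2 h
  apply hc
  have h1 : ∀ i, G (∑ j, c j • b j) (b i) = 0 := by
    intro i
    have := congrFun hc0 i
    rw [IsBilinearMap.sum_left hG.bilin]
    simp only [hG.bilin.smul_left, smul_eq_mul]
    simpa [Matrix.mulVec, dotProduct, hG.symm (b i), mul_comm] using this
  have h2 : ∑ j, c j • b j = 0 := by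
    refine hG.eq_zero fun w => ?_
    rw [← b.sum_repr w, IsBilinearMap.sum_right hG.bilin]
    simp [hG.bilin.smul_right, h1]
  ext i
  have := congrArg (fun v => b.repr v i) h2
  simpa [Finsupp.single_apply] using this

/-- The metric trace of a smooth field of bilinear forms is smooth. -/
theorem smoothFun_trG {G A : Π x : M, TangentSpace (𝓡 m) x → TangentSpace (𝓡 m) x → ℝ}
    (hGi : ∀ x, IsInner (G x)) (hA : ∀ x, IsBilinearMap ℝ (A x))
    (hGs : ∀ X Y, SmoothField X → SmoothField Y → SmoothFun (m := m) fun y => G y (X y) (Y y))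
    (hAs : ∀ X Y, SmoothField X → SmoothField Y → SmoothFun (m := m) fun y => A y (X y) (Y y)) :
    SmoothFun (m := m) (fun y => trG y (G y) (A y)) := by
  intro x
  obtain ⟨e, he, hb, -⟩ := exists_frame (m := m) x
  have heq : (fun y => trG y (G y) (A y)) =ᶠ[𝓝 x] fun y => ∑ i, ∑ j,
      (Matrix.of fun i j => G y (e i y) (e j y))⁻¹ i j * A y (e i y) (e j y) := by
    filter_upwards [hb] with y hy
    obtain ⟨b, hb⟩ := hy
    rw [trG_eq_of_basis (hGi y).bilin (hA y) b]
    simp only [hb, smul_eq_mul]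
  refine ContMDiffAt.congr_of_eventuallyEq ?_ heq
  refine contMDiffAt_finsetSum fun i _ => contMDiffAt_finsetSum fun j _ => ?_
  refine ContMDiffAt.mul ?_ (hAs _ _ (he i) (he j) x)
  refine contMDiffAt_matrix_inv (fun i j => hGs _ _ (he i) (he j) x) ?_ i j
  obtain ⟨b, hb⟩ := hb.self_of_nhds
  have := (hGi x).det_ne_zero b
  simp only [hb] at this
  exact this

end Smoothness

section Hom

variable {m : ℕ} {M : Type*} [TopologicalSpace M] [ChartedSpace (EuclideanSpace ℝ (Fin m)) M]
  [IsManifold (𝓡 m) ∞ M] [T2Space M]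

/-- A field of linear maps on the tangent spaces is smooth if it maps smooth vector fields to smooth
sections. -/
theorem contMDiff_hom_of_apply {F : Type*} [NormedAddCommGroup F] [NormedSpace ℝ F]
    {V : M → Type*} [∀ x, AddCommGroup (V x)] [∀ x, Module ℝ (V x)]
    [TopologicalSpace (TotalSpace F V)] [∀ x, TopologicalSpace (V x)]
    [FiberBundle F V] [VectorBundle ℝ F V] [∀ x, IsTopologicalAddGroup (V x)]
    [∀ x, ContinuousSMul ℝ (V x)]
    (A : Π x : M, TangentSpace (𝓡 m) x →L[ℝ] V x)
    (h : ∀ X, SmoothField X → ContMDiff (𝓡 m) ((𝓡 m).prod 𝓘(ℝ, F)) ∞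
      (fun x => TotalSpace.mk' F (E := V) x (A x (X x)))) :
    ContMDiff (𝓡 m) ((𝓡 m).prod 𝓘(ℝ, EuclideanSpace ℝ (Fin m) →L[ℝ] F)) ∞
      (fun x => TotalSpace.mk' (EuclideanSpace ℝ (Fin m) →L[ℝ] F)
        (E := fun x : M => TangentSpace (𝓡 m) x →L[ℝ] V x) x (A x)) := by
  intro x
  rw [contMDiffAt_hom_bundle]
  refine ⟨contMDiffAt_id, ?_⟩
  have key : ∀ v : EuclideanSpace ℝ (Fin m), ContMDiffAt (𝓡 m) 𝓘(ℝ, F) ∞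
      (fun y => ContinuousLinearMap.inCoordinates (EuclideanSpace ℝ (Fin m))
        (fun y : M => TangentSpace (𝓡 m) y) F V x y x y (A y) v) x := by
    intro v
    set t := trivializationAt (EuclideanSpace ℝ (Fin m)) (fun y : M => TangentSpace (𝓡 m) y) x
    obtain ⟨X, hX, hXe, -⟩ := exists_smoothField_extend (m := m) (t.symm x v)
    have h1 := h X hX x
    rw [contMDiffAt_totalSpace] at h1
    refine h1.2.congr_of_eventuallyEq ?_
    have ht : t.baseSet ∈ 𝓝 x :=
      t.open_baseSet.mem_nhds (FiberBundle.mem_baseSet_trivializationAt' x)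
    have ht' := (trivializationAt F V x).open_baseSet.mem_nhds
      (FiberBundle.mem_baseSet_trivializationAt' x)
    filter_upwards [hXe, ht, ht'] with y hy hyt hyt'
    have hxt : x ∈ t.baseSet := FiberBundle.mem_baseSet_trivializationAt' x
    have : X y = t.symm y v := by
      rw [hy]
      simp only [FiberBundle.extend]
      rw [show (t ⟨x, t.symm x v⟩).2 = v by rw [t.apply_mk_symm hxt]]
    rw [ContinuousLinearMap.inCoordinates_eq hyt hyt', this]
    simp
    rfl
  have h2 : (fun y => ContinuousLinearMap.inCoordinates (EuclideanSpace ℝ (Fin m))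
        (fun y : M => TangentSpace (𝓡 m) y) F V x y x y (A y)) = fun y =>
      ∑ i : Fin m, ContinuousLinearMap.smulRightL ℝ (EuclideanSpace ℝ (Fin m)) F
        (EuclideanSpace.proj (𝕜 := ℝ) i)
        (ContinuousLinearMap.inCoordinates (EuclideanSpace ℝ (Fin m))
        (fun y : M => TangentSpace (𝓡 m) y) F V x y x y (A y) (EuclideanSpace.single i 1)) := by
    ext1 y
    ext v
    conv_lhs => rw [← (EuclideanSpace.basisFun (Fin m) ℝ).sum_repr v]
    simp [sum_apply]
  change ContMDiffAt _ _ _ (fun y => ContinuousLinearMap.inCoordinates (EuclideanSpace ℝ (Fin m))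
        (fun y : M => TangentSpace (𝓡 m) y) F V x y x y (A y)) x
  rw [h2]
  refine contMDiffAt_finsetSum fun i _ => ?_
  exact (ContinuousLinearMap.contMDiff _).contMDiffAt.comp x (key _)

end Hom

/-! ### The Lie bracket as a commutator of derivations -/

section Bracket

theorem two_le_infty : (2 : WithTop ℕ∞) ≤ ∞ := by
  exact WithTop.coe_le_coe.2 (le_top : (2 : ℕ∞) ≤ ⊤)

variable {m : ℕ} {M : Type*} [TopologicalSpace M] [ChartedSpace (EuclideanSpace ℝ (Fin m)) M]
  [IsManifold (𝓡 m) ∞ M] {F : Type*} [NormedAddCommGroup F] [NormedSpace ℝ F]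

/-- The vector field `X` in the chart at `x`. -/
noncomputable def chartField (x : M) (X : Π y : M, TangentSpace (𝓡 m) y) :
    EuclideanSpace ℝ (Fin m) → EuclideanSpace ℝ (Fin m) :=
  VectorField.mpullbackWithin 𝓘(ℝ, EuclideanSpace ℝ (Fin m)) (𝓡 m) (extChartAt (𝓡 m) x).symm X
    (Set.range (𝓡 m))

/-- The derivative of a function in a tangent direction, computed in the chart at `x`. -/
theorem fderiv_comp_chart {x : M} {f : M → F} {u : EuclideanSpace ℝ (Fin m)}
    (hu : u ∈ (extChartAt (𝓡 m) x).target)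
    (hf : MDifferentiableAt (𝓡 m) 𝓘(ℝ, F) f ((extChartAt (𝓡 m) x).symm u))
    (v : TangentSpace (𝓡 m) ((extChartAt (𝓡 m) x).symm u)) :
    fderiv ℝ (f ∘ (extChartAt (𝓡 m) x).symm) u
      ((mfderivWithin 𝓘(ℝ, EuclideanSpace ℝ (Fin m)) (𝓡 m) (extChartAt (𝓡 m) x).symm
        (Set.range (𝓡 m)) u).inverse v) =
      mvfderiv (𝓡 m) f ((extChartAt (𝓡 m) x).symm u) v := by
  have hinv := isInvertible_mfderivWithin_extChartAt_symm (I := 𝓡 m) hu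
  have hd : MDifferentiableWithinAt 𝓘(ℝ, EuclideanSpace ℝ (Fin m)) (𝓡 m)
      (extChartAt (𝓡 m) x).symm (Set.range (𝓡 m)) u :=
    mdifferentiableWithinAt_extChartAt_symm hu
  have h1 := mfderiv_comp_mfderivWithin (I := 𝓘(ℝ, EuclideanSpace ℝ (Fin m))) (I' := 𝓡 m)
    (I'' := 𝓘(ℝ, F)) (g := f) u hf hd
    (by simp [uniqueMDiffWithinAt_univ])
  have h2 := hinv.self_comp_inverse
  have h3 : mfderivWithin 𝓘(ℝ, EuclideanSpace ℝ (Fin m)) 𝓘(ℝ, F)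
      (f ∘ (extChartAt (𝓡 m) x).symm) (Set.range (𝓡 m)) u =
      fderiv ℝ (f ∘ (extChartAt (𝓡 m) x).symm) u := by
    have : Set.range (𝓡 m) = Set.univ := by simp
    rw [this, mfderivWithin_univ, mfderiv_eq_fderiv]
  have h4 := congrArg (fun L => L ((mfderivWithin 𝓘(ℝ, EuclideanSpace ℝ (Fin m)) (𝓡 m)
    (extChartAt (𝓡 m) x).symm (Set.range (𝓡 m)) u).inverse v)) h1
  have h5 := congrArg (fun L => L v) h2
  rw [h3] at h4
  refine h4.trans ?_
  change mfderiv (𝓡 m) 𝓘(ℝ, F) f _ _ = mfderiv (𝓡 m) 𝓘(ℝ, F) f _ _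
  congr 1

/-- The Lie bracket acts on smooth functions as the commutator of the derivations `X` and `Y`. In a
chart this is the symmetry of the second derivative. -/
theorem mvfderiv_mlieBracket {f : M → F} (hf : ContMDiff (𝓡 m) 𝓘(ℝ, F) ∞ f)
    {X Y : Π y : M, TangentSpace (𝓡 m) y} (hX : SmoothField X) (hY : SmoothField Y) (x : M) :
    mvfderiv (𝓡 m) f x (VectorField.mlieBracket (𝓡 m) X Y x) =
      mvfderiv (𝓡 m) (fun y => mvfderiv (𝓡 m) f y (Y y)) x (X x)
        - mvfderiv (𝓡 m) (fun y => mvfderiv (𝓡 m) f y (X y)) x (Y x) := by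
  set φ := extChartAt (𝓡 m) x with hφ
  set u := φ x with hu
  have hut : u ∈ φ.target := mem_extChartAt_target x
  have htn : φ.target ∈ 𝓝 u := extChartAt_target_mem_nhds x
  have hφu : φ.symm u = x := extChartAt_to_inv x
  -- differentiation in the chart
  have key : ∀ {f : M → F}, ContMDiff (𝓡 m) 𝓘(ℝ, F) ∞ f → ∀ Z : Π y : M, TangentSpace (𝓡 m) y,
      ∀ w ∈ φ.target, mvfderiv (𝓡 m) f (φ.symm w) (Z (φ.symm w)) =
        fderiv ℝ (f ∘ φ.symm) w (chartField x Z w) := by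
    intro f hf Z w hw
    exact (fderiv_comp_chart hw ((hf _).mdifferentiableAt (by simp)) _).symm
  have keyx : ∀ {f : M → F}, ContMDiff (𝓡 m) 𝓘(ℝ, F) ∞ f → ∀ Z : Π y : M, TangentSpace (𝓡 m) y,
      mvfderiv (𝓡 m) f x (Z x) = fderiv ℝ (f ∘ φ.symm) u (chartField x Z u) := by
    intro f hf Z
    have := key hf Z u hut
    rw [hφu] at this
    exact this
  have hF : ContDiffAt ℝ ∞ (f ∘ φ.symm) u := by
    have h1 : ContMDiffAt 𝓘(ℝ, EuclideanSpace ℝ (Fin m)) 𝓘(ℝ, F) ∞ (f ∘ φ.symm) u :=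
      (hf _).comp u ((contMDiffOn_extChartAt_symm x).contMDiffAt htn)
    exact h1.contDiffAt
  have hfield : ∀ Z : Π y : M, TangentSpace (𝓡 m) y, SmoothField Z →
      DifferentiableAt ℝ (chartField x Z) u := by
    intro Z hZ
    have h1 := (hZ.mdiff x).mdifferentiableWithinAt (s := Set.univ)
    have h2 := MDifferentiableWithinAt.differentiableWithinAt_mpullbackWithin_vectorField h1
    have h3 : DifferentiableWithinAt ℝ (chartField x Z) (φ.symm ⁻¹' Set.univ ∩ Set.range (𝓡 m)) u :=
      h2
    rwa [Set.preimage_univ, Set.univ_inter, show Set.range (𝓡 m) = Set.univ by simp,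
      differentiableWithinAt_univ] at h3
  have hsec : ∀ Z V : Π y : M, TangentSpace (𝓡 m) y, SmoothField Z → SmoothField V →
      mvfderiv (𝓡 m) (fun y => mvfderiv (𝓡 m) f y (Z y)) x (V x) =
        fderiv ℝ (fderiv ℝ (f ∘ φ.symm)) u (chartField x V u) (chartField x Z u) +
        fderiv ℝ (f ∘ φ.symm) u (fderiv ℝ (chartField x Z) u (chartField x V u)) := by
    intro Z V hZ hV
    rw [keyx (contMDiff_mvfderiv hf hZ) V]
    have h1 : ((fun y => mvfderiv (𝓡 m) f y (Z y)) ∘ φ.symm) =ᶠ[𝓝 u]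
        fun w => fderiv ℝ (f ∘ φ.symm) w (chartField x Z w) := by
      filter_upwards [htn] with w hw
      exact key hf Z w hw
    rw [h1.fderiv_eq, fderiv_clm_apply
      ((hF.fderiv_right (m := 1) two_le_infty).differentiableAt (by simp))
      (hfield Z hZ)]
    simp [add_comm]
  have hbr : mvfderiv (𝓡 m) f x (VectorField.mlieBracket (𝓡 m) X Y x) =
      fderiv ℝ (f ∘ φ.symm) u (VectorField.lieBracket ℝ (chartField x X) (chartField x Y) u) := by
    rw [keyx hf]
    congr 1
    have h2 : VectorField.lieBracketWithin ℝ (chartField x X) (chartField x Y) (Set.range (𝓡 m)) u =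
        VectorField.lieBracket ℝ (chartField x X) (chartField x Y) u := by
      rw [show Set.range (𝓡 m) = Set.univ by simp, VectorField.lieBracketWithin_univ]
    have h1 : VectorField.mlieBracket (𝓡 m) X Y x =
        VectorField.lieBracketWithin ℝ (chartField x X) (chartField x Y) (Set.range (𝓡 m)) u := by
      rw [← VectorField.mlieBracketWithin_univ, VectorField.mlieBracketWithin_apply]
      simp only [Set.preimage_univ, Set.univ_inter]
      rw [mfderiv_extChartAt_self]
      exact congrArg (fun L : EuclideanSpace ℝ (Fin m) →L[ℝ] EuclideanSpace ℝ (Fin m) => L _)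
        ContinuousLinearMap.inverse_id
    have h3 : chartField x (VectorField.mlieBracket (𝓡 m) X Y) u =
      VectorField.mlieBracket (𝓡 m) X Y x := by
      refine Eq.trans ?_ (mfderivWithin_extChartAt_symm_inverse_apply _)
      change (mfderivWithin _ _ _ _ _).inverse _ = (mfderivWithin _ _ _ _ _).inverse _
      congr 1
      exact congrArg (fun y => (show EuclideanSpace ℝ (Fin m) from
        VectorField.mlieBracket (𝓡 m) X Y y)) hφu
    exact h3.trans (h1.trans h2)
  rw [hbr, hsec Y X hY hX, hsec X Y hX hY, VectorField.lieBracket_eq, map_sub]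
  have hsymm : IsSymmSndFDerivAt ℝ (f ∘ φ.symm) u :=
    hF.isSymmSndFDerivAt (by simpa using two_le_infty)
  rw [hsymm.eq (chartField x X u)]
  abel

end Bracket

/-! ### Connections and one-forms -/

section Connection

variable {m : ℕ} {M : Type*} [TopologicalSpace M] [ChartedSpace (EuclideanSpace ℝ (Fin m)) M]
  [IsManifold (𝓡 m) ∞ M]

/-- The properties of a smooth torsion-free connection on the tangent bundle, for its restriction to
smooth vector fields. -/
structure SmoothConn (D : Conn m M) : Prop where
  add : ∀ X Y, SmoothField X → SmoothField Y → ∀ x, D (fun y => X y + Y y) x = D X x + D Y x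
  leibniz : ∀ (f : M → ℝ) X, SmoothFun (m := m) f → SmoothField X → ∀ x v,
    D (fun y => f y • X y) x v = f x • D X x v + mvfderiv (𝓡 m) f x v • X x
  smooth : ∀ X Y, SmoothField X → SmoothField Y → SmoothField (fun y => D Y y (X y))
  congr : ∀ X X' : Π x : M, TangentSpace (𝓡 m) x, SmoothField X → ∀ x,
    (∀ᶠ y in 𝓝 x, X y = X' y) → D X' x = D X x
  torsion : ∀ X Y, SmoothField X → SmoothField Y → ∀ x,
    VectorField.mlieBracket (𝓡 m) X Y x = D Y x (X x) - D X x (Y x)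

theorem smoothConn_of_torsion_eq_zero {D : CovariantDerivative (𝓡 m) (EuclideanSpace ℝ (Fin m))
    (fun x : M => TangentSpace (𝓡 m) x)} (hs : D.ContMDiffCovariantDerivative ∞)
    (ht : D.torsion = 0) : SmoothConn D.toFun where
  add X Y hX hY x := D.isCovariantDerivativeOnUniv.add (hX.mdiff x) (hY.mdiff x)
  leibniz f X hf hX x v := by
    have := D.isCovariantDerivativeOnUniv.leibniz (hX.mdiff x) (hf.mdiff x)
    refine Eq.trans (congrArg (fun L => L v) this) ?_
    simp
  smooth X Y hX hY := hX.cov hs hY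
  congr X X' hX x h := by
    refine D.isCovariantDerivativeOnUniv.congr_of_eventuallyEq ?_ (hX.mdiff x) Filter.univ_mem
      (h.mono fun _ => Eq.symm)
    refine (hX.mdiff x).congr_of_eventuallyEq ?_
    filter_upwards [h] with y hy
    rw [hy]
  torsion X Y hX hY x :=
    (D.torsion_eq_zero_iff.1 ht (hX.mdiff x) (hY.mdiff x)).symm

theorem WeylStructure.smoothConn {c : ConformalStructure m M} (W : WeylStructure c) :
    SmoothConn W.cov.toFun :=
  smoothConn_of_torsion_eq_zero W.smooth W.torsion_free

/-- Smooth one-forms. -/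
structure SmoothForm (α : Π x : M, TangentSpace (𝓡 m) x → ℝ) : Prop where
  lin : ∀ x, IsLinearMap ℝ (α x)
  smooth : ∀ X, SmoothField X → SmoothFun (m := m) fun y => α y (X y)

theorem SmoothForm.add {α η : Π x : M, TangentSpace (𝓡 m) x → ℝ} (hα : SmoothForm α)
    (hη : SmoothForm η) : SmoothForm (fun x v => α x v + η x v) where
  lin x := ⟨fun v w => by rw [(hα.lin x).map_add, (hη.lin x).map_add]; ring,
    fun a v => by rw [(hα.lin x).map_smul, (hη.lin x).map_smul]; simp; ring⟩
  smooth X hX := (hα.smooth X hX).add (hη.smooth X hX)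

theorem SmoothForm.sub {α η : Π x : M, TangentSpace (𝓡 m) x → ℝ} (hα : SmoothForm α)
    (hη : SmoothForm η) : SmoothForm (fun x v => α x v - η x v) where
  lin x := ⟨fun v w => by rw [(hα.lin x).map_add, (hη.lin x).map_add]; ring,
    fun a v => by rw [(hα.lin x).map_smul, (hη.lin x).map_smul]; simp; ring⟩
  smooth X hX := (hα.smooth X hX).sub (hη.smooth X hX)

theorem SmoothForm.mul {f : M → ℝ} (hf : SmoothFun (m := m) f)
    {α : Π x : M, TangentSpace (𝓡 m) x → ℝ} (hα : SmoothForm α) :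
    SmoothForm (fun x v => f x * α x v) where
  lin x := ⟨fun v w => by rw [(hα.lin x).map_add]; ring,
    fun a v => by rw [(hα.lin x).map_smul]; simp; ring⟩
  smooth X hX := hf.mul (hα.smooth X hX)

theorem SmoothFun.smoothForm {f : M → ℝ} (hf : SmoothFun (m := m) f) :
    SmoothForm (fun x v => mvfderiv (𝓡 m) f x v) where
  lin x := ⟨by simp, by simp⟩
  smooth X hX := hX.mvfderiv hf

theorem SmoothForm.lineDeriv {β : Π x : M, TangentSpace (𝓡 m) x → ℝ} (hβ : SmoothForm β)
    {f : M → ℝ} (hf : SmoothFun (m := m) f) : SmoothForm (lineDeriv β f) := by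
  have := hf.smoothForm.add (SmoothForm.mul hf hβ)
  convert this using 3
  simp only [ConfGeom.lineDeriv]; ring

/-- The covariant derivative `(∇_X α)(Y)` of a one-form, by means of a local extension of `Y`. -/
noncomputable def nablaForm (D : Conn m M) (α : Π x : M, TangentSpace (𝓡 m) x → ℝ) (x : M)
    (X Y : TangentSpace (𝓡 m) x) : ℝ :=
  mvfderiv (𝓡 m) (fun y => α y (FiberBundle.extend (EuclideanSpace ℝ (Fin m)) Y y)) x X
    - α x (D (FiberBundle.extend (EuclideanSpace ℝ (Fin m)) Y) x X)

/-- The Hessian of `f ⊗ u` is `∇α + β ⊗ α`, where `α ⊗ u` is the derivative of `f ⊗ u`. -/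
theorem hessian_eq_nablaForm (β : Π x : M, TangentSpace (𝓡 m) x → ℝ) (D : Conn m M) (f : M → ℝ)
    (x : M) (X Y : TangentSpace (𝓡 m) x) :
    hessian β D f x X Y = nablaForm D (lineDeriv β f) x X Y + β x X * lineDeriv β f x Y := by
  unfold hessian nablaForm
  rw [lineDeriv]
  simp only [FiberBundle.extend_apply_self]
  ring

variable [T2Space M]

theorem mvfderiv_add_fun {f h : M → ℝ} (hf : SmoothFun (m := m) f) (hh : SmoothFun (m := m) h)
    (x : M) (v : TangentSpace (𝓡 m) x) : mvfderiv (𝓡 m) (fun y => f y + h y) x v =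
      mvfderiv (𝓡 m) f x v + mvfderiv (𝓡 m) h x v := by
  have := mvfderiv_add (hf.mdiff x) (hh.mdiff x)
  exact congrArg (fun L => L v) this

theorem mvfderiv_sub_fun {f h : M → ℝ} (hf : SmoothFun (m := m) f) (hh : SmoothFun (m := m) h)
    (x : M) (v : TangentSpace (𝓡 m) x) : mvfderiv (𝓡 m) (fun y => f y - h y) x v =
      mvfderiv (𝓡 m) f x v - mvfderiv (𝓡 m) h x v := by
  have := mvfderiv_sub (hf.mdiff x) (hh.mdiff x)
  exact congrArg (fun L => L v) this

theorem mvfderiv_mul_fun {f h : M → ℝ} (hf : SmoothFun (m := m) f) (hh : SmoothFun (m := m) h)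
    (x : M) (v : TangentSpace (𝓡 m) x) : mvfderiv (𝓡 m) (fun y => f y * h y) x v =
      f x * mvfderiv (𝓡 m) h x v + mvfderiv (𝓡 m) f x v * h x := by
  have := congrArg (fun L => L v) (mvfderiv_mul (hf.mdiff x) (hh.mdiff x))
  refine this.trans ?_
  simp; ring

/-- The covariant derivative of a one-form can be computed with any smooth vector field. -/
theorem nablaForm_apply {D : Conn m M} (hD : SmoothConn D)
    {α : Π x : M, TangentSpace (𝓡 m) x → ℝ} (hα : SmoothForm α) {Y : Π y : M, TangentSpace (𝓡 m) y}
    (hY : SmoothField Y) (x : M) (v : TangentSpace (𝓡 m) x) :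
    nablaForm D α x v (Y x) =
      mvfderiv (𝓡 m) (fun y => α y (Y y)) x v - α x (D Y x v) := by
  obtain ⟨Z, hZ, hZe, hZx⟩ := exists_smoothField_extend (Y x)
  have h1 : nablaForm D α x v (Y x) =
      mvfderiv (𝓡 m) (fun y => α y (Z y)) x v - α x (D Z x v) := by
    unfold nablaForm
    rw [hD.congr Z _ hZ x hZe]
    congr 2
    refine mvfderiv_congr ?_
    filter_upwards [hZe] with y hy
    rw [hy]
  rw [h1]
  refine eq_of_tensorial (Φ := fun Y => mvfderiv (𝓡 m) (fun y => α y (Y y)) x v - α x (D Y x v))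
    (fun X Y hX hY => ?_) (fun f X hf hX => ?_) hZ hY hZx
  · simp only [hD.add X Y hX hY, (hα.lin _).map_add, add_apply]
    rw [mvfderiv_add_fun (hα.smooth X hX) (hα.smooth Y hY)]
    ring
  · simp only [hD.leibniz f X hf hX, (hα.lin _).map_add, (hα.lin _).map_smul, smul_eq_mul]
    rw [mvfderiv_mul_fun hf (hα.smooth X hX)]
    ring

theorem isBilinearMap_nablaForm {D : Conn m M} (hD : SmoothConn D)
    {α : Π x : M, TangentSpace (𝓡 m) x → ℝ} (hα : SmoothForm α) (x : M) :
    IsBilinearMap ℝ (nablaForm D α x) := by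
  have h : ∀ v, IsLinearMap ℝ (nablaForm D α x v) := by
    intro v
    refine isLinearMap_of_tensorial (Φ := fun Y => mvfderiv (𝓡 m) (fun y => α y (Y y)) x v -
      α x (D Y x v)) (fun X Y hX hY => ?_) (fun f X hf hX => ?_)
      (fun X hX => nablaForm_apply hD hα hX x v)
    · simp only [hD.add X Y hX hY, (hα.lin _).map_add, add_apply]
      rw [mvfderiv_add_fun (hα.smooth X hX) (hα.smooth Y hY)]
      ring
    · simp only [hD.leibniz f X hf hX, (hα.lin _).map_add, (hα.lin _).map_smul, smul_eq_mul]
      rw [mvfderiv_mul_fun hf (hα.smooth X hX)]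
      ring
  refine ⟨fun v w Y => ?_, fun a v Y => ?_, fun v Y Z => (h v).map_add Y Z,
    fun a v Y => (h v).map_smul a Y⟩
  · simp only [nablaForm, map_add, (hα.lin _).map_add]; ring
  · simp only [nablaForm, map_smul, (hα.lin _).map_smul, smul_eq_mul]; ring

theorem smoothFun_nablaForm {D : Conn m M} (hD : SmoothConn D)
    {α : Π x : M, TangentSpace (𝓡 m) x → ℝ} (hα : SmoothForm α) {X Y : Π y : M, TangentSpace (𝓡 m) y}
    (hX : SmoothField X) (hY : SmoothField Y) :
    SmoothFun (m := m) fun y => nablaForm D α y (X y) (Y y) := by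
  simp only [nablaForm_apply hD hα hY]
  exact ContMDiff.sub (hX.mvfderiv (hα.smooth Y hY)) (hα.smooth _ (hD.smooth X Y hX hY))

theorem nablaForm_add {D : Conn m M} (hD : SmoothConn D)
    {α η : Π x : M, TangentSpace (𝓡 m) x → ℝ} (hα : SmoothForm α) (hη : SmoothForm η) (x : M)
    (X Y : TangentSpace (𝓡 m) x) :
    nablaForm D (fun x v => α x v + η x v) x X Y = nablaForm D α x X Y + nablaForm D η x X Y := by
  obtain ⟨Z, hZ, -, rfl⟩ := exists_smoothField_extend Y
  rw [nablaForm_apply hD hα hZ, nablaForm_apply hD hη hZ, nablaForm_apply hD (hα.add hη) hZ,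
    mvfderiv_add_fun (hα.smooth Z hZ) (hη.smooth Z hZ)]
  ring

theorem nablaForm_sub {D : Conn m M} (hD : SmoothConn D)
    {α η : Π x : M, TangentSpace (𝓡 m) x → ℝ} (hα : SmoothForm α) (hη : SmoothForm η) (x : M)
    (X Y : TangentSpace (𝓡 m) x) :
    nablaForm D (fun x v => α x v - η x v) x X Y = nablaForm D α x X Y - nablaForm D η x X Y := by
  obtain ⟨Z, hZ, -, rfl⟩ := exists_smoothField_extend Y
  rw [nablaForm_apply hD hα hZ, nablaForm_apply hD hη hZ, nablaForm_apply hD (hα.sub hη) hZ,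
    mvfderiv_sub_fun (hα.smooth Z hZ) (hη.smooth Z hZ)]
  ring

theorem nablaForm_mul {D : Conn m M} (hD : SmoothConn D) {f : M → ℝ} (hf : SmoothFun (m := m) f)
    {α : Π x : M, TangentSpace (𝓡 m) x → ℝ} (hα : SmoothForm α) (x : M)
    (X Y : TangentSpace (𝓡 m) x) :
    nablaForm D (fun x v => f x * α x v) x X Y =
      f x * nablaForm D α x X Y + mvfderiv (𝓡 m) f x X * α x Y := by
  obtain ⟨Z, hZ, -, rfl⟩ := exists_smoothField_extend Y
  rw [nablaForm_apply hD hα hZ, nablaForm_apply hD (SmoothForm.mul hf hα) hZ,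
    mvfderiv_mul_fun hf (hα.smooth Z hZ)]
  ring

/-- The covariant derivative of an exact form is symmetric. -/
theorem nablaForm_mvfderiv_symm {D : Conn m M} (hD : SmoothConn D) {f : M → ℝ}
    (hf : SmoothFun (m := m) f) (x : M) (X Y : TangentSpace (𝓡 m) x) :
    nablaForm D (fun x v => mvfderiv (𝓡 m) f x v) x X Y =
      nablaForm D (fun x v => mvfderiv (𝓡 m) f x v) x Y X := by
  obtain ⟨X, hX, -, rfl⟩ := exists_smoothField_extend X
  obtain ⟨Y, hY, -, rfl⟩ := exists_smoothField_extend Y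
  rw [nablaForm_apply hD hf.smoothForm hX, nablaForm_apply hD hf.smoothForm hY]
  have := mvfderiv_mlieBracket hf hX hY x
  rw [hD.torsion X Y hX hY, map_sub] at this
  linarith

theorem isBilinearMap_hessian {D : Conn m M} (hD : SmoothConn D)
    {β : Π x : M, TangentSpace (𝓡 m) x → ℝ} (hβ : SmoothForm β) {f : M → ℝ}
    (hf : SmoothFun (m := m) f) (x : M) : IsBilinearMap ℝ (hessian β D f x) := by
  have h1 := isBilinearMap_nablaForm hD (hβ.lineDeriv hf) x
  have h2 := (hβ.lineDeriv hf).lin x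
  have h3 := hβ.lin x
  simp only [funext₂ (hessian_eq_nablaForm β D f x)]
  exact ⟨fun _ _ _ => by simp only [h1.add_left, h3.map_add]; ring,
    fun _ _ _ => by simp only [h1.smul_left, h3.map_smul, smul_eq_mul]; ring,
    fun _ _ _ => by simp only [h1.add_right, h2.map_add]; ring,
    fun _ _ _ => by simp only [h1.smul_right, h2.map_smul, smul_eq_mul]; ring⟩

theorem smoothFun_hessian {D : Conn m M} (hD : SmoothConn D)
    {β : Π x : M, TangentSpace (𝓡 m) x → ℝ} (hβ : SmoothForm β) {f : M → ℝ}
    (hf : SmoothFun (m := m) f) {X Y : Π y : M, TangentSpace (𝓡 m) y}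
    (hX : SmoothField X) (hY : SmoothField Y) :
    SmoothFun (m := m) fun y => hessian β D f y (X y) (Y y) := by
  simp only [hessian_eq_nablaForm]
  exact ContMDiff.add (smoothFun_nablaForm hD (hβ.lineDeriv hf) hX hY)
    (ContMDiff.mul (hβ.smooth X hX) ((hβ.lineDeriv hf).smooth Y hY))

/-- The Hessian fails to be symmetric by the curvature `dβ` of the line bundle. -/
theorem hessian_sub_swap {D : Conn m M} (hD : SmoothConn D)
    {β : Π x : M, TangentSpace (𝓡 m) x → ℝ} (hβ : SmoothForm β) {f : M → ℝ}
    (hf : SmoothFun (m := m) f) (x : M) (X Y : TangentSpace (𝓡 m) x) :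
    hessian β D f x X Y - hessian β D f x Y X =
      f x * (nablaForm D β x X Y - nablaForm D β x Y X) := by
  have h : ∀ X Y, nablaForm D (lineDeriv β f) x X Y =
      nablaForm D (fun x v => mvfderiv (𝓡 m) f x v) x X Y +
        (f x * nablaForm D β x X Y + mvfderiv (𝓡 m) f x X * β x Y) := by
    intro X Y
    rw [← nablaForm_mul hD hf hβ, ← nablaForm_add hD hf.smoothForm (SmoothForm.mul hf hβ)]
    congr 1
    ext
    simp only [lineDeriv]; ring
  rw [hessian_eq_nablaForm, hessian_eq_nablaForm, h X Y, h Y X, nablaForm_mvfderiv_symm hD hf x X Y]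
  simp only [lineDeriv]
  ring

/-! ### Compatibility of a connection with a conformal class -/

/-- The connection `D` satisfies `∇ g = -2β ⊗ g`, that is, `∇ c = 0` if `β` is the connection form
of the weight bundle in the trivialization given by `g`. -/
def Compat (D : Conn m M) (g : Metric m M) (β : Π x : M, TangentSpace (𝓡 m) x → ℝ) : Prop :=
  ∀ Y Z : Π y : M, TangentSpace (𝓡 m) y, SmoothField Y → SmoothField Z → ∀ x v,
    mvfderiv (𝓡 m) (fun y => g.inner y (Y y) (Z y)) x v =
      g.inner x (D Y x v) (Z x) + g.inner x (Y x) (D Z x v) - 2 * β x v * g.inner x (Y x) (Z x)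

/-- The covariant derivative of a metric can be computed with any smooth vector fields. -/
theorem nablaMetric_apply {D : Conn m M} (hD : SmoothConn D) (g : Metric m M)
    {Y Z : Π y : M, TangentSpace (𝓡 m) y} (hY : SmoothField Y) (hZ : SmoothField Z) (x : M)
    (v : TangentSpace (𝓡 m) x) :
    nablaMetric D g x v (Y x) (Z x) = mvfderiv (𝓡 m) (fun y => g.inner y (Y y) (Z y)) x v
      - g.inner x (D Y x v) (Z x) - g.inner x (Y x) (D Z x v) := by
  obtain ⟨Y', hY', hYe, hYx⟩ := exists_smoothField_extend (Y x)
  obtain ⟨Z', hZ', hZe, hZx⟩ := exists_smoothField_extend (Z x)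
  have h1 : nablaMetric D g x v (Y x) (Z x) =
      mvfderiv (𝓡 m) (fun y => g.inner y (Y' y) (Z' y)) x v
      - g.inner x (D Y' x v) (Z' x) - g.inner x (Y' x) (D Z' x v) := by
    unfold nablaMetric
    rw [hD.congr Y' _ hY' x hYe, hD.congr Z' _ hZ' x hZe, hYx, hZx]
    congr 3
    refine mvfderiv_congr ?_
    filter_upwards [hYe, hZe] with y hy hz
    rw [hy, hz]
  have hadd : ∀ X Y, SmoothField X → SmoothField Y → ∀ Z, SmoothField Z →
      mvfderiv (𝓡 m) (fun y => g.inner y (X y + Y y) (Z y)) x v =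
      mvfderiv (𝓡 m) (fun y => g.inner y (X y) (Z y)) x v +
      mvfderiv (𝓡 m) (fun y => g.inner y (Y y) (Z y)) x v := by
    intro X Y hX hY Z hZ
    simp only [map_add, add_apply]
    exact mvfderiv_add_fun (smoothFun_inner g hX hZ) (smoothFun_inner g hY hZ) x v
  have hmul : ∀ (f : M → ℝ) X, SmoothFun (m := m) f → SmoothField X → ∀ Z, SmoothField Z →
      mvfderiv (𝓡 m) (fun y => g.inner y (f y • X y) (Z y)) x v =
      f x * mvfderiv (𝓡 m) (fun y => g.inner y (X y) (Z y)) x v +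
        mvfderiv (𝓡 m) f x v * g.inner x (X x) (Z x) := by
    intro f X hf hX Z hZ
    simp only [map_smul, smul_apply, smul_eq_mul]
    exact mvfderiv_mul_fun hf (smoothFun_inner g hX hZ) x v
  have hswap : ∀ X Y : Π y : M, TangentSpace (𝓡 m) y,
      (fun y => g.inner y (X y) (Y y)) = fun y => g.inner y (Y y) (X y) := by
    intro X Y; ext y; exact g.symm y _ _
  have h2 : ∀ Z, SmoothField Z → ∀ Y Y', SmoothField Y → SmoothField Y' → Y x = Y' x →
      mvfderiv (𝓡 m) (fun y => g.inner y (Y y) (Z y)) x v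
      - g.inner x (D Y x v) (Z x) - g.inner x (Y x) (D Z x v) =
      mvfderiv (𝓡 m) (fun y => g.inner y (Y' y) (Z y)) x v
      - g.inner x (D Y' x v) (Z x) - g.inner x (Y' x) (D Z x v) := by
    intro Z hZ Y Y' hY hY' h
    refine eq_of_tensorial (Φ := fun Y => mvfderiv (𝓡 m) (fun y => g.inner y (Y y) (Z y)) x v
      - g.inner x (D Y x v) (Z x) - g.inner x (Y x) (D Z x v))
      (fun X Y hX hY => ?_) (fun f X hf hX => ?_) hY hY' h
    · have h3 := hadd X Y hX hY Z hZ
      simp only [hD.add X Y hX hY, map_add, add_apply] at h3 ⊢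
      rw [h3]; ring
    · have h3 := hmul f X hf hX Z hZ
      simp only [hD.leibniz f X hf hX, map_add, map_smul, add_apply, smul_apply,
        smul_eq_mul] at h3 ⊢
      rw [h3]; ring
  rw [h1, h2 Z' hZ' Y' Y hY' hY hYx, hswap Y Z', hswap Y Z]
  have h3 := h2 Y hY Z' Z hZ' hZ hZx
  rw [g.symm x (D Y x v), g.symm x (Y x), g.symm x (D Y x v), g.symm x (Y x)]
  linarith

theorem SmoothConn.compat_of_nablaMetric {D : Conn m M} (hD : SmoothConn D) {g : Metric m M}
    {β : Π x : M, TangentSpace (𝓡 m) x → ℝ}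
    (h : ∀ x v Y Z, nablaMetric D g x v Y Z + 2 * β x v * g.inner x Y Z = 0) : Compat D g β := by
  intro Y Z hY hZ x v
  have := h x v (Y x) (Z x)
  rw [nablaMetric_apply hD g hY hZ] at this
  linarith

theorem Compat.nablaMetric_eq {D : Conn m M} (hD : SmoothConn D) {g : Metric m M}
    {β : Π x : M, TangentSpace (𝓡 m) x → ℝ} (h : Compat D g β) (x : M)
    (v Y Z : TangentSpace (𝓡 m) x) : nablaMetric D g x v Y Z = -2 * β x v * g.inner x Y Z := by
  obtain ⟨Y, hY, -, rfl⟩ := exists_smoothField_extend Y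
  obtain ⟨Z, hZ, -, rfl⟩ := exists_smoothField_extend Z
  rw [nablaMetric_apply hD g hY hZ, h Y Z hY hZ]
  ring

/-- The connection form of the weight bundle is determined by the compatibility condition. -/
theorem Compat.lForm_eq {D : Conn m M} (hm : m ≠ 0) (hD : SmoothConn D) {g : Metric m M}
    {β : Π x : M, TangentSpace (𝓡 m) x → ℝ} (h : Compat D g β) (x : M)
    (v : TangentSpace (𝓡 m) x) : lForm D g x v = β x v := by
  have hm' : (m : ℝ) ≠ 0 := Nat.cast_ne_zero.2 hm
  unfold lForm
  simp only [h.nablaMetric_eq hD]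
  have := trG_smul (G := fun v w => g.inner x v w) (-2 * β x v) (fun v w => g.inner x v w)
  simp only [smul_eq_mul] at this
  rw [this, trG_self (isInner_metric g x)]
  field_simp

theorem WeylStructure.compat {c : ConformalStructure m M} (W : WeylStructure c) {g : Metric m M}
    (hg : g ∈ c.metrics) : Compat W.cov.toFun g (lForm W.cov.toFun g) :=
  W.smoothConn.compat_of_nablaMetric (W.conformal g hg)

theorem smoothForm_lForm {D : Conn m M} (hD : SmoothConn D) {g : Metric m M}
    (h : Compat D g (lForm D g)) : SmoothForm (lForm D g) where
  lin x := by
    have h1 : ∀ v w Y Z, nablaMetric D g x (v + w) Y Z =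
        nablaMetric D g x v Y Z + nablaMetric D g x w Y Z := by
      intro v w Y Z; simp only [nablaMetric, map_add, add_apply]; ring
    have h2 : ∀ (a : ℝ) v Y Z, nablaMetric D g x (a • v) Y Z = a • nablaMetric D g x v Y Z := by
      intro a v Y Z; simp only [nablaMetric, map_smul, smul_apply, smul_eq_mul]; ring
    constructor
    · intro v w
      simp only [lForm, h1, trG_add]; ring
    · intro a v
      simp only [lForm, h2, trG_smul]
      simp only [smul_eq_mul]; ring
  smooth X hX := by
    refine ContMDiff.mul contMDiff_const (smoothFun_trG (fun x => isInner_metric g x)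
      (fun x => ?_) (fun X Y hX hY => smoothFun_inner g hX hY) (fun Y Z hY hZ => ?_))
    · simp only [funext₂ (h.nablaMetric_eq hD x (X x))]
      exact ⟨by simp [mul_add], by simp [mul_left_comm], by simp [mul_add], by simp [mul_left_comm]⟩
    · simp only [nablaMetric_apply hD g hY hZ]
      exact ContMDiff.sub (ContMDiff.sub (hX.mvfderiv (smoothFun_inner g hY hZ))
        (smoothFun_inner g (hD.smooth X Y hX hY) hZ)) (smoothFun_inner g hY (hD.smooth X Z hX hZ))

theorem WeylStructure.smoothForm_lForm {c : ConformalStructure m M} (W : WeylStructure c)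
    {g : Metric m M} (hg : g ∈ c.metrics) : SmoothForm (lForm W.cov.toFun g) :=
  ConfGeom.smoothForm_lForm W.smoothConn (W.compat hg)

theorem mvfderiv_exp_two_mul {ψ : M → ℝ} (hψ : SmoothFun (m := m) ψ) (x : M)
    (v : TangentSpace (𝓡 m) x) : mvfderiv (𝓡 m) (fun y => Real.exp (2 * ψ y)) x v =
      2 * Real.exp (2 * ψ x) * mvfderiv (𝓡 m) ψ x v := by
  have h1 : HasDerivAt (fun t : ℝ => Real.exp (2 * t)) (Real.exp (2 * ψ x) * (2 * 1)) (ψ x) :=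
    ((hasDerivAt_id (ψ x)).const_mul 2).exp
  have h2 := mvfderiv_comp_apply (g := fun t : ℝ => Real.exp (2 * t)) (I := 𝓘(ℝ, ℝ))
    (I' := 𝓡 m) x
    h1.differentiableAt.mdifferentiableAt (hψ.mdiff x) v
  refine h2.trans ?_
  have h3 : mvfderiv 𝓘(ℝ, ℝ) (fun t : ℝ => Real.exp (2 * t)) (ψ x) =
      fderiv ℝ (fun t : ℝ => Real.exp (2 * t)) (ψ x) := mfderiv_eq_fderiv
  rw [h3, h1.hasFDerivAt.fderiv]
  change mvfderiv (𝓡 m) ψ x v * (Real.exp (2 * ψ x) * (2 * 1)) = _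
  ring

theorem smoothFun_exp {ψ : M → ℝ} (hψ : SmoothFun (m := m) ψ) :
    SmoothFun (m := m) fun y => Real.exp (ψ y) :=
  (Real.contDiff_exp.contMDiff).comp hψ

/-- If `g = u⁻² c` is replaced by `e^{2ψ} g`, then `u` is replaced by `e^{-ψ} u`, and the connection
form changes by `-dψ`. -/
theorem Compat.rescale {D : Conn m M} {g g' : Metric m M}
    {β : Π x : M, TangentSpace (𝓡 m) x → ℝ} (h : Compat D g β) {ψ : M → ℝ}
    (hψ : SmoothFun (m := m) ψ) (hgg : IsRescaling g g' ψ) :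
    Compat D g' (fun x v => β x v - mvfderiv (𝓡 m) ψ x v) := by
  intro Y Z hY hZ x v
  simp only [hgg _ _ _]
  have h2 : SmoothFun (m := m) fun y => Real.exp (2 * ψ y) :=
    smoothFun_exp (contMDiff_const.mul hψ)
  rw [mvfderiv_mul_fun h2 (smoothFun_inner g hY hZ), h Y Z hY hZ,
    mvfderiv_exp_two_mul hψ]
  ring

theorem WeylStructure.lForm_rescale (hm : m ≠ 0) {c : ConformalStructure m M} (W : WeylStructure c)
    {g g' : Metric m M} (hg : g ∈ c.metrics) {ψ : M → ℝ} (hψ : SmoothFun (m := m) ψ)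
    (hgg : IsRescaling g g' ψ) (x : M) (v : TangentSpace (𝓡 m) x) :
    lForm W.cov.toFun g' x v = lForm W.cov.toFun g x v - mvfderiv (𝓡 m) ψ x v :=
  ((W.compat hg).rescale hψ hgg).lForm_eq hm W.smoothConn x v

end Connection

/-! ### Curvature -/

section Curvature

variable {m : ℕ} {M : Type*} [TopologicalSpace M] [ChartedSpace (EuclideanSpace ℝ (Fin m)) M]
  [IsManifold (𝓡 m) ∞ M] {D : Conn m M}

/-- The curvature expression `∇_X ∇_Y Z - ∇_Y ∇_X Z - ∇_{[X,Y]} Z` for vector fields. -/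
noncomputable def curvField (D : Conn m M) (x : M) (X Y Z : Π y : M, TangentSpace (𝓡 m) y) :
    TangentSpace (𝓡 m) x :=
  D (fun y => D Z y (Y y)) x (X x) - D (fun y => D Z y (X y)) x (Y x)
    - D Z x (VectorField.mlieBracket (𝓡 m) X Y x)

theorem curvField_swap (x : M) (X Y Z : Π y : M, TangentSpace (𝓡 m) y) :
    curvField D x X Y Z = -curvField D x Y X Z := by
  unfold curvField
  rw [VectorField.mlieBracket_swap_apply, map_neg]
  abel

theorem SmoothConn.curvField_eq (hD : SmoothConn D) {x : M} {X Y Z : Π y : M, TangentSpace (𝓡 m) y}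
    (hX : SmoothField X) (hY : SmoothField Y) : curvField D x X Y Z =
      D (fun y => D Z y (Y y)) x (X x) - D (fun y => D Z y (X y)) x (Y x)
    - (D Z x (D Y x (X x)) - D Z x (D X x (Y x))) := by
  unfold curvField
  rw [hD.torsion X Y hX hY, map_sub]

theorem curvField_add₁ (hD : SmoothConn D) {x : M} {X X' Y Z : Π y : M, TangentSpace (𝓡 m) y}
    (hX : SmoothField X) (hX' : SmoothField X') (hY : SmoothField Y) (hZ : SmoothField Z) :
    curvField D x (fun y => X y + X' y) Y Z = curvField D x X Y Z + curvField D x X' Y Z := by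
  rw [hD.curvField_eq hX hY, hD.curvField_eq hX' hY, hD.curvField_eq (hX.add hX') hY]
  simp only [map_add, hD.add _ _ hX hX', add_apply,
    hD.add _ _ (hD.smooth X Z hX hZ) (hD.smooth X' Z hX' hZ)]
  abel

theorem curvField_smul₁ (hD : SmoothConn D) {x : M} {f : M → ℝ} (hf : SmoothFun (m := m) f)
    {X Y Z : Π y : M, TangentSpace (𝓡 m) y}
    (hX : SmoothField X) (hY : SmoothField Y) (hZ : SmoothField Z) :
    curvField D x (fun y => f y • X y) Y Z = f x • curvField D x X Y Z := by
  rw [hD.curvField_eq hX hY, hD.curvField_eq (SmoothField.smul hf hX) hY]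
  simp only [map_smul, map_add, hD.leibniz f X hf hX,
    hD.leibniz f _ hf (hD.smooth X Z hX hZ)]
  module

theorem curvField_add₃ (hD : SmoothConn D) {x : M} {X Y Z Z' : Π y : M, TangentSpace (𝓡 m) y}
    (hX : SmoothField X) (hY : SmoothField Y) (hZ : SmoothField Z) (hZ' : SmoothField Z') :
    curvField D x X Y (fun y => Z y + Z' y) = curvField D x X Y Z + curvField D x X Y Z' := by
  simp only [curvField, hD.add _ _ hZ hZ', add_apply,
    hD.add _ _ (hD.smooth X Z hX hZ) (hD.smooth X Z' hX hZ'),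
    hD.add _ _ (hD.smooth Y Z hY hZ) (hD.smooth Y Z' hY hZ')]
  abel

variable [T2Space M]

/-- Linearity over functions in the last entry: the second derivatives of `f` cancel against the
derivative of `f` along the bracket. -/
theorem curvField_smul₃ (hD : SmoothConn D) {x : M} {f : M → ℝ} (hf : SmoothFun (m := m) f)
    {X Y Z : Π y : M, TangentSpace (𝓡 m) y}
    (hX : SmoothField X) (hY : SmoothField Y) (hZ : SmoothField Z) :
    curvField D x X Y (fun y => f y • Z y) = f x • curvField D x X Y Z := by
  have h1 : ∀ V W : Π y : M, TangentSpace (𝓡 m) y, SmoothField V → SmoothField W →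
      D (fun y => D (fun y => f y • Z y) y (V y)) x (W x) =
        f x • D (fun y => D Z y (V y)) x (W x) + mvfderiv (𝓡 m) f x (W x) • D Z x (V x) +
        (mvfderiv (𝓡 m) f x (V x) • D Z x (W x) +
          mvfderiv (𝓡 m) (fun y => mvfderiv (𝓡 m) f y (V y)) x (W x) • Z x) := by
    intro V W hV hW
    simp only [hD.leibniz f Z hf hZ]
    rw [hD.add _ _ (SmoothField.smul hf (hD.smooth V Z hV hZ))
      (SmoothField.smul (hV.mvfderiv hf) hZ), add_apply,
      hD.leibniz _ _ hf (hD.smooth V Z hV hZ), hD.leibniz _ _ (hV.mvfderiv hf) hZ]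
  have h2 := mvfderiv_mlieBracket hf hX hY x
  unfold curvField
  rw [h1 Y X hY hX, h1 X Y hX hY, hD.leibniz f Z hf hZ, h2]
  module

/-- The curvature can be computed with any smooth vector fields. -/
theorem curvature_apply (hD : SmoothConn D) {X Y Z : Π y : M, TangentSpace (𝓡 m) y}
    (hX : SmoothField X) (hY : SmoothField Y) (hZ : SmoothField Z) (x : M) :
    curvature D x (X x) (Y x) (Z x) = curvField D x X Y Z := by
  obtain ⟨X', hX', hXe, hXx⟩ := exists_smoothField_extend (X x)
  obtain ⟨Y', hY', hYe, hYx⟩ := exists_smoothField_extend (Y x)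
  obtain ⟨Z', hZ', hZe, hZx⟩ := exists_smoothField_extend (Z x)
  have hDZ : ∀ᶠ y in 𝓝 x, D (FiberBundle.extend (EuclideanSpace ℝ (Fin m)) (Z x)) y = D Z' y := by
    filter_upwards [hZe.eventually_nhds] with y hy
    exact hD.congr Z' _ hZ' y hy
  have h1 : ∀ V V' : Π y : M, TangentSpace (𝓡 m) y, SmoothField V → (∀ᶠ y in 𝓝 x, V y = V' y) →
      D (fun y => D (FiberBundle.extend (EuclideanSpace ℝ (Fin m)) (Z x)) y (V' y)) x =
        D (fun y => D Z' y (V y)) x := by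
    intro V V' hV hVe
    refine hD.congr _ _ (hD.smooth V Z' hV hZ') x ?_
    filter_upwards [hDZ, hVe] with y hy hy'
    rw [hy, hy']
  have h0 : curvature D x (X x) (Y x) (Z x) = curvField D x X' Y' Z' := by
    unfold curvature curvField
    rw [h1 Y' _ hY' hYe, h1 X' _ hX' hXe, hDZ.self_of_nhds, hXx, hYx]
    congr 2
    exact (Filter.EventuallyEq.mlieBracket_vectorField_eq hXe hYe).symm
  rw [h0]
  calc curvField D x X' Y' Z' = curvField D x X Y' Z' :=
        eq_of_tensorial (Φ := fun X => curvField D x X Y' Z')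
          (fun X Y hX hY => curvField_add₁ hD hX hY hY' hZ')
          (fun f X hf hX => curvField_smul₁ hD hf hX hY' hZ') hX' hX hXx
    _ = -curvField D x Y' X Z' := curvField_swap x X Y' Z'
    _ = -curvField D x Y X Z' := congrArg _ <|
        eq_of_tensorial (Φ := fun Y => curvField D x Y X Z')
          (fun _ _ h h' => curvField_add₁ hD h h' hX hZ')
          (fun f _ hf h => curvField_smul₁ hD hf h hX hZ') hY' hY hYx
    _ = curvField D x X Y Z' := (curvField_swap x X Y Z').symm
    _ = curvField D x X Y Z :=
        eq_of_tensorial (Φ := fun Z => curvField D x X Y Z)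
          (fun _ _ h h' => curvField_add₃ hD hX hY h h')
          (fun f _ hf h => curvField_smul₃ hD hf hX hY h) hZ' hZ hZx

theorem isLinearMap_curvature₁ (hD : SmoothConn D) (x : M) (v w : TangentSpace (𝓡 m) x) :
    IsLinearMap ℝ (fun u => curvature D x u v w) := by
  obtain ⟨Y, hY, -, rfl⟩ := exists_smoothField_extend v
  obtain ⟨Z, hZ, -, rfl⟩ := exists_smoothField_extend w
  exact isLinearMap_of_tensorial (Φ := fun X => curvField D x X Y Z)
    (fun _ _ h h' => curvField_add₁ hD h h' hY hZ) (fun f _ hf h => curvField_smul₁ hD hf h hY hZ)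
    (fun X hX => curvature_apply hD hX hY hZ x)

theorem curvature_swap (hD : SmoothConn D) (x : M) (u v w : TangentSpace (𝓡 m) x) :
    curvature D x u v w = -curvature D x v u w := by
  obtain ⟨X, hX, -, rfl⟩ := exists_smoothField_extend u
  obtain ⟨Y, hY, -, rfl⟩ := exists_smoothField_extend v
  obtain ⟨Z, hZ, -, rfl⟩ := exists_smoothField_extend w
  rw [curvature_apply hD hX hY hZ, curvature_apply hD hY hX hZ, curvField_swap]

theorem isLinearMap_curvature₂ (hD : SmoothConn D) (x : M) (u w : TangentSpace (𝓡 m) x) :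
    IsLinearMap ℝ (fun v => curvature D x u v w) := by
  have h := isLinearMap_curvature₁ hD x u w
  constructor
  · intro v v'
    rw [curvature_swap hD, h.map_add, curvature_swap hD x u v, curvature_swap hD x u v']; abel
  · intro a v
    rw [curvature_swap hD, h.map_smul, curvature_swap hD x u v, smul_neg]

theorem isLinearMap_curvature₃ (hD : SmoothConn D) (x : M) (u v : TangentSpace (𝓡 m) x) :
    IsLinearMap ℝ (fun w => curvature D x u v w) := by
  obtain ⟨X, hX, -, rfl⟩ := exists_smoothField_extend u
  obtain ⟨Y, hY, -, rfl⟩ := exists_smoothField_extend v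
  exact isLinearMap_of_tensorial (Φ := fun Z => curvField D x X Y Z)
    (fun _ _ h h' => curvField_add₃ hD hX hY h h') (fun f _ hf h => curvField_smul₃ hD hf hX hY h)
    (fun Z hZ => curvature_apply hD hX hY hZ x)

theorem smoothField_curvature (hD : SmoothConn D) {X Y Z : Π y : M, TangentSpace (𝓡 m) y}
    (hX : SmoothField X) (hY : SmoothField Y) (hZ : SmoothField Z) :
    SmoothField fun x => curvature D x (X x) (Y x) (Z x) := by
  simp only [curvature_apply hD hX hY hZ, curvField]
  exact ((hD.smooth _ _ hX (hD.smooth _ _ hY hZ)).sub (hD.smooth _ _ hY (hD.smooth _ _ hX hZ))).sub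
    (hD.smooth _ _ (hX.mlieBracket hY) hZ)

theorem isBilinearMap_ricci (hD : SmoothConn D) (x : M) : IsBilinearMap ℝ (ricci D x) := by
  have hc : ∀ v w : TangentSpace (𝓡 m) x, ∀ i, coordAt x i (v + w) = coordAt x i v + coordAt x i w :=
    fun _ _ _ => rfl
  have hs : ∀ (a : ℝ) (v : TangentSpace (𝓡 m) x), ∀ i, coordAt x i (a • v) = a * coordAt x i v :=
    fun _ _ _ => rfl
  unfold ricci endTrace
  refine ⟨?_, ?_, ?_, ?_⟩
  · intro v v' w
    simp only [(isLinearMap_curvature₂ hD x _ w).map_add, hc, Finset.sum_add_distrib]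
  · intro a v w
    simp only [(isLinearMap_curvature₂ hD x _ w).map_smul, hs, Finset.mul_sum, smul_eq_mul]
  · intro v w w'
    simp only [(isLinearMap_curvature₃ hD x _ v).map_add, hc, Finset.sum_add_distrib]
  · intro a v w
    simp only [(isLinearMap_curvature₃ hD x _ v).map_smul, hs, Finset.mul_sum, smul_eq_mul]

/-- The metric is auxiliary: it turns the trace of an endomorphism into a trace of a bilinear form.
-/
theorem smoothFun_ricci (hD : SmoothConn D) (g : Metric m M) {X Y : Π y : M, TangentSpace (𝓡 m) y}
    (hX : SmoothField X) (hY : SmoothField Y) :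
    SmoothFun (m := m) fun x => ricci D x (X x) (Y x) := by
  have h : ∀ x, ricci D x (X x) (Y x) = trG x (fun v w => g.inner x v w)
      (fun v w => g.inner x (curvature D x v (X x) (Y x)) w) := fun x =>
    endTrace_eq_trG (isInner_metric g x) (isLinearMap_curvature₁ hD x (X x) (Y x))
  simp only [h]
  refine smoothFun_trG (fun x => isInner_metric g x) (fun x => ?_)
    (fun X Y hX hY => smoothFun_inner g hX hY)
    (fun V W hV hW => smoothFun_inner g (smoothField_curvature hD hV hX hY) hW)
  have := isLinearMap_curvature₁ hD x (X x) (Y x)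
  exact ⟨fun _ _ _ => by simp [this.map_add], fun _ _ _ => by simp [this.map_smul],
    by simp, by simp⟩

/-- The curvature is skew-symmetric up to the curvature `dβ` of the weight bundle; this is the
second derivative of `∇ g = -2β ⊗ g`, skew-symmetrized. -/
theorem Compat.inner_curvature (hD : SmoothConn D) {g : Metric m M}
    {β : Π x : M, TangentSpace (𝓡 m) x → ℝ} (hβ : SmoothForm β) (h : Compat D g β) (x : M)
    (u v w z : TangentSpace (𝓡 m) x) :
    g.inner x (curvature D x u v w) z + g.inner x w (curvature D x u v z) =
      2 * (nablaForm D β x u v - nablaForm D β x v u) * g.inner x w z := by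
  obtain ⟨X, hX, -, rfl⟩ := exists_smoothField_extend u
  obtain ⟨Y, hY, -, rfl⟩ := exists_smoothField_extend v
  obtain ⟨Z, hZ, -, rfl⟩ := exists_smoothField_extend w
  obtain ⟨W, hW, -, rfl⟩ := exists_smoothField_extend z
  have hbr := mvfderiv_mlieBracket (smoothFun_inner g hZ hW) hX hY x
  have h2 : ∀ X Y : Π y : M, TangentSpace (𝓡 m) y, SmoothField X → SmoothField Y →
      mvfderiv (𝓡 m) (fun y => mvfderiv (𝓡 m) (fun y => g.inner y (Z y) (W y)) y (Y y)) x (X x) =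
      mvfderiv (𝓡 m) (fun y => g.inner y (D Z y (Y y)) (W y)) x (X x) +
      mvfderiv (𝓡 m) (fun y => g.inner y (Z y) (D W y (Y y))) x (X x) -
      2 * (β x (Y x) * mvfderiv (𝓡 m) (fun y => g.inner y (Z y) (W y)) x (X x) +
        mvfderiv (𝓡 m) (fun y => β y (Y y)) x (X x) * g.inner x (Z x) (W x)) := by
    intro X Y hX hY
    have e1 := smoothFun_inner g (hD.smooth Y Z hY hZ) hW
    have e2 := smoothFun_inner g hZ (hD.smooth Y W hY hW)
    have e3 := hβ.smooth Y hY
    have e4 := smoothFun_inner g hZ hW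
    have : (fun y => mvfderiv (𝓡 m) (fun y => g.inner y (Z y) (W y)) y (Y y)) =
        fun y => (g.inner y (D Z y (Y y)) (W y) + g.inner y (Z y) (D W y (Y y))) -
          2 * (β y (Y y) * g.inner y (Z y) (W y)) := by
      ext y; rw [h Z W hZ hW]; ring
    have e34 : SmoothFun (m := m) fun y => β y (Y y) * g.inner y (Z y) (W y) := e3.mul e4
    have e12 : SmoothFun (m := m) fun y =>
      g.inner y (D Z y (Y y)) (W y) + g.inner y (Z y) (D W y (Y y)) := e1.add e2
    have e5 : SmoothFun (m := m) fun y => 2 * (β y (Y y) * g.inner y (Z y) (W y)) :=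
      contMDiff_const.mul e34
    rw [this, mvfderiv_sub_fun e12 e5, mvfderiv_add_fun e1 e2,
      mvfderiv_mul_fun contMDiff_const e34, mvfderiv_mul_fun e3 e4, mvfderiv_const]
    simp
  rw [h2 X Y hX hY, h2 Y X hY hX, hD.torsion X Y hX hY, map_sub] at hbr
  simp only [h Z W hZ hW, h _ W (hD.smooth Y Z hY hZ) hW, h _ W (hD.smooth X Z hX hZ) hW,
    h Z _ hZ (hD.smooth Y W hY hW), h Z _ hZ (hD.smooth X W hX hW)] at hbr
  rw [curvature_apply hD hX hY hZ, curvature_apply hD hX hY hW, nablaForm_apply hD hβ hX,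
    nablaForm_apply hD hβ hY, hD.curvField_eq hX hY, hD.curvField_eq hX hY]
  simp only [map_sub, sub_apply]
  linarith

/-- The Faraday form of a Weyl structure is the curvature of its weight bundle. -/
theorem Compat.faraday_eq (hm : m ≠ 0) (hD : SmoothConn D) {g : Metric m M}
    {β : Π x : M, TangentSpace (𝓡 m) x → ℝ} (hβ : SmoothForm β) (h : Compat D g β) (x : M)
    (u v : TangentSpace (𝓡 m) x) :
    faraday D x u v = nablaForm D β x u v - nablaForm D β x v u := by
  have hm' : (m : ℝ) ≠ 0 := Nat.cast_ne_zero.2 hm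
  obtain ⟨b, hb⟩ := (isInner_metric g x).exists_orthonormal finrank_tangentSpace
  unfold faraday
  rw [endTrace_eq_sum (isInner_metric g x) (isLinearMap_curvature₃ hD x u v) hb]
  have : ∀ i, g.inner x (curvature D x u v (b i)) (b i) =
      nablaForm D β x u v - nablaForm D β x v u := by
    intro i
    have h1 := h.inner_curvature hD hβ x u v (b i) (b i)
    have h2 : g.inner x (b i) (b i) = 1 := by simpa using hb i i
    rw [g.symm x (b i), h2] at h1
    linarith
  simp only [this]
  simp
  field_simp

end Curvature

/-! ### Change of Weyl structure -/

section Change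

variable {m : ℕ} {M : Type*} [TopologicalSpace M] [ChartedSpace (EuclideanSpace ℝ (Fin m)) M]
  [IsManifold (𝓡 m) ∞ M] {D D' : Conn m M}

theorem SmoothConn.sub (hD : SmoothConn D) {X Y : Π y : M, TangentSpace (𝓡 m) y}
    (hX : SmoothField X) (hY : SmoothField Y) (x : M) :
    D (fun y => X y - Y y) x = D X x - D Y x := by
  have := hD.add _ _ (hX.sub hY) hY x
  simp only [sub_add_cancel] at this
  change D X x = _ at this
  rw [this]; abel

/-- Two Weyl structures `∇` and `∇'` differ by the one-form `θ = β' - β`, where `β` and `β'` are the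
connection forms on the weight bundle, and by its dual vector field `T`:
`∇'_X Y = ∇_X Y + θ(X) Y + θ(Y) X - g(X, Y) T`. -/
structure ConnChange (D D' : Conn m M) (g : Metric m M) (θ : Π x : M, TangentSpace (𝓡 m) x → ℝ)
    (T : Π x : M, TangentSpace (𝓡 m) x) : Prop where
  form : SmoothForm θ
  field : SmoothField T
  dual : ∀ x v, g.inner x (T x) v = θ x v
  eq : ∀ Y, SmoothField Y → ∀ x v,
    D' Y x v = D Y x v + θ x v • Y x + θ x (Y x) • v - g.inner x v (Y x) • T x

variable [T2Space M]

/-- Two torsion-free connections that are compatible with the same conformal class differ by a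
one-form: the fundamental theorem of Weyl geometry. -/
theorem exists_connChange (hm : m ≠ 0) (hD : SmoothConn D) (hD' : SmoothConn D') {g : Metric m M}
    {β β' : Π x : M, TangentSpace (𝓡 m) x → ℝ} (hβ : SmoothForm β) (hβ' : SmoothForm β')
    (h : Compat D g β) (h' : Compat D' g β') :
    ∃ T, ConnChange D D' g (fun x v => β' x v - β x v) T := by
  have hform := hβ'.sub hβ
  have hriesz : ∀ x, ∃ t : TangentSpace (𝓡 m) x, ∀ v, g.inner x t v = β' x v - β x v := by
    intro x
    obtain ⟨b, hb⟩ := (isInner_metric g x).exists_orthonormal finrank_tangentSpace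
    refine ⟨∑ i, (β' x (b i) - β x (b i)) • b i, fun v => ?_⟩
    have h1 := (isInner_metric g x).sum_smul hb v
    have h2 : ∀ L : TangentSpace (𝓡 m) x →ₗ[ℝ] ℝ, L v = ∑ i, g.inner x v (b i) * L (b i) := by
      intro L
      conv_lhs => rw [← h1]
      simp
    have h3 := h2 (IsLinearMap.mk' _ (hform.lin x))
    rw [IsLinearMap.mk'_apply] at h3
    rw [h3, IsBilinearMap.sum_left (isInner_metric g x).bilin]
    refine Finset.sum_congr rfl fun i _ => ?_
    rw [map_smul, smul_apply, smul_eq_mul, g.symm x v, IsLinearMap.mk'_apply]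
    ring
  choose T hT using hriesz
  have heq : ∀ Y, SmoothField Y → ∀ x v, D' Y x v = D Y x v + (β' x v - β x v) • Y x +
      (β' x (Y x) - β x (Y x)) • v - g.inner x v (Y x) • T x := by
    intro Y hY x v
    obtain ⟨X, hX, -, rfl⟩ := exists_smoothField_extend v
    refine (isInner_metric g x).ext fun z => ?_
    obtain ⟨Z, hZ, -, rfl⟩ := exists_smoothField_extend z
    -- the difference of the connections is symmetric, and skew up to the difference of the forms,
    -- so that the Koszul argument determines it
    have hs : ∀ X Y, SmoothField X → SmoothField Y →
        D' Y x (X x) - D Y x (X x) = D' X x (Y x) - D X x (Y x) := by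
      intro X Y hX hY
      have h1 := hD.torsion X Y hX hY x
      have h2 := hD'.torsion X Y hX hY x
      rw [h1, sub_eq_sub_iff_add_eq_add] at h2
      rw [sub_eq_sub_iff_add_eq_add, ← h2, add_comm]
    have hs' : ∀ X Y, SmoothField X → SmoothField Y → ∀ Z,
        g.inner x (D' Y x (X x)) Z - g.inner x (D Y x (X x)) Z =
          g.inner x (D' X x (Y x)) Z - g.inner x (D X x (Y x)) Z := by
      intro X Y hX hY Z
      have := congrArg (fun L => g.inner x L Z) (hs X Y hX hY)
      simpa using this
    have hk : ∀ X Y Z, SmoothField X → SmoothField Y → SmoothField Z →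
        (g.inner x (D' Y x (X x)) (Z x) - g.inner x (D Y x (X x)) (Z x)) +
        (g.inner x (D' Z x (X x)) (Y x) - g.inner x (D Z x (X x)) (Y x)) =
        2 * (β' x (X x) - β x (X x)) * g.inner x (Y x) (Z x) := by
      intro X Y Z hX hY hZ
      have h1 := h Y Z hY hZ x (X x)
      have h2 := h' Y Z hY hZ x (X x)
      rw [g.symm x (D' Z x (X x)), g.symm x (D Z x (X x))]
      linarith
    have k1 := hk X Y Z hX hY hZ
    have k2 := hk Y Z X hY hZ hX
    have k3 := hk Z X Y hZ hX hY
    have s1 := hs' X Y hX hY (Z x)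
    have s2 := hs' Y Z hY hZ (X x)
    have s3 := hs' Z X hZ hX (Y x)
    simp only [map_add, map_sub, map_smul, add_apply, sub_apply, smul_apply, smul_eq_mul, hT]
    rw [g.symm x (Z x) (X x)] at k2
    linarith
  refine ⟨T, hform, ?_, hT, heq⟩
  -- the formula for `∇'_e e`, with a nonvanishing field `e`, expresses `T` through smooth fields
  intro x
  obtain ⟨e, he, hb, -⟩ := exists_frame (m := m) x
  let i : Fin m := ⟨0, Nat.pos_of_ne_zero hm⟩
  have hne : ∀ᶠ y in 𝓝 x, g.inner y (e i y) (e i y) ≠ 0 := by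
    filter_upwards [hb] with y ⟨b, hb⟩
    rw [← hb i]
    exact (g.pos y _ (b.ne_zero i)).ne'
  have hTe : ∀ᶠ y in 𝓝 x, T y = (g.inner y (e i y) (e i y))⁻¹ •
      ((2 * (β' y (e i y) - β y (e i y))) • e i y - (D' (e i) y (e i y) - D (e i) y (e i y))) := by
    filter_upwards [hne] with y hy
    rw [eq_inv_smul_iff₀ hy, heq _ (he i)]
    module
  have hsm : SmoothField fun y => (2 * (β' y (e i y) - β y (e i y))) • e i y -
      (D' (e i) y (e i y) - D (e i) y (e i y)) :=
    (SmoothField.smul (contMDiff_const.mul (hform.smooth _ (he i))) (he i)).sub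
      ((hD'.smooth _ _ (he i) (he i)).sub (hD.smooth _ _ (he i) (he i)))
  have hc : ContMDiffAt (𝓡 m) 𝓘(ℝ, ℝ) ∞ (fun y => (g.inner y (e i y) (e i y))⁻¹) x :=
    (smoothFun_inner g (he i) (he i) x).inv₀ hne.self_of_nhds
  refine (hc.smul_section (hsm x)).congr_of_eventuallyEq ?_
  filter_upwards [hTe] with y hy
  rw [hy]; rfl

variable {g : Metric m M} {θ : Π x : M, TangentSpace (𝓡 m) x → ℝ} {T : Π x : M, TangentSpace (𝓡 m) x}

theorem ConnChange.nablaForm_eq (hD : SmoothConn D) (hD' : SmoothConn D')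
    (hc : ConnChange D D' g θ T) {η : Π x : M, TangentSpace (𝓡 m) x → ℝ} (hη : SmoothForm η)
    (x : M) (X Y : TangentSpace (𝓡 m) x) : nablaForm D' η x X Y =
      nablaForm D η x X Y - θ x X * η x Y - θ x Y * η x X + g.inner x X Y * η x (T x) := by
  obtain ⟨Y, hY, -, rfl⟩ := exists_smoothField_extend Y
  rw [nablaForm_apply hD hη hY, nablaForm_apply hD' hη hY, hc.eq Y hY]
  have hl := hη.lin x
  rw [hl.map_sub, hl.map_add, hl.map_add, hl.map_smul, hl.map_smul, hl.map_smul]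
  simp only [smul_eq_mul]; ring

/-- The change of the Hessian on the weight bundle. -/
theorem ConnChange.hessian_eq (hD : SmoothConn D) (hD' : SmoothConn D')
    (hc : ConnChange D D' g θ T) {β β' : Π x : M, TangentSpace (𝓡 m) x → ℝ} (hβ : SmoothForm β)
    (hβ' : ∀ x v, β' x v = β x v + θ x v) {f : M → ℝ} (hf : SmoothFun (m := m) f)
    (x : M) (X Y : TangentSpace (𝓡 m) x) : hessian β' D' f x X Y =
      hessian β D f x X Y + f x * (nablaForm D θ x X Y - θ x X * θ x Y)
        + lineDeriv β' f x (T x) * g.inner x X Y := by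
  have h1 : lineDeriv β' f = fun x v => lineDeriv β f x v + f x * θ x v := by
    ext x v; simp only [lineDeriv, hβ']; ring
  have h2 := hβ.lineDeriv hf
  have h3 := SmoothForm.mul hf hc.form
  rw [hessian_eq_nablaForm, hessian_eq_nablaForm, h1, nablaForm_add hD' h2 h3,
    hc.nablaForm_eq hD hD' h2, hc.nablaForm_eq hD hD' h3, nablaForm_mul hD hf hc.form, hβ']
  have h4 : mvfderiv (𝓡 m) f x X = lineDeriv β f x X - β x X * f x := by
    simp only [lineDeriv]; ring
  rw [h4]
  ring

/-- The change of the curvature. -/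
theorem ConnChange.curvature_eq (hD : SmoothConn D) (hD' : SmoothConn D')
    (hc : ConnChange D D' g θ T) {β : Π x : M, TangentSpace (𝓡 m) x → ℝ} (h : Compat D g β) (x : M)
    (u v w : TangentSpace (𝓡 m) x) : curvature D' x u v w =
      curvature D x u v w + (nablaForm D θ x u v - nablaForm D θ x v u) • w
      + nablaForm D θ x u w • v - nablaForm D θ x v w • u
      - g.inner x v w • (D T x u - (2 * β x u) • T x) + g.inner x u w • (D T x v - (2 * β x v) • T x)
      + (θ x v * θ x w) • u - (θ x u * θ x w) • v
      - θ x (T x) • (g.inner x v w • u - g.inner x u w • v)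
      + (g.inner x v w * θ x u - g.inner x u w * θ x v) • T x := by
  obtain ⟨X, hX, -, rfl⟩ := exists_smoothField_extend u
  obtain ⟨Y, hY, -, rfl⟩ := exists_smoothField_extend v
  obtain ⟨Z, hZ, -, rfl⟩ := exists_smoothField_extend w
  have hθ := hc.form
  have hT := hc.field
  have hl := hθ.lin x
  have h1 : ∀ X Y, SmoothField X → SmoothField Y → D' (fun y => D' Z y (Y y)) x (X x) =
      D (fun y => D Z y (Y y)) x (X x) +
        (θ x (Y x) • D Z x (X x) + mvfderiv (𝓡 m) (fun y => θ y (Y y)) x (X x) • Z x) +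
        (θ x (Z x) • D Y x (X x) + mvfderiv (𝓡 m) (fun y => θ y (Z y)) x (X x) • Y x) -
        (g.inner x (Y x) (Z x) • D T x (X x) +
          mvfderiv (𝓡 m) (fun y => g.inner y (Y y) (Z y)) x (X x) • T x)
      + θ x (X x) • D' Z x (Y x) + θ x (D' Z x (Y x)) • X x
      - g.inner x (X x) (D' Z x (Y x)) • T x := by
    intro X Y hX hY
    rw [hc.eq _ (hD'.smooth Y Z hY hZ) x (X x)]
    have e : (fun y => D' Z y (Y y)) = fun y => D Z y (Y y) + θ y (Y y) • Z y + θ y (Z y) • Y y -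
        g.inner y (Y y) (Z y) • T y := by
      ext1 y; exact hc.eq Z hZ y (Y y)
    have s1 := hD.smooth Y Z hY hZ
    have s2 := SmoothField.smul (hθ.smooth Y hY) hZ
    have s3 := SmoothField.smul (hθ.smooth Z hZ) hY
    have s4 := SmoothField.smul (smoothFun_inner g hY hZ) hT
    conv_lhs => rw [e]
    rw [hD.sub ((s1.add s2).add s3) s4, hD.add _ _ (s1.add s2) s3, hD.add _ _ s1 s2]
    simp only [sub_apply, add_apply, hD.leibniz _ _ (hθ.smooth Y hY) hZ,
      hD.leibniz _ _ (hθ.smooth Z hZ) hY, hD.leibniz _ _ (smoothFun_inner g hY hZ) hT]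
  rw [curvature_apply hD hX hY hZ, curvature_apply hD' hX hY hZ, hD.curvField_eq hX hY, curvField,
    hD.torsion X Y hX hY, h1 X Y hX hY, h1 Y X hY hX, nablaForm_apply hD hθ hX,
    nablaForm_apply hD hθ hY, nablaForm_apply hD hθ hZ, nablaForm_apply hD hθ hZ,
    h Y Z hY hZ, h X Z hX hZ]
  simp only [hc.eq Z hZ, hl.map_add, hl.map_sub, hl.map_smul, map_add, map_sub, map_smul,
    sub_apply, smul_eq_mul]
  have hXT : g.inner x (X x) (T x) = θ x (X x) := by rw [g.symm, hc.dual]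
  have hYT : g.inner x (Y x) (T x) = θ x (Y x) := by rw [g.symm, hc.dual]
  rw [hXT, hYT, g.symm x (Y x) (X x), g.symm x (Y x) (D Z x (X x)), g.symm x (X x) (D Z x (Y x))]
  module

/-- The derivative of the dual vector field `T`, corrected by the weight, is dual to `∇θ`. -/
theorem ConnChange.inner_field (hD : SmoothConn D) (hc : ConnChange D D' g θ T)
    {β : Π x : M, TangentSpace (𝓡 m) x → ℝ} (h : Compat D g β) (x : M)
    (u w : TangentSpace (𝓡 m) x) :
    g.inner x (D T x u - (2 * β x u) • T x) w = nablaForm D θ x u w := by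
  obtain ⟨Z, hZ, -, rfl⟩ := exists_smoothField_extend w
  have h1 := h T Z hc.field hZ x u
  simp only [hc.dual] at h1
  rw [nablaForm_apply hD hc.form hZ, h1, map_sub, map_smul, sub_apply, smul_apply, hc.dual]
  simp only [smul_eq_mul]; ring

/-- The change of the Ricci tensor, up to a multiple of the metric. -/
theorem ConnChange.exists_ricci_eq (hD : SmoothConn D) (hD' : SmoothConn D')
    (hc : ConnChange D D' g θ T) {β : Π x : M, TangentSpace (𝓡 m) x → ℝ} (h : Compat D g β)
    (x : M) : ∃ κ : ℝ, ∀ u v : TangentSpace (𝓡 m) x, ricci D' x u v =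
      ricci D x u v + nablaForm D θ x v u - ((m : ℝ) - 1) * nablaForm D θ x u v
        + ((m : ℝ) - 2) * (θ x u * θ x v) + κ * g.inner x u v := by
  have hg := isInner_metric g x
  obtain ⟨b, hb⟩ := hg.exists_orthonormal finrank_tangentSpace
  have hb1 : ∀ i, g.inner x (b i) (b i) = 1 := fun i => by simpa using hb i i
  have hexp : ∀ {L : TangentSpace (𝓡 m) x → ℝ}, IsLinearMap ℝ L → ∀ v,
      ∑ i, L (b i) * g.inner x v (b i) = L v := by
    intro L hL v
    have h1 : IsLinearMap.mk' L hL v = _ := congrArg _ (hg.sum_smul hb v).symm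
    rw [map_sum] at h1
    simp only [map_smul, IsLinearMap.mk'_apply, smul_eq_mul] at h1
    rw [h1]
    exact Finset.sum_congr rfl fun i _ => mul_comm _ _
  have hN := isBilinearMap_nablaForm hD hc.form x
  have hθ := hc.form.lin x
  refine ⟨(∑ i, θ x (b i) * θ x (b i)) - (∑ i, nablaForm D θ x (b i) (b i))
    - ((m : ℝ) - 1) * θ x (T x), fun u v => ?_⟩
  have hterm : ∀ i, g.inner x (curvature D' x (b i) u v) (b i) =
      g.inner x (curvature D x (b i) u v) (b i)
      + nablaForm D θ x (b i) u * g.inner x v (b i) - nablaForm D θ x u (b i) * g.inner x v (b i)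
      + nablaForm D θ x (b i) v * g.inner x u (b i) - nablaForm D θ x u v
      - g.inner x u v * nablaForm D θ x (b i) (b i) + nablaForm D θ x u (b i) * g.inner x v (b i)
      + θ x u * θ x v - θ x v * (θ x (b i) * g.inner x u (b i))
      - θ x (T x) * (g.inner x u v - g.inner x u (b i) * g.inner x v (b i))
      + g.inner x u v * (θ x (b i) * θ x (b i)) - θ x u * (θ x (b i) * g.inner x v (b i)) := by
    intro i
    rw [hc.curvature_eq hD hD' h]
    simp only [map_add, map_sub (g.inner x), map_smul, add_apply, sub_apply, smul_apply,
      smul_eq_mul, hc.dual, hb1]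
    have e1 := hc.inner_field hD h x (b i) (b i)
    have e2 := hc.inner_field hD h x u (b i)
    simp only [map_sub, map_smul, sub_apply, smul_apply, smul_eq_mul, hc.dual] at e1 e2
    rw [← e1, ← e2, g.symm x (b i) v]
    ring
  unfold ricci
  rw [endTrace_eq_sum hg (isLinearMap_curvature₁ hD x u v) hb,
    endTrace_eq_sum hg (isLinearMap_curvature₁ hD' x u v) hb]
  simp only [hterm, Finset.sum_add_distrib, Finset.sum_sub_distrib, ← Finset.mul_sum,
    hexp (L := fun z => nablaForm D θ x z u)
      ⟨fun a b => hN.add_left a b u, fun a b => hN.smul_left a b u⟩,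
    hexp (L := fun z => nablaForm D θ x z v)
      ⟨fun a b => hN.add_left a b v, fun a b => hN.smul_left a b v⟩,
    hexp ⟨hN.add_right u, fun a b => hN.smul_right a u b⟩, hexp hθ,
    hexp ⟨map_add (g.inner x u), map_smul (g.inner x u)⟩, Finset.sum_const, Finset.card_univ,
    Fintype.card_fin, nsmul_eq_mul]
  ring

/-- Up to a multiple of the metric, `(m - 2) hˢ` is the symmetric part of the Ricci tensor. -/
theorem exists_schoutenSym_eq_symPart_ricci (g : Metric m M) (D : Conn m M) (x : M) :
    ∃ κ : ℝ, ∀ X Y, schoutenSym D g x X Y =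
      (1 / ((m : ℝ) - 2)) * symPart (ricci D x) X Y + κ * g.inner x X Y := by
  refine ⟨-(1 / ((m : ℝ) - 2)) * ((1 / (m : ℝ)) * trG x (fun v w => g.inner x v w)
    (symPart (ricci D x))) + (1 / (2 * (m : ℝ) * ((m : ℝ) - 1))) * scal D g x, fun X Y => ?_⟩
  unfold schoutenSym traceFree
  ring

/-- The change of the Schouten-Weyl tensor, up to a multiple of the metric: `hˢ` changes by `-(sym
∇θ - θ ⊗ θ)`, which is opposite to the change of the Hessian. -/
theorem ConnChange.exists_schoutenSym_eq (hm : 3 ≤ m) (hD : SmoothConn D) (hD' : SmoothConn D')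
    (hc : ConnChange D D' g θ T) {β : Π x : M, TangentSpace (𝓡 m) x → ℝ} (h : Compat D g β)
    (x : M) : ∃ κ : ℝ, ∀ u v : TangentSpace (𝓡 m) x, schoutenSym D' g x u v =
      schoutenSym D g x u v - symPart (nablaForm D θ x) u v + θ x u * θ x v
        + κ * g.inner x u v := by
  have hm0 : m ≠ 0 := by lia
  have hm3 : (3 : ℝ) ≤ m := by exact_mod_cast hm
  have hm2 : (m : ℝ) - 2 ≠ 0 := by linarith
  obtain ⟨κ₁, h₁⟩ := exists_schoutenSym_eq_symPart_ricci g D x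
  obtain ⟨κ₂, h₂⟩ := exists_schoutenSym_eq_symPart_ricci g D' x
  obtain ⟨κ₃, h₃⟩ := hc.exists_ricci_eq hD hD' h x
  refine ⟨κ₂ - κ₁ + κ₃ / ((m : ℝ) - 2), fun u v => ?_⟩
  rw [h₁, h₂]
  simp only [symPart, h₃, g.symm x v u]
  field_simp
  ring

end Change

section CanonicalMobius

variable {m : ℕ} {M : Type*} [TopologicalSpace M] [ChartedSpace (EuclideanSpace ℝ (Fin m)) M]
  [IsManifold (𝓡 m) ∞ M] [T2Space M] {c : ConformalStructure m M}

theorem WeylStructure.exists_connChange (hm : m ≠ 0) (W W' : WeylStructure c) {g : Metric m M}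
    (hg : g ∈ c.metrics) : ∃ T, ConnChange W.cov.toFun W'.cov.toFun g
      (fun x v => lForm W'.cov.toFun g x v - lForm W.cov.toFun g x v) T :=
  ConfGeom.exists_connChange hm W.smoothConn W'.smoothConn (W.smoothForm_lForm hg)
    (W'.smoothForm_lForm hg) (W.compat hg) (W'.compat hg)

/-- The change of the trace-free Hessian: multiplication by the trace-free part of `sym ∇θ - θ ⊗ θ`,
where `θ` is the difference of the connection forms. -/
theorem hessZero_change (hm : m ≠ 0) (W W' : WeylStructure c) (l : LSection c) (g : c.metrics)
    (x : M) (X Y : TangentSpace (𝓡 m) x) :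
    hessZero W'.cov.toFun l g x X Y = hessZero W.cov.toFun l g x X Y +
      l.toFun g x * traceFree g.1 x (fun u v => symPart (nablaForm W.cov.toFun
        (fun x v => lForm W'.cov.toFun g x v - lForm W.cov.toFun g x v) x) u v -
        (lForm W'.cov.toFun g x u - lForm W.cov.toFun g x u) *
        (lForm W'.cov.toFun g x v - lForm W.cov.toFun g x v)) X Y := by
  obtain ⟨T, hc⟩ := W.exists_connChange hm W' g.2
  unfold hessZero
  rw [← traceFree_mul, ← traceFree_add]
  refine traceFree_congr_mod hm g.1
    (κ := lineDeriv (lForm W'.cov.toFun g) (l.toFun g) x (T x)) (fun u v => ?_) X Y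
  have h := hc.hessian_eq W.smoothConn W'.smoothConn (W.smoothForm_lForm g.2)
    (β' := lForm W'.cov.toFun g) (fun x v => by ring) (l.smooth g) x
  simp only [symPart, h, g.1.symm x v u]
  ring

/-- The canonical Möbius operator does not depend on the choice of the Weyl structure. -/
theorem canonicalMobius_eq (hm : 3 ≤ m) (W W' : WeylStructure c) (l : LSection c) (g : c.metrics)
    (x : M) (X Y : TangentSpace (𝓡 m) x) :
    canonicalMobius W'.cov.toFun l g x X Y = canonicalMobius W.cov.toFun l g x X Y := by
  have hm0 : m ≠ 0 := by lia
  obtain ⟨T, hc⟩ := W.exists_connChange hm0 W' g.2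
  obtain ⟨κ, hκ⟩ := hc.exists_schoutenSym_eq hm W.smoothConn W'.smoothConn (W.compat g.2) x
  unfold canonicalMobius
  rw [hessZero_change hm0 W W' l g, add_assoc, add_right_inj, mul_comm (l.toFun g x), ← add_mul,
    ← traceFree_add]
  congr 1
  refine (traceFree_congr_mod hm0 g.1 (κ := -κ) (fun u v => ?_) X Y).symm
  simp only [hκ]
  ring

end CanonicalMobius

/-! ### Vector fields along a submanifold -/

section Along

variable {m n : ℕ}
  {M : Type*} [TopologicalSpace M] [ChartedSpace (EuclideanSpace ℝ (Fin m)) M]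
  [IsManifold (𝓡 m) ∞ M]
  {N : Type*} [TopologicalSpace N] [ChartedSpace (EuclideanSpace ℝ (Fin n)) N]
  [IsManifold (𝓡 n) ∞ N] {ι : N → M}

/-- Smooth vector fields of `M` along `ι`, that is, smooth sections of `ι^* TM`. -/
abbrev SmoothAlong (ι : N → M) (V : Π y : N, TangentSpace (𝓡 m) (ι y)) : Prop :=
  ContMDiff (𝓡 n) ((𝓡 m).prod 𝓘(ℝ, EuclideanSpace ℝ (Fin m))) ∞
    (fun y => TotalSpace.mk' (EuclideanSpace ℝ (Fin m)) (E := fun p : M => TangentSpace (𝓡 m) p)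
      (ι y) (V y))

theorem SmoothField.along {V : Π p : M, TangentSpace (𝓡 m) p} (hV : SmoothField V)
    (hι : ContMDiff (𝓡 n) (𝓡 m) ∞ ι) : SmoothAlong (n := n) ι (fun y => V (ι y)) :=
  hV.comp hι

theorem SmoothField.dmap {X : Π y : N, TangentSpace (𝓡 n) y} (hX : SmoothField X)
    (hι : ContMDiff (𝓡 n) (𝓡 m) ∞ ι) :
    SmoothAlong (n := n) ι (fun y => dmap (m := m) ι y (X y)) := by
  have h : ContMDiff (𝓡 n).tangent (𝓡 m).tangent ∞ (tangentMap (𝓡 n) (𝓡 m) ι) :=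
    hι.contMDiff_tangentMap (by simp)
  exact h.comp hX

theorem mvfderiv_comp_dmap {F : Type*} [NormedAddCommGroup F] [NormedSpace ℝ F] {f : M → F} {x : N}
    (hι : MDifferentiableAt (𝓡 n) (𝓡 m) ι x)
    (hf : MDifferentiableAt (𝓡 m) 𝓘(ℝ, F) f (ι x)) (v : TangentSpace (𝓡 n) x) :
    mvfderiv (𝓡 n) (fun y => f (ι y)) x v = mvfderiv (𝓡 m) f (ι x) (ConfGeom.dmap ι x v) :=
  mfderiv_comp_apply x hf hι v

/-- The coordinates of a vector field along `ι` in the local trivialization of `TM` at `ι x`. -/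
noncomputable def alongCoord (ι : N → M) (V : Π y : N, TangentSpace (𝓡 m) (ι y)) (x y : N) :
    EuclideanSpace ℝ (Fin m) :=
  (trivializationAt (EuclideanSpace ℝ (Fin m)) (fun p : M => TangentSpace (𝓡 m) p) (ι x)
    ⟨ι y, V y⟩).2

theorem SmoothAlong.contMDiffAt_alongCoord {V : Π y : N, TangentSpace (𝓡 m) (ι y)}
    (hV : SmoothAlong (n := n) ι V) (x : N) :
    ContMDiffAt (𝓡 n) 𝓘(ℝ, EuclideanSpace ℝ (Fin m)) ∞ (alongCoord ι V x) x :=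
  (contMDiffAt_totalSpace.1 (hV x)).2

/-- Near `p` the local extension of a tangent vector has constant coordinates in the trivialization
of `TM` at `p`. -/
theorem eventually_extend (p : M) : ∀ᶠ q in 𝓝 p, ∀ v : TangentSpace (𝓡 m) p,
    FiberBundle.extend (EuclideanSpace ℝ (Fin m)) v q =
      (trivializationAt (EuclideanSpace ℝ (Fin m)) (fun p : M => TangentSpace (𝓡 m) p) p).symmL ℝ q
        ((trivializationAt (EuclideanSpace ℝ (Fin m)) (fun p : M => TangentSpace (𝓡 m) p) p)
          ⟨p, v⟩).2 := by
  set t := trivializationAt (EuclideanSpace ℝ (Fin m)) (fun p : M => TangentSpace (𝓡 m) p) p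
  have ht : t.baseSet ∈ 𝓝 p := t.open_baseSet.mem_nhds (FiberBundle.mem_baseSet_trivializationAt' p)
  filter_upwards [ht] with q hq v
  rw [t.symmL_apply (R := ℝ) hq]
  rfl

theorem triv_add {p q : M} (hq : q ∈ (trivializationAt (EuclideanSpace ℝ (Fin m))
    (fun p : M => TangentSpace (𝓡 m) p) p).baseSet) (v w : TangentSpace (𝓡 m) q) :
    (trivializationAt (EuclideanSpace ℝ (Fin m)) (fun p : M => TangentSpace (𝓡 m) p) p
      ⟨q, v + w⟩).2 = (trivializationAt (EuclideanSpace ℝ (Fin m))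
        (fun p : M => TangentSpace (𝓡 m) p) p ⟨q, v⟩).2 + (trivializationAt
          (EuclideanSpace ℝ (Fin m)) (fun p : M => TangentSpace (𝓡 m) p) p ⟨q, w⟩).2 :=
  ((trivializationAt (EuclideanSpace ℝ (Fin m)) (fun p : M => TangentSpace (𝓡 m) p) p).linear ℝ
    hq).map_add v w

theorem triv_smul {p q : M} (hq : q ∈ (trivializationAt (EuclideanSpace ℝ (Fin m))
    (fun p : M => TangentSpace (𝓡 m) p) p).baseSet) (a : ℝ) (v : TangentSpace (𝓡 m) q) :
    (trivializationAt (EuclideanSpace ℝ (Fin m)) (fun p : M => TangentSpace (𝓡 m) p) p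
      ⟨q, a • v⟩).2 = a • (trivializationAt (EuclideanSpace ℝ (Fin m))
        (fun p : M => TangentSpace (𝓡 m) p) p ⟨q, v⟩).2 :=
  ((trivializationAt (EuclideanSpace ℝ (Fin m)) (fun p : M => TangentSpace (𝓡 m) p) p).linear ℝ
    hq).map_smul a v

theorem baseSet_mem_nhds (p : M) : (trivializationAt (EuclideanSpace ℝ (Fin m))
    (fun p : M => TangentSpace (𝓡 m) p) p).baseSet ∈ 𝓝 p :=
  (trivializationAt (EuclideanSpace ℝ (Fin m)) (fun p : M => TangentSpace (𝓡 m) p)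
    p).open_baseSet.mem_nhds (FiberBundle.mem_baseSet_trivializationAt' p)

theorem triv_symmL {p : M} (v : TangentSpace (𝓡 m) p) :
    (trivializationAt (EuclideanSpace ℝ (Fin m)) (fun p : M => TangentSpace (𝓡 m) p) p).symmL ℝ p
      ((trivializationAt (EuclideanSpace ℝ (Fin m)) (fun p : M => TangentSpace (𝓡 m) p) p)
        ⟨p, v⟩).2 = v := by
  rw [← (eventually_extend p).self_of_nhds v]
  simp

theorem mvfderiv_alongCoord_add {V V' : Π y : N, TangentSpace (𝓡 m) (ι y)} {x : N}
    (hι : ContinuousAt ι x)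
    (hV : MDifferentiableAt (𝓡 n) 𝓘(ℝ, EuclideanSpace ℝ (Fin m)) (alongCoord ι V x) x)
    (hV' : MDifferentiableAt (𝓡 n) 𝓘(ℝ, EuclideanSpace ℝ (Fin m)) (alongCoord ι V' x) x)
    (v : TangentSpace (𝓡 n) x) :
    mvfderiv (𝓡 n) (alongCoord ι (fun y => V y + V' y) x) x v =
      mvfderiv (𝓡 n) (alongCoord ι V x) x v + mvfderiv (𝓡 n) (alongCoord ι V' x) x v := by
  have h : alongCoord ι (fun y => V y + V' y) x =ᶠ[𝓝 x] alongCoord ι V x + alongCoord ι V' x := by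
    filter_upwards [hι.eventually (baseSet_mem_nhds (m := m) (ι x))] with y hy
    exact triv_add hy _ _
  rw [mvfderiv_congr h, mvfderiv_add hV hV', add_apply]

theorem mvfderiv_alongCoord_smul {f : N → ℝ} {V : Π y : N, TangentSpace (𝓡 m) (ι y)} {x : N}
    (hι : ContinuousAt ι x) (hf : MDifferentiableAt (𝓡 n) 𝓘(ℝ, ℝ) f x)
    (hV : MDifferentiableAt (𝓡 n) 𝓘(ℝ, EuclideanSpace ℝ (Fin m)) (alongCoord ι V x) x)
    (v : TangentSpace (𝓡 n) x) :
    mvfderiv (𝓡 n) (alongCoord ι (fun y => f y • V y) x) x v =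
      f x • mvfderiv (𝓡 n) (alongCoord ι V x) x v + mvfderiv (𝓡 n) f x v • alongCoord ι V x x := by
  have h : alongCoord ι (fun y => f y • V y) x =ᶠ[𝓝 x] f • alongCoord ι V x := by
    filter_upwards [hι.eventually (baseSet_mem_nhds (m := m) (ι x))] with y hy
    exact triv_smul hy _ _
  rw [mvfderiv_congr h, mvfderiv_smul hf hV]
  simp

variable [T2Space M]

/-- Smooth functions on an embedded submanifold extend locally: compose with the local retraction
that the normal form of an immersion provides. -/
theorem exists_smoothFun_extension (hι : Manifold.IsSmoothEmbedding (𝓡 n) (𝓡 m) ∞ ι) {x : N}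
    {f : N → ℝ} {u : Set N} (hu : u ∈ 𝓝 x) (hf : ContMDiffOn (𝓡 n) 𝓘(ℝ, ℝ) ∞ f u) :
    ∃ F : M → ℝ, SmoothFun (m := m) F ∧ ∀ᶠ y in 𝓝 x, F (ι y) = f y := by
  have h := (hι.isImmersion.isImmersionAt x).isImmersionAtOfComplement_complement
  obtain ⟨v, hvu, hvo, hxv⟩ := mem_nhds_iff.1 hu
  set d := h.domChart
  set c := h.codChart
  set e := h.equiv
  have hx : x ∈ d.source := h.mem_domChart_source
  have hιx : ι x ∈ c.source := h.mem_codChart_source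
  have hwr : ∀ y ∈ d.source, (e.symm (c (ι y))).1 = d y := by
    intro y hy
    have h0 := h.writtenInCharts
    have h1 := @h0 (d y) (by simpa [d] using d.map_source hy)
    have h2 : c (ι y) = e (d y, 0) := by
      have h2 : c (ι (d.symm (d y))) = e (d y, 0) := by simpa using h1
      rwa [d.left_inv hy] at h2
    rw [h2]; simp
  -- in the charts `ι` is the inclusion of a linear subspace, and `r` the projection to it
  let r : M → N := fun p => d.symm (e.symm (c p)).1
  have hr : ∀ y ∈ d.source, r (ι y) = y := by
    intro y hy
    simp only [r, hwr y hy, d.left_inv hy]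
  have hq : ContMDiffOn (𝓡 m) 𝓘(ℝ, EuclideanSpace ℝ (Fin n)) ∞ (fun p => (e.symm (c p)).1)
      c.source := by
    have h2 : ContDiff ℝ ∞ (fun v => (e.symm v).1) := contDiff_fst.comp e.symm.contDiff
    exact h2.contMDiff.comp_contMDiffOn
      (contMDiffOn_of_mem_maximalAtlas h.codChart_mem_maximalAtlas)
  have hqc : ContinuousAt (fun p => (e.symm (c p)).1) (ι x) :=
    (hq.continuousOn).continuousAt (c.open_source.mem_nhds hιx)
  have hdx : (e.symm (c (ι x))).1 ∈ d.target := by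
    rw [hwr x hx]; exact d.map_source hx
  have hrc : ContinuousAt r (ι x) :=
    ContinuousAt.comp (f := fun p => (e.symm (c p)).1)
      (d.symm.continuousAt hdx) hqc
  have hw : {p | p ∈ c.source ∧ (e.symm (c p)).1 ∈ d.target ∧ r p ∈ v} ∈ 𝓝 (ι x) := by
    filter_upwards [c.open_source.mem_nhds hιx, hqc.eventually (d.open_target.mem_nhds hdx),
      hrc.eventually (hvo.mem_nhds (by rw [hr x hx]; exact hxv))] with p h1 h2 h3
    exact ⟨h1, h2, h3⟩
  have hfv : ContMDiffOn (𝓡 m) 𝓘(ℝ, ℝ) ∞ (f ∘ r)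
      {p | p ∈ c.source ∧ (e.symm (c p)).1 ∈ d.target ∧ r p ∈ v} := by
    refine (hf.mono hvu).comp (t := v) ?_ (fun p hp => hp.2.2)
    exact (contMDiffOn_symm_of_mem_maximalAtlas h.domChart_mem_maximalAtlas).comp
      (hq.mono fun p hp => hp.1) (fun p hp => hp.2.1)
  obtain ⟨F, hF, hFe⟩ := exists_smoothFun_eventuallyEq hw hfv
  refine ⟨F, hF, ?_⟩
  have hιc : ContinuousAt ι x := hι.contMDiff.continuous.continuousAt
  filter_upwards [hιc.eventually hFe, d.open_source.mem_nhds hx] with y hy hys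
  rw [hy, Function.comp_apply, hr y hys]

/-- Smooth vector fields along an embedded submanifold extend locally. -/
theorem exists_smoothField_extension (hι : Manifold.IsSmoothEmbedding (𝓡 n) (𝓡 m) ∞ ι)
    {V : Π y : N, TangentSpace (𝓡 m) (ι y)} (hV : SmoothAlong (n := n) ι V) (x : N) :
    ∃ X : Π p : M, TangentSpace (𝓡 m) p, SmoothField X ∧ ∀ᶠ y in 𝓝 x, X (ι y) = V y := by
  set t := trivializationAt (EuclideanSpace ℝ (Fin m)) (fun p : M => TangentSpace (𝓡 m) p) (ι x)
    with ht
  have hιc : ContinuousAt ι x := hι.contMDiff.continuous.continuousAt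
  have hb := hιc.eventually (baseSet_mem_nhds (m := m) (ι x))
  have hco : ContMDiffOn (𝓡 n) 𝓘(ℝ, EuclideanSpace ℝ (Fin m)) ∞ (alongCoord ι V x)
      (ι ⁻¹' t.baseSet) :=
    ((t.contMDiffOn_iff (fun y hy => t.mem_source.2 hy)).1 hV.contMDiffOn).2
  have h1 : ∀ i : Fin m, ∃ F : M → ℝ, SmoothFun (m := m) F ∧
      ∀ᶠ y in 𝓝 x, F (ι y) = alongCoord ι V x y i := fun i =>
    exists_smoothFun_extension hι hb
      ((EuclideanSpace.proj (𝕜 := ℝ) i).contDiff.contMDiff.comp_contMDiffOn hco)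
  have h2 : ∀ i : Fin m, ∃ X : Π p : M, TangentSpace (𝓡 m) p, SmoothField X ∧
      ∀ᶠ q in 𝓝 (ι x), X q = t.symmL ℝ q (EuclideanSpace.single i 1) := by
    intro i
    obtain ⟨X, hX, hXe, -⟩ := exists_smoothField_extend (m := m)
      (t.symmL ℝ (ι x) (EuclideanSpace.single i 1))
    refine ⟨X, hX, ?_⟩
    filter_upwards [hXe, eventually_extend (m := m) (ι x)] with q hq hq'
    rw [hq, hq']
    congr 1
    have hx : ι x ∈ t.baseSet := FiberBundle.mem_baseSet_trivializationAt' _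
    rw [t.symmL_apply (R := ℝ) hx, t.apply_mk_symm hx]
  choose F hF hFe using h1
  choose e he hee using h2
  refine ⟨fun q => ∑ i, F i q • e i q, SmoothField.sum fun i => (he i).smul (hF i), ?_⟩
  filter_upwards [hb, Filter.eventually_all.2 hFe,
    Filter.eventually_all.2 fun i => hιc.eventually (hee i)] with y hyb hyF hye
  simp only [hyF, hye, ← map_smul]
  rw [← map_sum]
  have h3 : ∑ i, alongCoord ι V x y i • EuclideanSpace.single i (1 : ℝ) = alongCoord ι V x y := by
    simpa using (EuclideanSpace.basisFun (Fin m) ℝ).sum_repr (alongCoord ι V x y)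
  rw [h3, t.symmL_apply (R := ℝ) hyb]
  exact t.symm_apply_apply_mk hyb (V y)

/-- A connection in the local trivialization of the tangent bundle at `p`: the derivative of the
coordinates plus a term that depends only on `V p`. -/
theorem SmoothConn.eq_symmL {D : Conn m M} (hD : SmoothConn D) {V : Π p : M, TangentSpace (𝓡 m) p}
    (hV : SmoothField V) (p : M) (w : TangentSpace (𝓡 m) p) :
    D V p w = (trivializationAt (EuclideanSpace ℝ (Fin m))
        (fun p : M => TangentSpace (𝓡 m) p) p).symmL ℝ p
        (mvfderiv (𝓡 m) (alongCoord (fun p : M => p) V p) p w)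
      + D (FiberBundle.extend (EuclideanSpace ℝ (Fin m)) (V p)) p w := by
  have hdiff : ∀ X : Π p : M, TangentSpace (𝓡 m) p, SmoothField X → MDifferentiableAt (𝓡 m)
      𝓘(ℝ, EuclideanSpace ℝ (Fin m)) (alongCoord (fun p : M => p) X p) p := fun X hX =>
    (SmoothAlong.contMDiffAt_alongCoord (ι := fun p : M => p) hX p).mdifferentiableAt (by simp)
  obtain ⟨E, hE, hEe, hEp⟩ := exists_smoothField_extend (V p)
  have h1 := eq_of_tensorial (Φ := fun V => D V p w - (trivializationAt (EuclideanSpace ℝ (Fin m))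
        (fun p : M => TangentSpace (𝓡 m) p) p).symmL ℝ p
        (mvfderiv (𝓡 m) (alongCoord (fun p : M => p) V p) p w)) (x := p)
    (fun X Y hX hY => ?_) (fun f X hf hX => ?_) hV hE hEp.symm
  · rw [sub_eq_iff_eq_add] at h1
    rw [h1, hD.congr E _ hE p hEe]
    have h2 : alongCoord (fun p : M => p) E p =ᶠ[𝓝 p] fun _ => alongCoord (fun p : M => p) V p p := by
      filter_upwards [hEe, baseSet_mem_nhds (m := m) p] with q hq hqb
      unfold alongCoord
      rw [hq]
      unfold FiberBundle.extend
      have h3 := Trivialization.apply_mk_symm _ hqb (trivializationAt (EuclideanSpace ℝ (Fin m))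
        (fun p : M => TangentSpace (𝓡 m) p) p ⟨p, V p⟩).2
      have h4 := congrArg Prod.snd h3
      exact h4
    rw [mvfderiv_congr h2, mvfderiv_const]
    simp; abel
  · rw [hD.add X Y hX hY, mvfderiv_alongCoord_add (ι := fun p : M => p) continuousAt_id (hdiff X hX) (hdiff Y hY),
      map_add, add_apply]
    abel
  · rw [hD.leibniz f X hf hX, mvfderiv_alongCoord_smul (ι := fun p : M => p) continuousAt_id (hf.mdiff p) (hdiff X hX),
      map_add, map_smul, map_smul]
    have := triv_symmL (X p)
    unfold alongCoord
    rw [this]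
    module

theorem alongDeriv_apply (ι : N → M) (D : Conn m M) (V : Π y : N, TangentSpace (𝓡 m) (ι y)) (x : N)
    (v : TangentSpace (𝓡 n) x) : alongDeriv ι D V x v =
      (trivializationAt (EuclideanSpace ℝ (Fin m))
        (fun p : M => TangentSpace (𝓡 m) p) (ι x)).symmL ℝ (ι x)
        (mvfderiv (𝓡 n) (alongCoord ι V x) x v)
      + D (FiberBundle.extend (EuclideanSpace ℝ (Fin m)) (V x)) (ι x) (dmap ι x v) := rfl

/-- The covariant derivative along `ι` of a vector field that extends to `M` is the derivative of
any extension. -/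
theorem alongDeriv_eq {D : Conn m M} (hD : SmoothConn D) (hι : ContMDiff (𝓡 n) (𝓡 m) ∞ ι)
    {V : Π y : N, TangentSpace (𝓡 m) (ι y)} {X : Π p : M, TangentSpace (𝓡 m) p}
    (hX : SmoothField X) {x : N} (h : ∀ᶠ y in 𝓝 x, X (ι y) = V y) (v : TangentSpace (𝓡 n) x) :
    alongDeriv ι D V x v = D X (ι x) (dmap ι x v) := by
  have h1 : alongCoord ι V x =ᶠ[𝓝 x] (alongCoord (fun p : M => p) X (ι x)) ∘ ι := by
    filter_upwards [h] with y hy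
    simp only [alongCoord, Function.comp_apply, hy]
  have hdiff : MDifferentiableAt (𝓡 m) 𝓘(ℝ, EuclideanSpace ℝ (Fin m))
      (alongCoord (fun p : M => p) X (ι x)) (ι x) :=
    (SmoothAlong.contMDiffAt_alongCoord (ι := fun p : M => p) hX (ι x)).mdifferentiableAt (by simp)
  have h2 := mvfderiv_comp_dmap ((hι x).mdifferentiableAt (by simp)) hdiff v
  rw [alongDeriv_apply, hD.eq_symmL hX, h.self_of_nhds, mvfderiv_congr h1]
  exact congrArg (fun z => (trivializationAt (EuclideanSpace ℝ (Fin m))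
        (fun p : M => TangentSpace (𝓡 m) p) (ι x)).symmL ℝ (ι x) z + _) h2

theorem extend_add_eventually {p : M} (v w : TangentSpace (𝓡 m) p) : ∀ᶠ q in 𝓝 p,
    FiberBundle.extend (EuclideanSpace ℝ (Fin m)) (v + w) q =
      FiberBundle.extend (EuclideanSpace ℝ (Fin m)) v q +
        FiberBundle.extend (EuclideanSpace ℝ (Fin m)) w q := by
  filter_upwards [eventually_extend (m := m) p] with q hq
  rw [hq, hq, hq, triv_add (FiberBundle.mem_baseSet_trivializationAt' p), map_add]

theorem extend_smul_eventually {p : M} (a : ℝ) (v : TangentSpace (𝓡 m) p) : ∀ᶠ q in 𝓝 p,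
    FiberBundle.extend (EuclideanSpace ℝ (Fin m)) (a • v) q =
      a • FiberBundle.extend (EuclideanSpace ℝ (Fin m)) v q := by
  filter_upwards [eventually_extend (m := m) p] with q hq
  rw [hq, hq, triv_smul (FiberBundle.mem_baseSet_trivializationAt' p), map_smul]

theorem SmoothConn.extend_add {D : Conn m M} (hD : SmoothConn D) {p : M}
    (v w : TangentSpace (𝓡 m) p) : D (FiberBundle.extend (EuclideanSpace ℝ (Fin m)) (v + w)) p =
      D (FiberBundle.extend (EuclideanSpace ℝ (Fin m)) v) p +
        D (FiberBundle.extend (EuclideanSpace ℝ (Fin m)) w) p := by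
  obtain ⟨X, hX, hXe, -⟩ := exists_smoothField_extend v
  obtain ⟨Y, hY, hYe, -⟩ := exists_smoothField_extend w
  rw [hD.congr X _ hX p hXe, hD.congr Y _ hY p hYe, ← hD.add X Y hX hY]
  refine hD.congr _ _ (hX.add hY) p ?_
  filter_upwards [hXe, hYe, extend_add_eventually v w] with q h1 h2 h3
  rw [h1, h2, h3]

theorem SmoothConn.extend_smul {D : Conn m M} (hD : SmoothConn D) {p : M} (a : ℝ)
    (v : TangentSpace (𝓡 m) p) : D (FiberBundle.extend (EuclideanSpace ℝ (Fin m)) (a • v)) p =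
      a • D (FiberBundle.extend (EuclideanSpace ℝ (Fin m)) v) p := by
  obtain ⟨X, hX, hXe, -⟩ := exists_smoothField_extend v
  have h1 : D (FiberBundle.extend (EuclideanSpace ℝ (Fin m)) (a • v)) p =
      D (fun q => a • X q) p := by
    refine hD.congr _ _ (SmoothField.smul contMDiff_const hX) p ?_
    filter_upwards [hXe, extend_smul_eventually a v] with q h1 h2
    rw [h1, h2]
  ext1 w
  rw [h1, hD.congr X _ hX p hXe, hD.leibniz (fun _ => a) X contMDiff_const hX, mvfderiv_const]
  simp

theorem alongDeriv_add {D : Conn m M} (hD : SmoothConn D) {V V' : Π y : N, TangentSpace (𝓡 m) (ι y)}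
    {x : N} (hι : ContinuousAt ι x)
    (hV : MDifferentiableAt (𝓡 n) 𝓘(ℝ, EuclideanSpace ℝ (Fin m)) (alongCoord ι V x) x)
    (hV' : MDifferentiableAt (𝓡 n) 𝓘(ℝ, EuclideanSpace ℝ (Fin m)) (alongCoord ι V' x) x) :
    alongDeriv ι D (fun y => V y + V' y) x =
      (alongDeriv ι D V x + alongDeriv ι D V' x : TangentSpace (𝓡 n) x →L[ℝ] _) := by
  ext1 v
  rw [add_apply, alongDeriv_apply, alongDeriv_apply, alongDeriv_apply, hD.extend_add,
    mvfderiv_alongCoord_add hι hV hV', map_add, add_apply]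
  abel

theorem alongDeriv_smul {D : Conn m M} (hD : SmoothConn D) {f : N → ℝ}
    {V : Π y : N, TangentSpace (𝓡 m) (ι y)} {x : N} (hι : ContinuousAt ι x)
    (hf : MDifferentiableAt (𝓡 n) 𝓘(ℝ, ℝ) f x)
    (hV : MDifferentiableAt (𝓡 n) 𝓘(ℝ, EuclideanSpace ℝ (Fin m)) (alongCoord ι V x) x)
    (v : TangentSpace (𝓡 n) x) :
    alongDeriv ι D (fun y => f y • V y) x v =
      f x • alongDeriv ι D V x v + mvfderiv (𝓡 n) f x v • V x := by
  rw [alongDeriv_apply, alongDeriv_apply, hD.extend_smul, mvfderiv_alongCoord_smul hι hf hV,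
    map_add, map_smul, map_smul, smul_apply]
  have := triv_symmL (V x)
  conv_lhs => unfold alongCoord
  rw [this]
  unfold alongCoord
  module

end Along

/-! ### The orthogonal projection to a submanifold -/

/-- The inverse Gram matrix provides the vector with prescribed products with a basis. -/
theorem IsInner.sum_inv_gram {V : Type*} [AddCommGroup V] [Module ℝ V] {G : V → V → ℝ}
    (hG : IsInner G) {κ : Type*} [Fintype κ] [DecidableEq κ] (b : Module.Basis κ ℝ V) (f : κ → ℝ)
    (k : κ) :
    G (∑ i, (∑ j, (Matrix.of fun i j => G (b i) (b j))⁻¹ i j * f j) • b i) (b k) = f k := by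
  set A := Matrix.of fun i j => G (b i) (b j) with hA
  have h1 : A * A⁻¹ = 1 := Matrix.mul_nonsing_inv A (isUnit_iff_ne_zero.2 (hG.det_ne_zero b))
  rw [IsBilinearMap.sum_left hG.bilin]
  simp only [hG.bilin.smul_left, smul_eq_mul, Finset.sum_mul]
  rw [Finset.sum_comm]
  have h2 : ∀ j, ∑ i, A⁻¹ i j * f j * G (b i) (b k) = (if k = j then 1 else 0) * f j := by
    intro j
    have := congrFun (congrFun h1 k) j
    rw [Matrix.mul_apply, Matrix.one_apply] at this
    rw [← this, Finset.sum_mul]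
    refine Finset.sum_congr rfl fun i _ => ?_
    rw [hG.symm, hA, Matrix.of_apply]
    ring
  simp [h2]

/-- A functional that agrees with `G w` on a basis is `G w`. -/
theorem IsInner.ext_basis {V : Type*} [AddCommGroup V] [Module ℝ V] {G : V → V → ℝ}
    (hG : IsInner G) {κ : Type*} [Fintype κ] (b : Module.Basis κ ℝ V) {L : V →ₗ[ℝ] ℝ} {w : V}
    (h : ∀ k, G w (b k) = L (b k)) (v : V) : G w v = L v := by
  rw [← b.sum_repr v, IsBilinearMap.sum_right hG.bilin, map_sum]
  simp [hG.bilin.smul_right, h]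

section Projection

variable {m n : ℕ}
  {M : Type*} [TopologicalSpace M] [ChartedSpace (EuclideanSpace ℝ (Fin m)) M]
  [IsManifold (𝓡 m) ∞ M]
  {N : Type*} [TopologicalSpace N] [ChartedSpace (EuclideanSpace ℝ (Fin n)) N]
  {ι : N → M} {g g' : Metric m M}

/-- The defining property of the orthogonal projection. -/
theorem pullInner_tanProj (hG : ∀ x : N, IsInner (pullInner (n := n) g ι x)) (x : N)
    (v : TangentSpace (𝓡 m) (ι x)) (w : TangentSpace (𝓡 n) x) :
    pullInner g ι x (tanProj g ι x v) w = g.inner (ι x) v (dmap ι x w) := by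
  have h : tanProj g ι x v = ∑ i, (∑ j, (Matrix.of fun i j =>
      pullInner (n := n) g ι x (stdBasis x i) (stdBasis x j))⁻¹ i j *
        g.inner (ι x) v (dmap ι x (stdBasis x j))) • stdBasis x i := by
    simp only [stdBasis_apply, tanProj, sum_apply, ContinuousLinearMap.smulRight_apply, smul_apply,
      smul_eq_mul]
    refine Finset.sum_congr rfl fun i _ => ?_
    congr 1
    refine Finset.sum_congr rfl fun j _ => ?_
    rw [g.symm (ι x) v]
    rfl
  have := (hG x).ext_basis (stdBasis x) (w := tanProj g ι x v)
    (L := ((g.inner (ι x) v).comp (dmap ι x) : TangentSpace (𝓡 n) x →L[ℝ] ℝ).toLinearMap)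
    (fun k => by rw [h, (hG x).sum_inv_gram]; rfl) w
  exact this

theorem tanProj_eq (hG : ∀ x : N, IsInner (pullInner (n := n) g ι x)) {x : N}
    {v : TangentSpace (𝓡 m) (ι x)} {u : TangentSpace (𝓡 n) x}
    (h : ∀ w, pullInner g ι x u w = g.inner (ι x) v (dmap ι x w)) : tanProj g ι x v = u :=
  (hG x).ext fun w => by rw [pullInner_tanProj hG, h]

theorem tanProj_dmap (hG : ∀ x : N, IsInner (pullInner (n := n) g ι x)) (x : N)
    (v : TangentSpace (𝓡 n) x) : tanProj g ι x (dmap ι x v) = v :=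
  tanProj_eq hG fun _ => rfl

theorem inner_norProj (hG : ∀ x : N, IsInner (pullInner (n := n) g ι x)) (x : N)
    (v : TangentSpace (𝓡 m) (ι x)) (w : TangentSpace (𝓡 n) x) :
    g.inner (ι x) (norProj (n := n) g ι x v) (dmap ι x w) = 0 := by
  have h := pullInner_tanProj hG x v w
  unfold norProj
  rw [map_sub, sub_apply, ← h]
  exact sub_self _

theorem dmap_tanProj_add_norProj (x : N) (v : TangentSpace (𝓡 m) (ι x)) :
    dmap ι x (tanProj (n := n) g ι x v) + norProj (n := n) g ι x v = v := by
  unfold norProj; abel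

theorem norProj_dmap (hG : ∀ x : N, IsInner (pullInner (n := n) g ι x)) (x : N)
    (v : TangentSpace (𝓡 n) x) : norProj (n := n) g ι x (dmap ι x v) = 0 := by
  rw [norProj, tanProj_dmap hG, sub_self]

theorem norProj_add (x : N) (v w : TangentSpace (𝓡 m) (ι x)) :
    norProj (n := n) g ι x (v + w) = norProj (n := n) g ι x v + norProj (n := n) g ι x w := by
  unfold norProj; rw [map_add, map_add]; abel

theorem norProj_smul (x : N) (a : ℝ) (v : TangentSpace (𝓡 m) (ι x)) :
    norProj (n := n) g ι x (a • v) = a • norProj (n := n) g ι x v := by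
  unfold norProj; rw [map_smul, map_smul, smul_sub]

theorem pullInner_rescale {ψ : M → ℝ} (h : IsRescaling g g' ψ) (x : N)
    (v w : TangentSpace (𝓡 n) x) :
    pullInner g' ι x v w = Real.exp (2 * ψ (ι x)) * pullInner g ι x v w := h _ _ _

theorem tanProj_rescale (hG : ∀ x : N, IsInner (pullInner (n := n) g ι x)) {ψ : M → ℝ}
    (h : IsRescaling g g' ψ) (x : N) : tanProj (n := n) g' ι x = tanProj g ι x := by
  have hG' : ∀ x : N, IsInner (pullInner (n := n) g' ι x) := fun x => by
    have := (hG x).smul (Real.exp_pos (2 * ψ (ι x)))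
    convert this using 3
    exact pullInner_rescale h _ _ _
  ext1 v
  refine tanProj_eq hG' fun w => ?_
  rw [pullInner_rescale h, pullInner_tanProj hG, h]

variable [IsManifold (𝓡 n) ∞ N]

theorem IsInducedConformal.isInner {c : ConformalStructure m M} {cN : ConformalStructure n N}
    (hc : IsInducedConformal ι c cN) (hg : g ∈ c.metrics) (x : N) :
    IsInner (pullInner (n := n) g ι x) := by
  obtain ⟨h, hh⟩ := cN.nonempty
  obtain ⟨φ, -, hφ⟩ := hc g hg h hh
  have := (isInner_metric h x).smul (Real.exp_pos (-(2 * φ x)))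
  convert this using 3 with v w
  rw [hφ, ← mul_assoc, ← Real.exp_add]
  simp

/-- The function `φ` in `h = e^{2φ} ι^* g` is `logFactor`. -/
theorem logFactor_eq (hn : n ≠ 0) {h : Metric n N} {x : N} (hG : IsInner (pullInner (n := n) g ι x))
    {a : ℝ} (ha : ∀ X Y : TangentSpace (𝓡 n) x,
      h.inner x X Y = Real.exp (2 * a) * pullInner g ι x X Y) : logFactor g ι h x = a := by
  have hn' : (n : ℝ) ≠ 0 := Nat.cast_ne_zero.2 hn
  have h1 : trG (m := n) x (pullInner g ι x) (fun v w => h.inner x v w) =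
      Real.exp (2 * a) * n := by
    simp only [ha]
    have := trG_smul (G := pullInner (n := n) g ι x) (Real.exp (2 * a)) (pullInner g ι x)
    simp only [smul_eq_mul] at this
    rw [this, trG_self hG]
  rw [logFactor, h1]
  have : (1 / (n : ℝ)) * (Real.exp (2 * a) * n) = Real.exp (2 * a) := by field_simp
  rw [this, Real.log_exp]
  ring

theorem IsInducedConformal.logFactor_spec {c : ConformalStructure m M}
    {cN : ConformalStructure n N} (hn : n ≠ 0)
    (hc : IsInducedConformal ι c cN) (hg : g ∈ c.metrics) {h : Metric n N} (hh : h ∈ cN.metrics) :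
    SmoothFun (m := n) (logFactor g ι h) ∧ ∀ x (X Y : TangentSpace (𝓡 n) x),
      h.inner x X Y = Real.exp (2 * logFactor g ι h x) * pullInner g ι x X Y := by
  obtain ⟨φ, hφs, hφ⟩ := hc g hg h hh
  have : logFactor g ι h = φ := funext fun x => logFactor_eq hn (hc.isInner hg x) (hφ x)
  rw [this]
  exact ⟨hφs, hφ⟩

variable [T2Space M]

theorem smoothFun_inner_along (hι : Manifold.IsSmoothEmbedding (𝓡 n) (𝓡 m) ∞ ι) (g : Metric m M)
    {V W : Π y : N, TangentSpace (𝓡 m) (ι y)} (hV : SmoothAlong (n := n) ι V)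
    (hW : SmoothAlong (n := n) ι W) : SmoothFun (m := n) fun y => g.inner (ι y) (V y) (W y) := by
  intro x
  obtain ⟨X, hX, hXe⟩ := exists_smoothField_extension hι hV x
  obtain ⟨Y, hY, hYe⟩ := exists_smoothField_extension hι hW x
  have h1 : SmoothFun (m := n) fun y => g.inner (ι y) (X (ι y)) (Y (ι y)) :=
    ContMDiff.comp (smoothFun_inner g hX hY) hι.contMDiff
  refine (h1 x).congr_of_eventuallyEq ?_
  filter_upwards [hXe, hYe] with y h2 h3
  rw [h2, h3]

theorem SmoothAlong.tanProj (hι : Manifold.IsSmoothEmbedding (𝓡 n) (𝓡 m) ∞ ι)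
    (hG : ∀ x : N, IsInner (pullInner (n := n) g ι x)) {V : Π y : N, TangentSpace (𝓡 m) (ι y)}
    (hV : SmoothAlong (n := n) ι V) :
    SmoothField (m := n) fun y => tanProj g ι y (V y) := by
  have : T2Space N := hι.isEmbedding.t2Space
  intro x
  obtain ⟨e, he, heb, -⟩ := exists_frame (m := n) x
  have hes : ∀ i, SmoothAlong (n := n) ι fun y => dmap (m := m) ι y (e i y) := fun i =>
    (he i).dmap hι.contMDiff
  let A : N → Matrix (Fin n) (Fin n) ℝ := fun y =>
    Matrix.of fun i j => pullInner g ι y (e i y) (e j y)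
  have hA : ∀ i j, ContMDiffAt (𝓡 n) 𝓘(ℝ, ℝ) ∞ (fun y => A y i j) x := fun i j =>
    smoothFun_inner_along hι g (hes i) (hes j) x
  have hdet : (A x).det ≠ 0 := by
    obtain ⟨b, hb⟩ := heb.self_of_nhds
    simpa [hb, A] using (hG x).det_ne_zero b
  have h1 : ContMDiffAt (𝓡 n) ((𝓡 n).prod 𝓘(ℝ, EuclideanSpace ℝ (Fin n))) ∞
      (fun y => TotalSpace.mk' (EuclideanSpace ℝ (Fin n)) (E := fun x : N => TangentSpace (𝓡 n) x)
        y (∑ i, (∑ j, (A y)⁻¹ i j * g.inner (ι y) (V y) (dmap (m := m) ι y (e j y))) • e i y)) x := by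
    refine ContMDiffAt.sum_section fun i _ => ContMDiffAt.smul_section ?_ (he i x)
    exact contMDiffAt_finsetSum fun j _ =>
      (contMDiffAt_matrix_inv hA hdet i j).mul (smoothFun_inner_along hι g hV (hes j) x)
  refine h1.congr_of_eventuallyEq ?_
  filter_upwards [heb] with y hy
  obtain ⟨b, hb⟩ := hy
  congr 1
  refine tanProj_eq hG fun w => ?_
  refine (hG y).ext_basis b
    (L := ((g.inner (ι y) (V y)).comp (dmap ι y) : TangentSpace (𝓡 n) y →L[ℝ] ℝ).toLinearMap)
    (fun k => ?_) w
  have := (hG y).sum_inv_gram b (fun j => g.inner (ι y) (V y) (dmap (m := m) ι y (b j))) k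
  simp only [hb] at this ⊢
  exact this

end Projection

/-! ### Brackets of related vector fields -/

section Related

variable {m n : ℕ}
  {M : Type*} [TopologicalSpace M] [ChartedSpace (EuclideanSpace ℝ (Fin m)) M]
  [IsManifold (𝓡 m) ∞ M] [T2Space M]
  {N : Type*} [TopologicalSpace N] [ChartedSpace (EuclideanSpace ℝ (Fin n)) N]
  [IsManifold (𝓡 n) ∞ N] {ι : N → M}

/-- Tangent vectors are determined by the derivatives of smooth functions. -/
theorem eq_of_mvfderiv_eq {p : M} {v w : TangentSpace (𝓡 m) p}
    (h : ∀ f : M → ℝ, SmoothFun (m := m) f → mvfderiv (𝓡 m) f p v = mvfderiv (𝓡 m) f p w) :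
    v = w := by
  have hc : ContMDiffOn (𝓡 m) 𝓘(ℝ, EuclideanSpace ℝ (Fin m)) ∞ (extChartAt (𝓡 m) p)
      (chartAt (EuclideanSpace ℝ (Fin m)) p).source := contMDiffOn_extChartAt
  have hd : MDifferentiableAt (𝓡 m) 𝓘(ℝ, EuclideanSpace ℝ (Fin m)) (extChartAt (𝓡 m) p) p :=
    mdifferentiableAt_extChartAt (mem_chart_source _ p)
  have h1 : ∀ i, coordAt p i v = coordAt p i w := by
    intro i
    obtain ⟨f, hf, hfe⟩ := exists_smoothFun_eventuallyEq (m := m) (x := p)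
      ((chartAt (EuclideanSpace ℝ (Fin m)) p).open_source.mem_nhds (mem_chart_source _ p))
      ((EuclideanSpace.proj (𝕜 := ℝ) i).contDiff.contMDiff.comp_contMDiffOn hc)
    have h2 : ∀ u : TangentSpace (𝓡 m) p, mvfderiv (𝓡 m) f p u = coordAt p i u := by
      intro u
      rw [mvfderiv_congr hfe]
      have h3 := mfderiv_comp_apply (I' := 𝓘(ℝ, EuclideanSpace ℝ (Fin m))) (I'' := 𝓘(ℝ, ℝ)) p
        (EuclideanSpace.proj (𝕜 := ℝ) i : EuclideanSpace ℝ (Fin m) →L[ℝ] ℝ).differentiableAt.mdifferentiableAt hd u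
      rw [mfderiv_eq_fderiv, ContinuousLinearMap.fderiv, mfderiv_extChartAt_self] at h3
      exact h3
    rw [← h2, ← h2, h f hf]
  rw [← sum_coordAt v, ← sum_coordAt w]
  simp only [h1]

/-- If `X` and `Y` are related to vector fields on `N`, then so are their brackets. -/
theorem mlieBracket_related [T2Space N] (hι : ContMDiff (𝓡 n) (𝓡 m) ∞ ι)
    {X Y : Π y : N, TangentSpace (𝓡 n) y}
    (hX : SmoothField X) (hY : SmoothField Y) {X' Y' : Π p : M, TangentSpace (𝓡 m) p}
    (hX' : SmoothField X') (hY' : SmoothField Y') {x : N}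
    (hXX : ∀ᶠ y in 𝓝 x, X' (ι y) = dmap ι y (X y)) (hYY : ∀ᶠ y in 𝓝 x, Y' (ι y) = dmap ι y (Y y)) :
    VectorField.mlieBracket (𝓡 m) X' Y' (ι x) =
      dmap ι x (VectorField.mlieBracket (𝓡 n) X Y x) := by
  have hd : ∀ y, MDifferentiableAt (𝓡 n) (𝓡 m) ι y := fun y => (hι y).mdifferentiableAt (by simp)
  refine eq_of_mvfderiv_eq fun f hf => ?_
  have hfι : SmoothFun (m := n) fun y => f (ι y) := hf.comp hι
  have key : ∀ {Z : Π y : N, TangentSpace (𝓡 n) y} {Z' : Π p : M, TangentSpace (𝓡 m) p},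
      SmoothField Z' → (∀ᶠ y in 𝓝 x, Z' (ι y) = dmap ι y (Z y)) → ∀ v : TangentSpace (𝓡 n) x,
      mvfderiv (𝓡 m) (fun p => mvfderiv (𝓡 m) f p (Z' p)) (ι x) (dmap ι x v) =
        mvfderiv (𝓡 n) (fun y => mvfderiv (𝓡 n) (fun y => f (ι y)) y (Z y)) x v := by
    intro Z Z' hZ' hZZ v
    rw [← mvfderiv_comp_dmap (f := fun p => mvfderiv (𝓡 m) f p (Z' p)) (hd x)
      ((hZ'.mvfderiv hf).mdiff _)]
    suffices h1 : (fun y => mvfderiv (𝓡 m) f (ι y) (Z' (ι y))) =ᶠ[𝓝 x]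
        fun y => mvfderiv (𝓡 n) (fun y => f (ι y)) y (Z y) from
      congrArg (fun L => L v) (mvfderiv_congr h1)
    filter_upwards [hZZ] with y hy
    rw [hy, mvfderiv_comp_dmap (f := f) (hd y) (hf.mdiff _)]
  rw [mvfderiv_mlieBracket hf hX' hY', ← mvfderiv_comp_dmap (f := f) (hd x) (hf.mdiff _),
    mvfderiv_mlieBracket hfι hX hY, hXX.self_of_nhds, hYY.self_of_nhds, key hX' hXX, key hY' hYY]

theorem alongDeriv_smoothAlong {D : Conn m M} (hD : SmoothConn D)
    (hι : Manifold.IsSmoothEmbedding (𝓡 n) (𝓡 m) ∞ ι) {V : Π y : N, TangentSpace (𝓡 m) (ι y)}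
    (hV : SmoothAlong (n := n) ι V) {X : Π y : N, TangentSpace (𝓡 n) y} (hX : SmoothField X) :
    SmoothAlong (n := n) ι fun y => alongDeriv ι D V y (X y) := by
  intro x
  obtain ⟨V', hV', hVV⟩ := exists_smoothField_extension hι hV x
  obtain ⟨X', hX', hXX⟩ := exists_smoothField_extension hι (hX.dmap hι.contMDiff) x
  refine ((hD.smooth X' V' hX' hV').along hι.contMDiff x).congr_of_eventuallyEq ?_
  filter_upwards [hVV.eventually_nhds, hXX] with y h1 h2
  rw [alongDeriv_eq hD hι.contMDiff hV' h1, h2]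

/-- The derivative along `ι` of a torsion-free connection is torsion-free. -/
theorem alongDeriv_sub_swap [T2Space N] {D : Conn m M} (hD : SmoothConn D)
    (hι : Manifold.IsSmoothEmbedding (𝓡 n) (𝓡 m) ∞ ι)
    {X Y : Π y : N, TangentSpace (𝓡 n) y} (hX : SmoothField X) (hY : SmoothField Y) (x : N) :
    alongDeriv ι D (fun y => dmap ι y (Y y)) x (X x) - alongDeriv ι D (fun y => dmap ι y (X y)) x (Y x)
      = dmap ι x (VectorField.mlieBracket (𝓡 n) X Y x) := by
  obtain ⟨X', hX', hXX⟩ := exists_smoothField_extension hι (hX.dmap hι.contMDiff) x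
  obtain ⟨Y', hY', hYY⟩ := exists_smoothField_extension hι (hY.dmap hι.contMDiff) x
  rw [alongDeriv_eq hD hι.contMDiff hX' hXX, alongDeriv_eq hD hι.contMDiff hY' hYY,
    ← mlieBracket_related hι.contMDiff hX hY hX' hY' hXX hYY, hD.torsion X' Y' hX' hY',
    hXX.self_of_nhds, hYY.self_of_nhds]

end Related

/-! ### The induced connection and the fundamental form -/

section Induced

variable {m n : ℕ}
  {M : Type*} [TopologicalSpace M] [ChartedSpace (EuclideanSpace ℝ (Fin m)) M]
  [IsManifold (𝓡 m) ∞ M] [T2Space M]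
  {N : Type*} [TopologicalSpace N] [ChartedSpace (EuclideanSpace ℝ (Fin n)) N]
  [IsManifold (𝓡 n) ∞ N] {ι : N → M} {g : Metric m M} {D : Conn m M}

theorem alongDeriv_congr {V V' : Π y : N, TangentSpace (𝓡 m) (ι y)} {x : N}
    (h : ∀ᶠ y in 𝓝 x, V y = V' y) : alongDeriv (n := n) ι D V x = alongDeriv ι D V' x := by
  have h1 : alongCoord ι V x =ᶠ[𝓝 x] alongCoord ι V' x := by
    filter_upwards [h] with y hy
    rw [alongCoord, alongCoord, hy]
  ext1 v
  rw [alongDeriv_apply, alongDeriv_apply, mvfderiv_congr h1, h.self_of_nhds]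

theorem mdifferentiableAt_alongCoord_dmap (hι : ContMDiff (𝓡 n) (𝓡 m) ∞ ι)
    {Y : Π y : N, TangentSpace (𝓡 n) y} {x : N}
    (hY : MDifferentiableAt (𝓡 n) ((𝓡 n).prod 𝓘(ℝ, EuclideanSpace ℝ (Fin n)))
      (fun x => TotalSpace.mk' (EuclideanSpace ℝ (Fin n)) (E := fun x : N => TangentSpace (𝓡 n) x)
        x (Y x)) x) :
    MDifferentiableAt (𝓡 n) 𝓘(ℝ, EuclideanSpace ℝ (Fin m))
      (alongCoord ι (fun y => dmap (m := m) ι y (Y y)) x) x := by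
  have h : ContMDiff (𝓡 n).tangent (𝓡 m).tangent ∞ (tangentMap (𝓡 n) (𝓡 m) ι) :=
    hι.contMDiff_tangentMap (by simp)
  have h1 := ((h _).mdifferentiableAt (by simp)).comp x hY
  exact ((mdifferentiableAt_totalSpace _ _).1 h1).2

/-- The induced connection, as a covariant derivative. -/
noncomputable def inducedCov (hD : SmoothConn D) (hι : ContMDiff (𝓡 n) (𝓡 m) ∞ ι)
    (hG : ∀ x : N, IsInner (pullInner (n := n) g ι x)) :
    CovariantDerivative (𝓡 n) (EuclideanSpace ℝ (Fin n)) (fun x : N => TangentSpace (𝓡 n) x) where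
  toFun := inducedConn g ι D
  isCovariantDerivativeOnUniv :=
    { add := by
        intro σ σ' x hσ hσ' _
        have h1 := alongDeriv_add hD hι.continuous.continuousAt
          (mdifferentiableAt_alongCoord_dmap hι hσ) (mdifferentiableAt_alongCoord_dmap hι hσ')
        have h2 : (fun y => dmap (m := m) ι y ((σ + σ') y)) =
            fun y => dmap ι y (σ y) + dmap ι y (σ' y) := funext fun y => map_add _ _ _
        unfold inducedConn
        rw [h2, h1, ContinuousLinearMap.comp_add]
      leibniz := by
        intro σ f x hσ hf _
        have h2 : (fun y => dmap (m := m) ι y ((f • σ) y)) =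
            fun y => f y • dmap ι y (σ y) := funext fun y => (dmap ι y).map_smul (f y) (σ y)
        ext1 v
        have h1 := alongDeriv_smul hD hι.continuous.continuousAt hf
          (mdifferentiableAt_alongCoord_dmap hι hσ) v
        unfold inducedConn
        rw [h2, ContinuousLinearMap.comp_apply, h1, map_add, map_smul, map_smul, tanProj_dmap hG]
        simp }

theorem inducedConn_apply (Y : Π y : N, TangentSpace (𝓡 n) y) (x : N) (v : TangentSpace (𝓡 n) x) :
    inducedConn g ι D Y x v = tanProj g ι x (alongDeriv ι D (fun y => dmap ι y (Y y)) x v) := rfl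

theorem smooth_inducedConn (hD : SmoothConn D) (hι : Manifold.IsSmoothEmbedding (𝓡 n) (𝓡 m) ∞ ι)
    (hG : ∀ x : N, IsInner (pullInner (n := n) g ι x)) {X Y : Π y : N, TangentSpace (𝓡 n) y}
    (hX : SmoothField X) (hY : SmoothField Y) :
    SmoothField fun y => inducedConn g ι D Y y (X y) :=
  (alongDeriv_smoothAlong hD hι (hY.dmap hι.contMDiff) hX).tanProj hι hG

theorem contMDiff_inducedCov (hD : SmoothConn D) (hι : Manifold.IsSmoothEmbedding (𝓡 n) (𝓡 m) ∞ ι)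
    (hG : ∀ x : N, IsInner (pullInner (n := n) g ι x)) :
    (inducedCov hD hι.contMDiff hG).ContMDiffCovariantDerivative ∞ := by
  have : T2Space N := hι.isEmbedding.t2Space
  refine ⟨⟨fun {σ} hσ => ?_⟩⟩
  have h1 : SmoothField σ := by
    rw [contMDiffOn_univ] at hσ
    exact hσ.of_le (by simp)
  rw [contMDiffOn_univ]
  exact contMDiff_hom_of_apply (V := fun x : N => TangentSpace (𝓡 n) x) _ fun X hX =>
    smooth_inducedConn hD hι hG hX h1

theorem inducedCov_torsion (hD : SmoothConn D) (hι : Manifold.IsSmoothEmbedding (𝓡 n) (𝓡 m) ∞ ι)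
    (hG : ∀ x : N, IsInner (pullInner (n := n) g ι x)) :
    (inducedCov hD hι.contMDiff hG).torsion = 0 := by
  have : T2Space N := hι.isEmbedding.t2Space
  ext x v w : 3
  obtain ⟨X, hX, -, rfl⟩ := exists_smoothField_extend v
  obtain ⟨Y, hY, -, rfl⟩ := exists_smoothField_extend w
  rw [CovariantDerivative.torsion_apply _ (hX.mdiff x) (hY.mdiff x)]
  have h1 := congrArg (tanProj (n := n) g ι x) (alongDeriv_sub_swap hD hι hX hY x)
  rw [map_sub, tanProj_dmap hG] at h1
  exact sub_eq_zero.2 h1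

theorem smoothConn_inducedConn (hD : SmoothConn D) (hι : Manifold.IsSmoothEmbedding (𝓡 n) (𝓡 m) ∞ ι)
    (hG : ∀ x : N, IsInner (pullInner (n := n) g ι x)) : SmoothConn (inducedConn (n := n) g ι D) :=
  smoothConn_of_torsion_eq_zero (contMDiff_inducedCov hD hι hG) (inducedCov_torsion hD hι hG)

/-! ### The fundamental form -/

/-- The fundamental form is tensorial in its second entry, since the derivatives of the coefficients
are multiplied with tangent vectors, which have no normal component. -/
theorem isLinearMap_and_fundForm_apply (hD : SmoothConn D)
    (hι : Manifold.IsSmoothEmbedding (𝓡 n) (𝓡 m) ∞ ι)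
    (hG : ∀ x : N, IsInner (pullInner (n := n) g ι x)) (x : N) (v : TangentSpace (𝓡 n) x) :
    IsLinearMap ℝ (fundForm g ι D x v) ∧ ∀ Y, SmoothField Y → fundForm g ι D x v (Y x) =
      norProj (n := n) g ι x (alongDeriv ι D (fun y => dmap ι y (Y y)) x v) := by
  have : T2Space N := hι.isEmbedding.t2Space
  have hadd : ∀ X Y : Π y : N, TangentSpace (𝓡 n) y, SmoothField X → SmoothField Y →
      norProj (n := n) g ι x (alongDeriv ι D (fun y => dmap ι y (X y + Y y)) x v) =
      norProj (n := n) g ι x (alongDeriv ι D (fun y => dmap ι y (X y)) x v) +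
        norProj (n := n) g ι x (alongDeriv ι D (fun y => dmap ι y (Y y)) x v) := by
    intro X Y hX hY
    have h1 := alongDeriv_add hD hι.contMDiff.continuous.continuousAt
      (mdifferentiableAt_alongCoord_dmap hι.contMDiff (hX.mdiff x))
      (mdifferentiableAt_alongCoord_dmap hι.contMDiff (hY.mdiff x))
    simp only [map_add]
    rw [h1, add_apply, norProj_add]
  have hsmul : ∀ (f : N → ℝ) (X : Π y : N, TangentSpace (𝓡 n) y), SmoothFun (m := n) f →
      SmoothField X →
      norProj (n := n) g ι x (alongDeriv ι D (fun y => dmap ι y (f y • X y)) x v) =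
      f x • norProj (n := n) g ι x (alongDeriv ι D (fun y => dmap ι y (X y)) x v) := by
    intro f X hf hX
    have h1 := alongDeriv_smul hD hι.contMDiff.continuous.continuousAt (hf.mdiff x)
      (mdifferentiableAt_alongCoord_dmap hι.contMDiff (hX.mdiff x)) v
    simp only [map_smul]
    rw [h1, norProj_add, norProj_smul, norProj_smul, norProj_dmap hG, smul_zero, add_zero]
  have happ : ∀ Y, SmoothField Y → fundForm g ι D x v (Y x) =
      norProj (n := n) g ι x (alongDeriv ι D (fun y => dmap ι y (Y y)) x v) := by
    intro Y hY
    obtain ⟨Z, hZ, hZe, hZx⟩ := exists_smoothField_extend (Y x)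
    have h1 : fundForm g ι D x v (Y x) =
        norProj (n := n) g ι x (alongDeriv ι D (fun y => dmap ι y (Z y)) x v) := by
      unfold fundForm
      rw [alongDeriv_congr (V := fun y => dmap ι y (Z y))
        (V' := fun y => dmap ι y (FiberBundle.extend (EuclideanSpace ℝ (Fin n)) (Y x) y))]
      filter_upwards [hZe] with y hy
      rw [hy]
    rw [h1]
    exact eq_of_tensorial (Φ := fun Y => norProj (n := n) g ι x
      (alongDeriv ι D (fun y => dmap ι y (Y y)) x v)) hadd hsmul hZ hY hZx
  exact ⟨isLinearMap_of_tensorial (Φ := fun Y => norProj (n := n) g ι x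
      (alongDeriv ι D (fun y => dmap ι y (Y y)) x v)) hadd hsmul happ, happ⟩

/-- The Gauss formula `∇_v Y = ∇^N_v Y + B(v, Y)`. -/
theorem gauss_formula (hD : SmoothConn D) (hι : Manifold.IsSmoothEmbedding (𝓡 n) (𝓡 m) ∞ ι)
    (hG : ∀ x : N, IsInner (pullInner (n := n) g ι x)) {Y : Π y : N, TangentSpace (𝓡 n) y}
    (hY : SmoothField Y) (x : N) (v : TangentSpace (𝓡 n) x) :
    alongDeriv ι D (fun y => dmap ι y (Y y)) x v =
      dmap ι x (inducedConn g ι D Y x v) + fundForm g ι D x v (Y x) := by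
  rw [(isLinearMap_and_fundForm_apply hD hι hG x v).2 Y hY, inducedConn_apply,
    dmap_tanProj_add_norProj]

/-- The fundamental form is symmetric, as the bracket of tangent fields is tangent. -/
theorem fundForm_symm (hD : SmoothConn D) (hι : Manifold.IsSmoothEmbedding (𝓡 n) (𝓡 m) ∞ ι)
    (hG : ∀ x : N, IsInner (pullInner (n := n) g ι x)) (x : N) (v w : TangentSpace (𝓡 n) x) :
    fundForm g ι D x v w = fundForm g ι D x w v := by
  have : T2Space N := hι.isEmbedding.t2Space
  obtain ⟨X, hX, -, rfl⟩ := exists_smoothField_extend v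
  obtain ⟨Y, hY, -, rfl⟩ := exists_smoothField_extend w
  rw [(isLinearMap_and_fundForm_apply hD hι hG x (X x)).2 Y hY,
    (isLinearMap_and_fundForm_apply hD hι hG x (Y x)).2 X hX]
  rw [sub_eq_iff_eq_add.1 (alongDeriv_sub_swap hD hι hX hY x), norProj_add, norProj_dmap hG, zero_add]

theorem isBilinearMap_fundForm (hD : SmoothConn D) (hι : Manifold.IsSmoothEmbedding (𝓡 n) (𝓡 m) ∞ ι)
    (hG : ∀ x : N, IsInner (pullInner (n := n) g ι x)) (x : N) :
    IsBilinearMap ℝ (fundForm (n := n) g ι D x) := by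
  have h := fun v => (isLinearMap_and_fundForm_apply hD hι hG x v).1
  exact ⟨fun v v' w => by
      rw [fundForm_symm hD hι hG, (h w).map_add, fundForm_symm hD hι hG x w v,
        fundForm_symm hD hι hG x w v'],
    fun a v w => by
      rw [fundForm_symm hD hι hG, (h w).map_smul, fundForm_symm hD hι hG x w v],
    fun v w w' => (h v).map_add w w', fun a v w => (h v).map_smul a w⟩

theorem smoothAlong_fundForm (hD : SmoothConn D) (hι : Manifold.IsSmoothEmbedding (𝓡 n) (𝓡 m) ∞ ι)
    (hG : ∀ x : N, IsInner (pullInner (n := n) g ι x)) {X Y : Π y : N, TangentSpace (𝓡 n) y}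
    (hX : SmoothField X) (hY : SmoothField Y) :
    SmoothAlong (n := n) ι fun y => fundForm g ι D y (X y) (Y y) := by
  have h1 := alongDeriv_smoothAlong hD hι (hY.dmap hι.contMDiff) hX
  have h2 := (smooth_inducedConn hD hι hG hX hY).dmap hι.contMDiff
  intro x
  obtain ⟨V, hV, hVe⟩ := exists_smoothField_extension hι h1 x
  obtain ⟨W, hW, hWe⟩ := exists_smoothField_extension hι h2 x
  refine ((hV.sub hW).along hι.contMDiff x).congr_of_eventuallyEq ?_
  filter_upwards [hVe, hWe] with y h3 h4
  rw [h3, h4, gauss_formula hD hι hG hY, add_sub_cancel_left]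

theorem inner_fundForm_dmap (hG : ∀ x : N, IsInner (pullInner (n := n) g ι x)) (x : N)
    (u v w : TangentSpace (𝓡 n) x) : g.inner (ι x) (fundForm g ι D x u v) (dmap ι x w) = 0 :=
  inner_norProj hG x _ w

/-! ### Forms and Hessians on a submanifold -/

theorem SmoothForm.pullback (hι : Manifold.IsSmoothEmbedding (𝓡 n) (𝓡 m) ∞ ι)
    {α : Π p : M, TangentSpace (𝓡 m) p → ℝ} (hα : SmoothForm α) :
    SmoothForm fun (x : N) (v : TangentSpace (𝓡 n) x) => α (ι x) (dmap ι x v) where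
  lin x := ⟨fun v w => by rw [map_add, (hα.lin _).map_add],
    fun a v => by rw [map_smul, (hα.lin _).map_smul]⟩
  smooth X hX := by
    intro x
    obtain ⟨X', hX', hXX⟩ := exists_smoothField_extension hι (hX.dmap hι.contMDiff) x
    have h1 : SmoothFun (m := n) fun y => α (ι y) (X' (ι y)) :=
      ContMDiff.comp (hα.smooth X' hX') hι.contMDiff
    refine (h1 x).congr_of_eventuallyEq ?_
    filter_upwards [hXX] with y hy
    rw [hy]

/-- The derivative of the restriction of a one-form. By the Gauss formula, `(∇^N α|_N)(v, w) =
(∇α)(v, w) + α(B(v, w))`. -/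
theorem nablaForm_pullback (hD : SmoothConn D) (hι : Manifold.IsSmoothEmbedding (𝓡 n) (𝓡 m) ∞ ι)
    (hG : ∀ x : N, IsInner (pullInner (n := n) g ι x)) {α : Π p : M, TangentSpace (𝓡 m) p → ℝ}
    (hα : SmoothForm α) (x : N) (v w : TangentSpace (𝓡 n) x) :
    nablaForm (inducedConn g ι D) (fun x v => α (ι x) (dmap ι x v)) x v w =
      nablaForm D α (ι x) (dmap ι x v) (dmap ι x w) + α (ι x) (fundForm g ι D x v w) := by
  have : T2Space N := hι.isEmbedding.t2Space
  obtain ⟨Y, hY, -, rfl⟩ := exists_smoothField_extend w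
  obtain ⟨Y', hY', hYY⟩ := exists_smoothField_extension hι (hY.dmap hι.contMDiff) x
  have hιd : MDifferentiableAt (𝓡 n) (𝓡 m) ι x := (hι.contMDiff x).mdifferentiableAt (by simp)
  have h1 : (fun y => α (ι y) (dmap ι y (Y y))) =ᶠ[𝓝 x] fun y => α (ι y) (Y' (ι y)) := by
    filter_upwards [hYY] with y hy
    rw [hy]
  have h2 : mvfderiv (𝓡 n) (fun y => α (ι y) (dmap ι y (Y y))) x v =
      mvfderiv (𝓡 m) (fun p => α p (Y' p)) (ι x) (dmap ι x v) := by
    rw [mvfderiv_congr h1]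
    exact mvfderiv_comp_dmap (f := fun p => α p (Y' p)) hιd ((hα.smooth Y' hY').mdiff _) v
  have h3 := gauss_formula hD hι hG hY x v
  rw [alongDeriv_eq hD hι.contMDiff hY' hYY] at h3
  rw [nablaForm_apply (smoothConn_inducedConn hD hι hG) (hα.pullback hι) hY, h2,
    ← hYY.self_of_nhds, nablaForm_apply hD hα hY', h3, (hα.lin _).map_add]
  ring

/-- The induced connection preserves the induced conformal class, and the connection form of the
weight bundle is the restriction of the ambient one, corrected by the conformal factor `e^{2φ}`. -/
theorem Compat.induced (hD : SmoothConn D) (hι : Manifold.IsSmoothEmbedding (𝓡 n) (𝓡 m) ∞ ι)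
    (hG : ∀ x : N, IsInner (pullInner (n := n) g ι x))
    {β : Π p : M, TangentSpace (𝓡 m) p → ℝ} (hβ : Compat D g β) {h : Metric n N} {φ : N → ℝ}
    (hφ : SmoothFun (m := n) φ)
    (hh : ∀ x (v w : TangentSpace (𝓡 n) x), h.inner x v w = Real.exp (2 * φ x) * pullInner g ι x v w) :
    Compat (inducedConn g ι D) h (fun x v => β (ι x) (dmap ι x v) - mvfderiv (𝓡 n) φ x v) := by
  have : T2Space N := hι.isEmbedding.t2Space
  intro Y Z hY hZ x v
  have hιd : MDifferentiableAt (𝓡 n) (𝓡 m) ι x := (hι.contMDiff x).mdifferentiableAt (by simp)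
  obtain ⟨Y', hY', hYY⟩ := exists_smoothField_extension hι (hY.dmap hι.contMDiff) x
  obtain ⟨Z', hZ', hZZ⟩ := exists_smoothField_extension hι (hZ.dmap hι.contMDiff) x
  have h1 : (fun y => pullInner g ι y (Y y) (Z y)) =ᶠ[𝓝 x]
      fun y => g.inner (ι y) (Y' (ι y)) (Z' (ι y)) := by
    filter_upwards [hYY, hZZ] with y hy hz
    rw [hy, hz, pullInner]
  have h2 : mvfderiv (𝓡 n) (fun y => pullInner g ι y (Y y) (Z y)) x v =
      mvfderiv (𝓡 m) (fun p => g.inner p (Y' p) (Z' p)) (ι x) (dmap ι x v) := by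
    rw [mvfderiv_congr h1]
    exact mvfderiv_comp_dmap (f := fun p => g.inner p (Y' p) (Z' p)) hιd
      ((smoothFun_inner g hY' hZ').mdiff _) v
  have h3 := hβ Y' Z' hY' hZ' (ι x) (dmap ι x v)
  rw [← h2, hYY.self_of_nhds, hZZ.self_of_nhds, ← alongDeriv_eq hD hι.contMDiff hY' hYY,
    ← alongDeriv_eq hD hι.contMDiff hZ' hZZ, g.symm (ι x) (dmap ι x (Y x)),
    ← pullInner_tanProj hG, ← pullInner_tanProj hG] at h3
  have hsm : SmoothFun (m := n) fun y => pullInner g ι y (Y y) (Z y) :=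
    smoothFun_inner_along hι g (hY.dmap hι.contMDiff) (hZ.dmap hι.contMDiff)
  have hφ2 : SmoothFun (m := n) fun y => 2 * φ y := contMDiff_const.mul hφ
  have h4 := mvfderiv_mul_fun (smoothFun_exp hφ2) hsm x v
  have h5 : (fun y => h.inner y (Y y) (Z y)) =
      fun y => Real.exp (2 * φ y) * pullInner g ι y (Y y) (Z y) := funext fun y => hh y _ _
  have h6 := mvfderiv_exp_two_mul hφ x v
  rw [h5, hh, hh, hh, inducedConn_apply, inducedConn_apply]
  rw [h4, h6, h3, (hG x).symm (Y x) (tanProj g ι x _)]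
  simp only [pullInner]
  ring

theorem lineDeriv_congr {β : Π x : N, TangentSpace (𝓡 n) x → ℝ} {f f' : N → ℝ} {x : N}
    (h : f =ᶠ[𝓝 x] f') : lineDeriv β f x = lineDeriv β f' x := by
  ext v
  rw [lineDeriv, lineDeriv, mvfderiv_congr h, h.self_of_nhds]

theorem hessian_congr {β : Π x : N, TangentSpace (𝓡 n) x → ℝ} {D : Conn n N} {f f' : N → ℝ} {x : N}
    (h : f =ᶠ[𝓝 x] f') : hessian β D f x = hessian β D f' x := by
  ext v w
  have h2 : (fun y => lineDeriv β f y (FiberBundle.extend (EuclideanSpace ℝ (Fin n)) w y)) =ᶠ[𝓝 x]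
      fun y => lineDeriv β f' y (FiberBundle.extend (EuclideanSpace ℝ (Fin n)) w y) := by
    filter_upwards [h.eventually_nhds] with y hy
    rw [lineDeriv_congr hy]
  rw [hessian, hessian, lineDeriv_congr h, lineDeriv_congr h2]

/-- The Hessian of a section does not depend on the trivialization. -/
theorem hessian_exp_mul [T2Space N] {D : Conn n N} (hD : SmoothConn D)
    {β : Π x : N, TangentSpace (𝓡 n) x → ℝ} (hβ : SmoothForm β) {f φ : N → ℝ}
    (hf : SmoothFun (m := n) f) (hφ : SmoothFun (m := n) φ) (x : N) (v w : TangentSpace (𝓡 n) x) :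
    hessian (fun x v => β x v - mvfderiv (𝓡 n) φ x v) D (fun y => Real.exp (φ y) * f y) x v w =
      Real.exp (φ x) * hessian β D f x v w := by
  have hexp : ∀ y (v : TangentSpace (𝓡 n) y), mvfderiv (𝓡 n) (fun y => Real.exp (φ y)) y v =
      Real.exp (φ y) * mvfderiv (𝓡 n) φ y v := by
    intro y v
    have h1 : SmoothFun (m := n) fun y => (1 / 2 : ℝ) * φ y := contMDiff_const.mul hφ
    have h2 := mvfderiv_exp_two_mul h1 y v
    have h3 : mvfderiv (𝓡 n) (fun y => (1 / 2 : ℝ) * φ y) y v = (1 / 2) * mvfderiv (𝓡 n) φ y v := by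
      rw [mvfderiv_mul_fun contMDiff_const hφ]
      simp [mvfderiv_const]
    rw [h3] at h2
    have h4 : (fun y => Real.exp (2 * ((1 / 2 : ℝ) * φ y))) = fun y => Real.exp (φ y) := by
      ext y; congr 1; ring
    rw [h4] at h2
    rw [h2]
    have : 2 * ((1 / 2 : ℝ) * φ y) = φ y := by ring
    rw [this]
    ring
  have hl : ∀ {f : N → ℝ}, SmoothFun (m := n) f →
      lineDeriv (fun x v => β x v - mvfderiv (𝓡 n) φ x v) (fun y => Real.exp (φ y) * f y) =
      fun y v => Real.exp (φ y) * lineDeriv β f y v := by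
    intro f hf
    ext y v
    rw [lineDeriv, lineDeriv, mvfderiv_mul_fun (smoothFun_exp hφ) hf, hexp]
    ring
  rw [hessian_eq_nablaForm, hessian_eq_nablaForm, hl hf,
    nablaForm_mul hD (smoothFun_exp hφ) (hβ.lineDeriv hf), hexp]
  ring

/-- The Hessian of the restriction of a section to a submanifold: the Gauss formula adds the
derivative in the direction of `B`. -/
theorem hessian_pullback (hD : SmoothConn D) (hι : Manifold.IsSmoothEmbedding (𝓡 n) (𝓡 m) ∞ ι)
    (hG : ∀ x : N, IsInner (pullInner (n := n) g ι x)) {β : Π p : M, TangentSpace (𝓡 m) p → ℝ}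
    (hβ : SmoothForm β) {F : M → ℝ} (hF : SmoothFun (m := m) F) (x : N)
    (v w : TangentSpace (𝓡 n) x) :
    hessian (fun x v => β (ι x) (dmap ι x v)) (inducedConn g ι D) (fun y => F (ι y)) x v w =
      hessian β D F (ι x) (dmap ι x v) (dmap ι x w) +
        lineDeriv β F (ι x) (fundForm g ι D x v w) := by
  have h1 : lineDeriv (fun (x : N) (v : TangentSpace (𝓡 n) x) => β (ι x) (dmap ι x v))
      (fun y => F (ι y)) = fun x v => lineDeriv β F (ι x) (dmap ι x v) := by
    ext y u
    rw [lineDeriv, lineDeriv, mvfderiv_comp_dmap (f := F)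
      ((hι.contMDiff y).mdifferentiableAt (by simp)) (hF.mdiff _)]
  rw [hessian_eq_nablaForm, hessian_eq_nablaForm, h1, nablaForm_pullback hD hι hG (hβ.lineDeriv hF)]
  ring

end Induced

/-! ### The induced Weyl structure -/

section InducedWeyl

variable {m n : ℕ}
  {M : Type*} [TopologicalSpace M] [ChartedSpace (EuclideanSpace ℝ (Fin m)) M]
  [IsManifold (𝓡 m) ∞ M] [T2Space M]
  {N : Type*} [TopologicalSpace N] [ChartedSpace (EuclideanSpace ℝ (Fin n)) N]
  [IsManifold (𝓡 n) ∞ N] {ι : N → M}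
  {c : ConformalStructure m M} {cN : ConformalStructure n N}

/-- The connection form `restrictedLForm` makes the induced connection compatible with the induced
conformal class. -/
theorem compat_inducedConn (hn : n ≠ 0) (hι : Manifold.IsSmoothEmbedding (𝓡 n) (𝓡 m) ∞ ι)
    (hc : IsInducedConformal ι c cN) (W : WeylStructure c) (g : c.metrics) (h : cN.metrics) :
    Compat (inducedConn g.1 ι W.cov.toFun) h.1 (restrictedLForm g.1 ι W.cov.toFun h.1) := by
  obtain ⟨h1, h2⟩ := hc.logFactor_spec hn g.2 h.2
  exact (W.compat g.2).induced W.smoothConn hι (hc.isInner g.2) h1 h2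

/-- The connection form that the induced Weyl structure defines on the weight bundle of the
submanifold is the restriction of the ambient one. -/
theorem lForm_inducedConn (hn : n ≠ 0) (hι : Manifold.IsSmoothEmbedding (𝓡 n) (𝓡 m) ∞ ι)
    (hc : IsInducedConformal ι c cN) (W : WeylStructure c) (g : c.metrics) (h : cN.metrics) :
    lForm (inducedConn g.1 ι W.cov.toFun) h.1 = restrictedLForm g.1 ι W.cov.toFun h.1 := by
  have : T2Space N := hι.isEmbedding.t2Space
  ext x v
  exact (compat_inducedConn hn hι hc W g h).lForm_eq hn
    (smoothConn_inducedConn W.smoothConn hι (hc.isInner g.2)) x v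

/-- The Weyl structure that a Weyl structure of the ambient manifold induces on a submanifold. It
does not depend on the metric `g`, which serves to define the orthogonal projection. -/
noncomputable def inducedWeyl (hn : n ≠ 0) (hι : Manifold.IsSmoothEmbedding (𝓡 n) (𝓡 m) ∞ ι)
    (hc : IsInducedConformal ι c cN) (W : WeylStructure c) (g : c.metrics) : WeylStructure cN where
  cov := inducedCov W.smoothConn hι.contMDiff (hc.isInner g.2)
  smooth := contMDiff_inducedCov W.smoothConn hι (hc.isInner g.2)
  torsion_free := inducedCov_torsion W.smoothConn hι (hc.isInner g.2)
  conformal h hh x v Y Z := by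
    have : T2Space N := hι.isEmbedding.t2Space
    have hD := smoothConn_inducedConn W.smoothConn hι (hc.isInner g.2)
    have h1 := compat_inducedConn hn hι hc W g ⟨h, hh⟩
    change nablaMetric (inducedConn g.1 ι W.cov.toFun) h x v Y Z +
      2 * lForm (inducedConn g.1 ι W.cov.toFun) h x v * h.inner x Y Z = 0
    rw [h1.nablaMetric_eq hD, h1.lForm_eq hn hD]
    ring

/-- The Hessian on the submanifold of a section of the weight bundle, through the ambient one. -/
theorem hessian_restrict (hn : n ≠ 0) (hι : Manifold.IsSmoothEmbedding (𝓡 n) (𝓡 m) ∞ ι)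
    (hc : IsInducedConformal ι c cN) (W : WeylStructure c) (g : c.metrics) (h : cN.metrics)
    {f : N → ℝ} {F : M → ℝ} (hF : SmoothFun (m := m) F) {x : N}
    (hf : ∀ᶠ y in 𝓝 x, f y = Real.exp (logFactor g.1 ι h.1 y) * F (ι y))
    (v w : TangentSpace (𝓡 n) x) :
    hessian (restrictedLForm g.1 ι W.cov.toFun h.1) (inducedConn g.1 ι W.cov.toFun) f x v w =
      Real.exp (logFactor g.1 ι h.1 x) *
        (hessian (lForm W.cov.toFun g.1) W.cov.toFun F (ι x) (dmap ι x v) (dmap ι x w) +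
          lineDeriv (lForm W.cov.toFun g.1) F (ι x) (fundForm g.1 ι W.cov.toFun x v w)) := by
  have : T2Space N := hι.isEmbedding.t2Space
  rw [hessian_congr hf, ← hessian_pullback W.smoothConn hι (hc.isInner g.2)
    (W.smoothForm_lForm g.2) hF]
  exact hessian_exp_mul (smoothConn_inducedConn W.smoothConn hι (hc.isInner g.2))
    ((W.smoothForm_lForm g.2).pullback hι) (hF.comp hι.contMDiff)
    (hc.logFactor_spec hn g.2 h.2).1 x v w

/-! ### The trace-free fundamental form and the mean curvature -/

variable {D : Conn m M} {g : Metric m M} {h : Metric n N} {x : N}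

theorem apply_meanVec (L : TangentSpace (𝓡 m) (ι x) →ₗ[ℝ] ℝ) :
    L (meanVec (n := n) g ι D x) =
      (1 / (n : ℝ)) * trG (m := n) x (pullInner g ι x) (fun v w => L (fundForm g ι D x v w)) := by
  rw [meanVec, map_smul, trG_map (G := pullInner (n := n) g ι x) L, smul_eq_mul]

/-- The trace-free part of `L ∘ B` is `L ∘ B₀`. -/
theorem traceFree_fundForm {a : ℝ} (ha : 0 < a)
    (hh : ∀ v w : TangentSpace (𝓡 n) x, h.inner x v w = a * pullInner g ι x v w)
    (L : TangentSpace (𝓡 m) (ι x) →ₗ[ℝ] ℝ) (v w : TangentSpace (𝓡 n) x) :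
    traceFree h x (fun v w => L (fundForm g ι D x v w)) v w = L (fundFormZero g ι D x v w) := by
  have h1 : (fun v w : TangentSpace (𝓡 n) x => h.inner x v w) =
      fun v w => a * pullInner g ι x v w := by ext; exact hh _ _
  rw [traceFree, h1, trG_rescale, fundFormZero, map_sub, map_smul, apply_meanVec, hh,
    smul_eq_mul, smul_eq_mul]
  field_simp

theorem traceFree_fundFormZero (hn : n ≠ 0) {a : ℝ} (ha : 0 < a)
    (hh : ∀ v w : TangentSpace (𝓡 n) x, h.inner x v w = a * pullInner g ι x v w)
    (L : TangentSpace (𝓡 m) (ι x) →ₗ[ℝ] ℝ) (v w : TangentSpace (𝓡 n) x) :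
    traceFree h x (fun v w => L (fundFormZero g ι D x v w)) v w = L (fundFormZero g ι D x v w) := by
  have h1 : (fun v w => L (fundFormZero (n := n) g ι D x v w)) =
      traceFree h x (fun v w => L (fundForm g ι D x v w)) := by
    ext v w; rw [traceFree_fundForm ha hh]
  rw [h1, traceFree_of_trG_eq_zero h (trG_traceFree hn h _), traceFree_fundForm ha hh]

/-- The mean curvature vector is normal. -/
theorem inner_meanVec_dmap (hG : ∀ x : N, IsInner (pullInner (n := n) g ι x)) (x : N)
    (w : TangentSpace (𝓡 n) x) : g.inner (ι x) (meanVec (n := n) g ι D x) (dmap ι x w) = 0 := by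
  have h1 := apply_meanVec (n := n) (g := g) (ι := ι) (D := D) (x := x)
    (g.inner (ι x) (dmap ι x w)).toLinearMap
  have h2 : (fun v u : TangentSpace (𝓡 n) x =>
      (g.inner (ι x) (dmap ι x w)).toLinearMap (fundForm g ι D x v u)) = fun _ _ => 0 := by
    ext v u
    exact (g.symm _ _ _).trans (inner_fundForm_dmap hG x v u w)
  rw [h2] at h1
  have h3 : trG (m := n) x (pullInner g ι x) (fun _ _ => (0 : ℝ)) = 0 := by simp [trG]
  rw [h3, mul_zero] at h1
  exact (g.symm _ _ _).trans h1

/-! ### Change of the ambient metric -/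

section Rescale

variable {g' : Metric m M} {ψ : M → ℝ}

theorem inducedConn_rescale (hG : ∀ x : N, IsInner (pullInner (n := n) g ι x))
    (hψ : IsRescaling g g' ψ) : inducedConn (n := n) g' ι D = inducedConn g ι D := by
  ext1 Y
  ext1 x
  rw [inducedConn, inducedConn, tanProj_rescale hG hψ]

theorem fundForm_rescale (hG : ∀ x : N, IsInner (pullInner (n := n) g ι x))
    (hψ : IsRescaling g g' ψ) (x : N) : fundForm (n := n) g' ι D x = fundForm g ι D x := by
  ext1 v
  ext1 w
  rw [fundForm, fundForm, norProj, norProj, tanProj_rescale hG hψ]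

theorem meanVec_rescale (hG : ∀ x : N, IsInner (pullInner (n := n) g ι x))
    (hψ : IsRescaling g g' ψ) (x : N) : meanVec (n := n) g' ι D x =
      (Real.exp (2 * ψ (ι x)))⁻¹ • meanVec (n := n) g ι D x := by
  have h1 : pullInner (n := n) g' ι x = fun v w => Real.exp (2 * ψ (ι x)) * pullInner g ι x v w := by
    ext v w; exact pullInner_rescale hψ x v w
  rw [meanVec, meanVec, h1, trG_rescale, fundForm_rescale hG hψ, smul_comm]

theorem meanCurv_rescale (hG : ∀ x : N, IsInner (pullInner (n := n) g ι x))
    (hψ : IsRescaling g g' ψ) (x : N) (ξ : TangentSpace (𝓡 m) (ι x)) :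
    meanCurv (n := n) g' ι D x ξ = meanCurv (n := n) g ι D x ξ := by
  rw [meanCurv, meanCurv, hψ, meanVec_rescale hG hψ, map_smul, smul_apply, smul_eq_mul,
    ← mul_assoc, mul_inv_cancel₀ (Real.exp_ne_zero _), one_mul]

theorem schoutenSym_rescale {D : Conn m M} (hψ : IsRescaling g g' ψ) (p : M)
    (X Y : TangentSpace (𝓡 m) p) : schoutenSym D g' p X Y = schoutenSym D g p X Y := by
  have h1 : (fun v w : TangentSpace (𝓡 m) p => g'.inner p v w) =
      fun v w => Real.exp (2 * ψ p) * g.inner p v w := by ext; exact hψ _ _ _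
  have h2 := traceFree_rescale (Real.exp_ne_zero (2 * ψ p)) (hψ p) (symPart (ricci D p))
  rw [schoutenSym, schoutenSym, h2, scal, scal, h1,
    trG_rescale (G := fun v w => g.inner p v w), hψ, smul_eq_mul]
  have := Real.exp_ne_zero (2 * ψ p)
  field_simp

end Rescale

end InducedWeyl

/-! ### Scalar perturbations of the trace-free Hessian -/

section Mobius

variable {m : ℕ} {M : Type*} [TopologicalSpace M] [ChartedSpace (EuclideanSpace ℝ (Fin m)) M]
  [IsManifold (𝓡 m) ∞ M]

/-- Bilinear functions on the finite-dimensional tangent spaces as continuous bilinear maps. -/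
theorem exists_bilin {A : Π x : M, TangentSpace (𝓡 m) x → TangentSpace (𝓡 m) x → ℝ}
    (hA : ∀ x, IsBilinearMap ℝ (A x)) :
    ∃ b : Π x : M, TangentSpace (𝓡 m) x →L[ℝ] TangentSpace (𝓡 m) x →L[ℝ] ℝ,
      ∀ x X Y, b x X Y = A x X Y := by
  have hfin : ∀ x : M, FiniteDimensional ℝ (TangentSpace (𝓡 m) x) := fun x =>
    inferInstanceAs (FiniteDimensional ℝ (EuclideanSpace ℝ (Fin m)))
  have ht2 : ∀ x : M, T2Space (TangentSpace (𝓡 m) x) := fun x =>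
    inferInstanceAs (T2Space (EuclideanSpace ℝ (Fin m)))
  exact ⟨fun x => (hA x).toContinuousBilinearMap, fun x X Y => rfl⟩

variable [T2Space M]

/-- A field of bilinear forms is smooth if its values on smooth vector fields are smooth. -/
theorem isSmoothBilin_of_apply
    {b : Π x : M, TangentSpace (𝓡 m) x →L[ℝ] TangentSpace (𝓡 m) x →L[ℝ] ℝ}
    (hb : ∀ X Y, SmoothField X → SmoothField Y → SmoothFun (m := m) fun y => b y (X y) (Y y)) :
    IsSmoothBilin b := by
  refine contMDiff_hom_of_apply (V := fun x : M => TangentSpace (𝓡 m) x →L[ℝ] ℝ) b fun X hX => ?_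
  refine contMDiff_hom_of_apply (V := Bundle.Trivial M ℝ) (fun x => b x (X x)) fun Y hY => ?_
  intro x
  exact (contMDiffAt_section (E := Bundle.Trivial M ℝ) x).2 (hb X Y hX hY x)

theorem smoothFun_traceFree (g : Metric m M)
    {A : Π x : M, TangentSpace (𝓡 m) x → TangentSpace (𝓡 m) x → ℝ}
    (hA : ∀ x, IsBilinearMap ℝ (A x))
    (hAs : ∀ X Y, SmoothField X → SmoothField Y → SmoothFun (m := m) fun y => A y (X y) (Y y))
    {X Y : Π x : M, TangentSpace (𝓡 m) x} (hX : SmoothField X) (hY : SmoothField Y) :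
    SmoothFun (m := m) fun y => traceFree g y (A y) (X y) (Y y) := by
  have h1 := smoothFun_trG (isInner_metric g) hA (fun X Y hX hY => smoothFun_inner g hX hY) hAs
  unfold traceFree
  exact ContMDiff.sub (hAs X Y hX hY)
    (ContMDiff.mul (contMDiff_const.mul h1) (smoothFun_inner g hX hY))

theorem smoothFun_symPart {A : Π x : M, TangentSpace (𝓡 m) x → TangentSpace (𝓡 m) x → ℝ}
    (hAs : ∀ X Y, SmoothField X → SmoothField Y → SmoothFun (m := m) fun y => A y (X y) (Y y))
    (X Y : Π x : M, TangentSpace (𝓡 m) x) (hX : SmoothField X) (hY : SmoothField Y) :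
    SmoothFun (m := m) fun y => symPart (A y) (X y) (Y y) := by
  simp only [symPart, div_eq_mul_inv]
  exact ContMDiff.mul (ContMDiff.add (hAs X Y hX hY) (hAs Y X hY hX)) contMDiff_const

theorem isBilinearMap_schoutenSym {D : Conn m M} (hD : SmoothConn D) (g : Metric m M) (x : M) :
    IsBilinearMap ℝ (schoutenSym D g x) := by
  have h1 := isBilinearMap_traceFree g (isBilinearMap_symPart (isBilinearMap_ricci hD x))
  refine ⟨fun _ _ _ => ?_, fun _ _ _ => ?_, fun _ _ _ => ?_, fun _ _ _ => ?_⟩ <;>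
  simp only [schoutenSym, h1.add_left, h1.smul_left, h1.add_right, h1.smul_right, smul_eq_mul,
    map_add, map_smul, add_apply, smul_apply] <;> ring

theorem schoutenSym_symm (D : Conn m M) (g : Metric m M) (x : M) (X Y : TangentSpace (𝓡 m) x) :
    schoutenSym D g x X Y = schoutenSym D g x Y X := by
  rw [schoutenSym, schoutenSym, g.symm x X Y,
    traceFree_symm g (fun v w => by rw [symPart, symPart, add_comm]) X Y]

theorem smoothFun_schoutenSym {D : Conn m M} (hD : SmoothConn D) (g : Metric m M)
    {X Y : Π x : M, TangentSpace (𝓡 m) x} (hX : SmoothField X) (hY : SmoothField Y) :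
    SmoothFun (m := m) fun y => schoutenSym D g y (X y) (Y y) := by
  have hs := fun X Y hX hY => smoothFun_ricci hD g (X := X) (Y := Y) hX hY
  have h1 := smoothFun_trG (isInner_metric g) (fun x => isBilinearMap_ricci hD x)
    (fun X Y hX hY => smoothFun_inner g hX hY) hs
  have h2 := smoothFun_traceFree g (fun x => isBilinearMap_symPart (isBilinearMap_ricci hD x))
    (smoothFun_symPart hs) hX hY
  unfold schoutenSym scal
  exact ContMDiff.add (contMDiff_const.mul h2)
    (ContMDiff.mul (contMDiff_const.mul h1) (smoothFun_inner g hX hY))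

variable {c : ConformalStructure m M}

theorem isBilinearMap_hessZero (W : WeylStructure c) (l : LSection c) (g : c.metrics) (x : M) :
    IsBilinearMap ℝ (hessZero W.cov.toFun l g x) :=
  isBilinearMap_traceFree g.1 (isBilinearMap_symPart
    (isBilinearMap_hessian W.smoothConn (W.smoothForm_lForm g.2) (l.smooth g) x))

theorem smoothFun_hessZero (W : WeylStructure c) (l : LSection c) (g : c.metrics)
    {X Y : Π x : M, TangentSpace (𝓡 m) x} (hX : SmoothField X) (hY : SmoothField Y) :
    SmoothFun (m := m) fun y => hessZero W.cov.toFun l g y (X y) (Y y) :=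
  smoothFun_traceFree g.1 (fun x => isBilinearMap_symPart
    (isBilinearMap_hessian W.smoothConn (W.smoothForm_lForm g.2) (l.smooth g) x))
    (smoothFun_symPart fun _ _ hX hY =>
      smoothFun_hessian W.smoothConn (W.smoothForm_lForm g.2) (l.smooth g) hX hY) hX hY

theorem hessZero_symm (W : WeylStructure c) (l : LSection c) (g : c.metrics) (x : M)
    (X Y : TangentSpace (𝓡 m) x) :
    hessZero W.cov.toFun l g x X Y = hessZero W.cov.toFun l g x Y X :=
  traceFree_symm g.1 (fun v w => by rw [symPart, symPart, add_comm]) X Y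

/-- The exponent of the conformal factor between two metrics of the class is smooth. -/
theorem IsRescaling.smooth (hm : m ≠ 0) {g g' : Metric m M} (hg : g ∈ c.metrics)
    (hg' : g' ∈ c.metrics) {φ : M → ℝ} (h : IsRescaling g g' φ) : SmoothFun (m := m) φ := by
  obtain ⟨ψ, hψ, hgg⟩ := (c.mem_iff g hg g').1 hg'
  convert hψ using 1
  ext x
  have : NeZero m := ⟨hm⟩
  have hpos := g.pos x (stdBasis x 0) ((stdBasis x).ne_zero 0)
  have h1 := (h x (stdBasis x 0) (stdBasis x 0)).symm.trans (hgg x _ _)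
  have h2 := Real.exp_injective (mul_right_cancel₀ hpos.ne' h1)
  linarith

/-- The trace-free Hessian has weight one: it is a section of `S²₀ ⊗ L`. -/
theorem hessZero_weight (hm : m ≠ 0) (W : WeylStructure c) (l : LSection c) (g g' : c.metrics)
    {φ : M → ℝ} (h : IsRescaling g.1 g'.1 φ) (x : M) (X Y : TangentSpace (𝓡 m) x) :
    hessZero W.cov.toFun l g' x X Y = Real.exp (φ x) * hessZero W.cov.toFun l g x X Y := by
  have hφ := h.smooth hm g.2 g'.2
  have h1 : lForm W.cov.toFun g'.1 = fun x v => lForm W.cov.toFun g.1 x v - mvfderiv (𝓡 m) φ x v := by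
    ext x v
    exact W.lForm_rescale hm g.2 hφ h x v
  have h2 : l.toFun g' = fun x => Real.exp (φ x) * l.toFun g x := funext (l.weight g g' φ h)
  have h3 : symPart (hessian (lForm W.cov.toFun g'.1) W.cov.toFun (l.toFun g') x) =
      fun v w => Real.exp (φ x) *
        symPart (hessian (lForm W.cov.toFun g.1) W.cov.toFun (l.toFun g) x) v w := by
    ext v w
    rw [h1, h2, symPart, symPart, hessian_exp_mul W.smoothConn (W.smoothForm_lForm g.2) (l.smooth g) hφ,
      hessian_exp_mul W.smoothConn (W.smoothForm_lForm g.2) (l.smooth g) hφ]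
    ring
  rw [hessZero, h3, traceFree_mul, traceFree_rescale (Real.exp_ne_zero (2 * φ x)) (h x), hessZero]

/-- A scalar perturbation of the trace-free Hessian of a Weyl structure is a Möbius structure. -/
theorem isMobiusStructure_of_eq (hm : m ≠ 0) (W : WeylStructure c)
    {b : Π x : M, TangentSpace (𝓡 m) x → TangentSpace (𝓡 m) x → ℝ}
    (hbil : ∀ x, IsBilinearMap ℝ (b x))
    (hbs : ∀ X Y, SmoothField X → SmoothField Y → SmoothFun (m := m) fun y => b y (X y) (Y y))
    (hsymm : ∀ x X Y, b x X Y = b x Y X)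
    (htr : ∀ g ∈ c.metrics, ∀ x, trG x (fun v w => g.inner x v w) (b x) = 0)
    {P : LSection c → LForm c}
    (hP : ∀ l g x X Y, P l g x X Y = hessZero W.cov.toFun l g x X Y + b x X Y * l.toFun g x) :
    IsMobiusStructure c P := by
  refine ⟨fun l => ?_, W, ?_⟩
  · have h1 : ∀ (g : c.metrics) x, IsBilinearMap ℝ
        (fun X Y => hessZero W.cov.toFun l g x X Y + b x X Y * l.toFun g x) := by
      intro g x
      have h2 := isBilinearMap_hessZero W l g x
      have h3 := hbil x
      refine ⟨fun _ _ _ => ?_, fun _ _ _ => ?_, fun _ _ _ => ?_, fun _ _ _ => ?_⟩ <;>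
      simp only [h2.add_left, h2.smul_left, h2.add_right, h2.smul_right, h3.add_left, h3.smul_left,
        h3.add_right, h3.smul_right, smul_eq_mul] <;> ring
    choose B hB using fun g => exists_bilin (h1 g)
    refine ⟨B, fun g x X Y => by rw [hP, hB], fun g => ?_, fun g x X Y => ?_, fun g x => ?_,
      fun g g' φ h x X Y => ?_⟩
    · refine isSmoothBilin_of_apply fun X Y hX hY => ?_
      simp only [hB]
      exact ContMDiff.add (smoothFun_hessZero W l g hX hY) (ContMDiff.mul (hbs X Y hX hY) (l.smooth g))
    · rw [hB, hB, hessZero_symm, hsymm]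
    · simp only [hB]
      have h2 : trG x (fun v w => g.1.inner x v w) (fun v w => b x v w * l.toFun g x) = 0 := by
        have := trG_smul (G := fun v w => g.1.inner x v w) (l.toFun g x) (b x)
        simp only [smul_eq_mul, htr g.1 g.2 x, mul_zero] at this
        simpa only [mul_comm] using this
      rw [trG_add, h2, add_zero]
      exact trG_traceFree hm g.1 _
    · rw [hB, hB, hessZero_weight hm W l g g' h, l.weight g g' φ h]
      ring
  · obtain ⟨B, hB⟩ := exists_bilin hbil
    refine ⟨B, isSmoothBilin_of_apply fun X Y hX hY => ?_, fun x X Y => by rw [hB, hB, hsymm],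
      fun g hg x => ?_, fun l g x X Y => by rw [hB, hP]⟩
    · simpa only [hB] using hbs X Y hX hY
    · simpa only [hB] using htr g hg x

/-- A Möbius structure differs from the trace-free Hessian of every Weyl structure by a scalar
operator. -/
theorem IsMobiusStructure.exists_eq (hm : m ≠ 0) {P : LSection c → LForm c}
    (hP : IsMobiusStructure c P) (W : WeylStructure c) :
    ∃ b : Π x : M, TangentSpace (𝓡 m) x →L[ℝ] TangentSpace (𝓡 m) x →L[ℝ] ℝ,
      ∀ l g x X Y, P l g x X Y = hessZero W.cov.toFun l g x X Y + b x X Y * l.toFun g x := by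
  obtain ⟨-, W₀, b, -, -, -, hb⟩ := hP
  obtain ⟨g₀, hg₀⟩ := c.nonempty
  set θ : Π x : M, TangentSpace (𝓡 m) x → ℝ := fun x v =>
    lForm W₀.cov.toFun g₀ x v - lForm W.cov.toFun g₀ x v with hθ
  have hform : SmoothForm θ := (W₀.smoothForm_lForm hg₀).sub (W.smoothForm_lForm hg₀)
  have hAbil : ∀ x, IsBilinearMap ℝ (fun X Y => b x X Y + traceFree g₀ x (fun u v =>
      symPart (nablaForm W.cov.toFun θ x) u v - θ x u * θ x v) X Y) := by
    intro x
    have h1 := isBilinearMap_symPart (isBilinearMap_nablaForm W.smoothConn hform x)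
    have h2 := hform.lin x
    have h3 : IsBilinearMap ℝ (fun u v =>
        symPart (nablaForm W.cov.toFun θ x) u v - θ x u * θ x v) := by
      refine ⟨fun _ _ _ => ?_, fun _ _ _ => ?_, fun _ _ _ => ?_, fun _ _ _ => ?_⟩ <;>
      simp only [h1.add_left, h1.smul_left, h1.add_right, h1.smul_right, h2.map_add, h2.map_smul,
        smul_eq_mul] <;> ring
    have h4 := isBilinearMap_traceFree g₀ h3
    refine ⟨fun _ _ _ => ?_, fun _ _ _ => ?_, fun _ _ _ => ?_, fun _ _ _ => ?_⟩ <;>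
    simp only [h4.add_left, h4.smul_left, h4.add_right, h4.smul_right, smul_eq_mul, map_add,
      map_smul, add_apply, smul_apply] <;> ring
  obtain ⟨B, hB⟩ := exists_bilin hAbil
  refine ⟨B, fun l g x X Y => ?_⟩
  obtain ⟨ψ, hψ, hgg⟩ := (c.mem_iff g₀ hg₀ g.1).1 g.2
  have h1 : (fun x v => lForm W₀.cov.toFun g.1 x v - lForm W.cov.toFun g.1 x v) = θ := by
    ext x v
    rw [W.lForm_rescale hm hg₀ hψ hgg, W₀.lForm_rescale hm hg₀ hψ hgg, hθ]
    ring
  have h2 := hessZero_change hm W W₀ l g x X Y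
  have h3 : ∀ x v, lForm W₀.cov.toFun g.1 x v - lForm W.cov.toFun g.1 x v = θ x v := fun x v =>
    congrFun (congrFun h1 x) v
  simp only [h3] at h2
  rw [hb, h2, hB, traceFree_rescale (Real.exp_ne_zero (2 * ψ x)) (hgg x)]
  ring

/-- The trace-free part of the tensor of a Möbius structure acts as the tensor itself. -/
theorem IsMobiusStructure.traceFree_mul_eq (hm : m ≠ 0) {P : LSection c → LForm c}
    (hP : IsMobiusStructure c P) (W : WeylStructure c)
    {b : Π x : M, TangentSpace (𝓡 m) x →L[ℝ] TangentSpace (𝓡 m) x →L[ℝ] ℝ}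
    (hb : ∀ l g x X Y, P l g x X Y = hessZero W.cov.toFun l g x X Y + b x X Y * l.toFun g x)
    (l : LSection c) (g : c.metrics) (x : M) (X Y : TangentSpace (𝓡 m) x) :
    traceFree g.1 x (fun v w => b x v w) X Y * l.toFun g x = b x X Y * l.toFun g x := by
  obtain ⟨B, hPB, -, -, htr, -⟩ := hP.1 l
  have h1 : (fun v w => l.toFun g x * b x v w) =
      fun v w => B g x v w - hessZero W.cov.toFun l g x v w := by
    ext v w
    rw [← hPB, hb]
    ring
  have h2 : trG x (fun v w => g.1.inner x v w) (fun v w => l.toFun g x * b x v w) = 0 := by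
    rw [h1, trG_sub, htr]
    have := trG_traceFree hm g.1
      (symPart (hessian (lForm W.cov.toFun g.1) W.cov.toFun (l.toFun g) x))
    exact sub_eq_zero.2 this.symm
  have h3 := traceFree_of_trG_eq_zero g.1 h2 X Y
  rw [traceFree_mul] at h3
  linarith

/-- The skew part of the Hessian is given by the Faraday form. -/
theorem hessian_eq_symPart_add (hm : m ≠ 0) (W : WeylStructure c) (g : c.metrics) {f : M → ℝ}
    (hf : SmoothFun (m := m) f) (x : M) (X Y : TangentSpace (𝓡 m) x) :
    hessian (lForm W.cov.toFun g.1) W.cov.toFun f x X Y =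
      symPart (hessian (lForm W.cov.toFun g.1) W.cov.toFun f x) X Y +
        (1 / 2) * faraday W.cov.toFun x X Y * f x := by
  have h1 := hessian_sub_swap W.smoothConn (W.smoothForm_lForm g.2) hf x X Y
  rw [(W.compat g.2).faraday_eq hm W.smoothConn (W.smoothForm_lForm g.2), symPart]
  linarith

end Mobius

/-! ### The induced Möbius operator -/

section InducedMobius

variable {m n : ℕ}
  {M : Type*} [TopologicalSpace M] [ChartedSpace (EuclideanSpace ℝ (Fin m)) M]
  [IsManifold (𝓡 m) ∞ M] [T2Space M]
  {N : Type*} [TopologicalSpace N] [ChartedSpace (EuclideanSpace ℝ (Fin n)) N]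
  [IsManifold (𝓡 n) ∞ N] {ι : N → M}
  {c : ConformalStructure m M} {cN : ConformalStructure n N}

/-- The restriction to a submanifold of a smooth field of bilinear forms. -/
theorem smoothFun_bilin_along (hι : Manifold.IsSmoothEmbedding (𝓡 n) (𝓡 m) ∞ ι)
    {A : Π p : M, TangentSpace (𝓡 m) p → TangentSpace (𝓡 m) p → ℝ}
    (hA : ∀ X Y, SmoothField X → SmoothField Y → SmoothFun (m := m) fun p => A p (X p) (Y p))
    {V W : Π y : N, TangentSpace (𝓡 m) (ι y)} (hV : SmoothAlong (n := n) ι V)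
    (hW : SmoothAlong (n := n) ι W) : SmoothFun (m := n) fun y => A (ι y) (V y) (W y) := by
  intro x
  obtain ⟨X, hX, hXe⟩ := exists_smoothField_extension hι hV x
  obtain ⟨Y, hY, hYe⟩ := exists_smoothField_extension hι hW x
  have h1 : SmoothFun (m := n) fun y => A (ι y) (X (ι y)) (Y (ι y)) :=
    ContMDiff.comp (hA X Y hX hY) hι.contMDiff
  refine (h1 x).congr_of_eventuallyEq ?_
  filter_upwards [hXe, hYe] with y h2 h3
  rw [h2, h3]

/-- The bilinear form `hˢ|_N + H ∘ B` on the submanifold. Its trace-free part is the tensor by which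
the induced Möbius operator differs from the trace-free Hessian of the induced Weyl structure. -/
noncomputable def scalarPart (g : Metric m M) (ι : N → M) (D : Conn m M) (x : N)
    (X Y : TangentSpace (𝓡 n) x) : ℝ :=
  schoutenSym D g (ι x) (dmap ι x X) (dmap ι x Y) +
    meanCurv (n := n) g ι D x (fundForm g ι D x X Y)

theorem exists_linearMap_meanCurv (g : Metric m M) (D : Conn m M) (x : N) :
    ∃ L : TangentSpace (𝓡 m) (ι x) →ₗ[ℝ] ℝ, ∀ ξ, meanCurv (n := n) g ι D x ξ = L ξ :=
  ⟨(g.inner (ι x) (meanVec (n := n) g ι D x)).toLinearMap, fun _ => rfl⟩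

section Scalar

variable {D : Conn m M} {g : Metric m M}

theorem isBilinearMap_pullback {A : Π p : M, TangentSpace (𝓡 m) p → TangentSpace (𝓡 m) p → ℝ}
    (hA : ∀ p, IsBilinearMap ℝ (A p)) (x : N) :
    IsBilinearMap ℝ (fun v w : TangentSpace (𝓡 n) x => A (ι x) (dmap ι x v) (dmap ι x w)) := by
  have h := hA (ι x)
  refine ⟨fun _ _ _ => ?_, fun _ _ _ => ?_, fun _ _ _ => ?_, fun _ _ _ => ?_⟩ <;>
  simp only [map_add, map_smul, h.add_left, h.smul_left, h.add_right, h.smul_right]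

theorem isBilinearMap_scalarPart (hD : SmoothConn D)
    (hι : Manifold.IsSmoothEmbedding (𝓡 n) (𝓡 m) ∞ ι)
    (hG : ∀ x : N, IsInner (pullInner (n := n) g ι x)) (x : N) :
    IsBilinearMap ℝ (scalarPart (n := n) g ι D x) := by
  have h1 := isBilinearMap_pullback (ι := ι) (n := n) (fun p => isBilinearMap_schoutenSym hD g p) x
  have h2 := isBilinearMap_fundForm (g := g) hD hι hG x
  obtain ⟨L, hL⟩ := exists_linearMap_meanCurv (n := n) (ι := ι) g D x
  have h3 := h1.add_left
  have h4 := h1.smul_left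
  have h5 := h1.add_right
  have h6 := h1.smul_right
  unfold scalarPart
  refine ⟨fun u v w => ?_, fun a v w => ?_, fun u v w => ?_, fun a v w => ?_⟩
  · simp only [hL, h3 u v w, h2.add_left, map_add L]; ring
  · simp only [hL, h4 a v w, h2.smul_left, map_smul L, smul_eq_mul]; ring
  · simp only [hL, h5 u v w, h2.add_right, map_add L]; ring
  · simp only [hL, h6 a v w, h2.smul_right, map_smul L, smul_eq_mul]; ring

theorem scalarPart_symm (hD : SmoothConn D) (hι : Manifold.IsSmoothEmbedding (𝓡 n) (𝓡 m) ∞ ι)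
    (hG : ∀ x : N, IsInner (pullInner (n := n) g ι x)) (x : N) (v w : TangentSpace (𝓡 n) x) :
    scalarPart g ι D x v w = scalarPart g ι D x w v := by
  rw [scalarPart, scalarPart, schoutenSym_symm, fundForm_symm hD hι hG]

/-- For smoothness, `H(B(X, Y))` is written as the trace of `g(B(X, Y), B(·, ·))`. -/
theorem smoothFun_scalarPart (hD : SmoothConn D)
    (hι : Manifold.IsSmoothEmbedding (𝓡 n) (𝓡 m) ∞ ι)
    (hG : ∀ x : N, IsInner (pullInner (n := n) g ι x)) {X Y : Π y : N, TangentSpace (𝓡 n) y}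
    (hX : SmoothField X) (hY : SmoothField Y) :
    SmoothFun (m := n) fun y => scalarPart g ι D y (X y) (Y y) := by
  have : T2Space N := hι.isEmbedding.t2Space
  have hB := smoothAlong_fundForm (g := g) hD hι hG hX hY
  have h1 : SmoothFun (m := n) fun y => schoutenSym D g (ι y) (dmap ι y (X y)) (dmap ι y (Y y)) :=
    smoothFun_bilin_along hι (fun X Y hX hY => smoothFun_schoutenSym hD g hX hY)
      (hX.dmap hι.contMDiff) (hY.dmap hι.contMDiff)
  have h2 : SmoothFun (m := n) fun y => trG (m := n) y (pullInner g ι y) (fun v w =>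
      g.inner (ι y) (fundForm g ι D y (X y) (Y y)) (fundForm g ι D y v w)) := by
    refine smoothFun_trG hG (fun y => ?_) (fun Z W hZ hW => ?_) (fun Z W hZ hW => ?_)
    · have h3 := isBilinearMap_fundForm (g := g) hD hι hG y
      refine ⟨fun _ _ _ => ?_, fun _ _ _ => ?_, fun _ _ _ => ?_, fun _ _ _ => ?_⟩ <;>
      simp only [map_add, map_smul, h3.add_left, h3.smul_left, h3.add_right, h3.smul_right]
    · exact smoothFun_inner_along hι g (hZ.dmap hι.contMDiff) (hW.dmap hι.contMDiff)
    · exact smoothFun_inner_along hι g hB (smoothAlong_fundForm (g := g) hD hι hG hZ hW)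
  have h3 : ∀ y, meanCurv (n := n) g ι D y (fundForm g ι D y (X y) (Y y)) =
      (1 / (n : ℝ)) * trG (m := n) y (pullInner g ι y) (fun v w =>
        g.inner (ι y) (fundForm g ι D y (X y) (Y y)) (fundForm g ι D y v w)) := fun y => by
    rw [meanCurv, g.symm]
    exact apply_meanVec (g.inner (ι y) (fundForm g ι D y (X y) (Y y))).toLinearMap
  unfold scalarPart
  simp only [h3]
  exact ContMDiff.add h1 (contMDiff_const.mul h2)

/-- The trace of `B` is absorbed in the trace-free part: only `B₀` remains. -/
theorem traceFree_scalarPart {h : Metric n N} {x : N} {a : ℝ} (ha : 0 < a)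
    (hh : ∀ v w : TangentSpace (𝓡 n) x, h.inner x v w = a * pullInner g ι x v w)
    (X Y : TangentSpace (𝓡 n) x) : traceFree h x (scalarPart g ι D x) X Y =
      traceFree h x (fun v w => schoutenSym D g (ι x) (dmap ι x v) (dmap ι x w)) X Y +
        meanCurv (n := n) g ι D x (fundFormZero g ι D x X Y) := by
  obtain ⟨L, hL⟩ := exists_linearMap_meanCurv (n := n) (ι := ι) g D x
  unfold scalarPart
  simp only [hL]
  rw [traceFree_add, traceFree_fundForm ha hh L]

end Scalar

variable (hn : n ≠ 0) (hι : Manifold.IsSmoothEmbedding (𝓡 n) (𝓡 m) ∞ ι)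
  (hc : IsInducedConformal ι c cN) (W : WeylStructure c) (g : c.metrics) (h : cN.metrics)

include hn hι hc in
/-- The Faraday form of the induced Weyl structure is the restriction of the ambient one. -/
theorem faraday_inducedConn (hm : m ≠ 0) (x : N) (X Y : TangentSpace (𝓡 n) x) :
    faraday (inducedConn g.1 ι W.cov.toFun) x X Y =
      faraday W.cov.toFun (ι x) (dmap ι x X) (dmap ι x Y) := by
  have : T2Space N := hι.isEmbedding.t2Space
  obtain ⟨h, hh⟩ := cN.nonempty
  have hG := hc.isInner g.2
  have hD := smoothConn_inducedConn W.smoothConn hι hG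
  have hβ := (W.smoothForm_lForm g.2).pullback hι
  have hφ := (hc.logFactor_spec hn g.2 hh).1
  have hform : SmoothForm (restrictedLForm g.1 ι W.cov.toFun h) := hβ.sub hφ.smoothForm
  rw [(compat_inducedConn hn hι hc W g ⟨h, hh⟩).faraday_eq hn hD hform,
    (W.compat g.2).faraday_eq hm W.smoothConn (W.smoothForm_lForm g.2)]
  have h1 : ∀ X Y, nablaForm (inducedConn g.1 ι W.cov.toFun)
      (restrictedLForm g.1 ι W.cov.toFun h) x X Y =
      nablaForm W.cov.toFun (lForm W.cov.toFun g.1) (ι x) (dmap ι x X) (dmap ι x Y) +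
        lForm W.cov.toFun g.1 (ι x) (fundForm g.1 ι W.cov.toFun x X Y) -
      nablaForm (inducedConn g.1 ι W.cov.toFun)
        (fun x v => mvfderiv (𝓡 n) (logFactor g.1 ι h) x v) x X Y := by
    intro X Y
    rw [← nablaForm_pullback W.smoothConn hι hG (W.smoothForm_lForm g.2)]
    exact nablaForm_sub hD hβ hφ.smoothForm x X Y
  rw [h1, h1, fundForm_symm W.smoothConn hι hG x Y X, nablaForm_mvfderiv_symm hD hφ x Y X]
  ring

include hn hι hc in
/-- The induced Möbius operator is a scalar perturbation of the trace-free Hessian of the induced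
Weyl structure. The skew part of the Hessian is half of the Faraday form of `N`, and cancels against
the skew part of the ambient Schouten-Weyl tensor. -/
theorem inducedMobius_eq (hm : m ≠ 0) (l : LSection cN) (x : N) (X Y : TangentSpace (𝓡 n) x) :
    inducedMobius g.1 ι W.cov.toFun l h x X Y =
      hessZero (inducedConn g.1 ι W.cov.toFun) l h x X Y +
        traceFree h.1 x (scalarPart g.1 ι W.cov.toFun x) X Y * l.toFun h x := by
  have : T2Space N := hι.isEmbedding.t2Space
  have h1 : opP g.1 ι W.cov.toFun l h x = fun v w =>
      symPart (hessian (lForm (inducedConn g.1 ι W.cov.toFun) h.1) (inducedConn g.1 ι W.cov.toFun)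
        (l.toFun h) x) v w +
      l.toFun h x * schoutenSym W.cov.toFun g.1 (ι x) (dmap ι x v) (dmap ι x w) := by
    ext v w
    have h2 := hessian_eq_symPart_add hn (inducedWeyl hn hι hc W g) h (l.smooth h) x v w
    have h3 := faraday_inducedConn hn hι hc W g hm x v w
    change hessian (lForm (inducedConn g.1 ι W.cov.toFun) h.1) (inducedConn g.1 ι W.cov.toFun)
      (l.toFun h) x v w = symPart (hessian (lForm (inducedConn g.1 ι W.cov.toFun) h.1)
        (inducedConn g.1 ι W.cov.toFun) (l.toFun h) x) v w +
        (1 / 2) * faraday (inducedConn g.1 ι W.cov.toFun) x v w * l.toFun h x at h2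
    rw [opP, ← lForm_inducedConn hn hι hc W g h, h2, h3, schouten]
    ring
  rw [inducedMobius, h1, traceFree_add, traceFree_mul,
    traceFree_scalarPart (Real.exp_pos _) ((hc.logFactor_spec hn g.2 h.2).2 x)]
  unfold hessZero
  ring

include hn hι hc in
theorem inducedMobius_isMobiusStructure (hm : m ≠ 0) :
    IsMobiusStructure cN (inducedMobius g.1 ι W.cov.toFun) := by
  have : T2Space N := hι.isEmbedding.t2Space
  obtain ⟨h₀, hh₀⟩ := cN.nonempty
  have hG := hc.isInner g.2
  have hbil := fun x => isBilinearMap_scalarPart W.smoothConn hι hG x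
  refine isMobiusStructure_of_eq hn (inducedWeyl hn hι hc W g)
    (b := fun x => traceFree h₀ x (scalarPart g.1 ι W.cov.toFun x))
    (fun x => isBilinearMap_traceFree h₀ (hbil x))
    (fun X Y hX hY => smoothFun_traceFree h₀ hbil
      (fun X Y hX hY => smoothFun_scalarPart W.smoothConn hι hG hX hY) hX hY)
    (fun x X Y => traceFree_symm h₀ (scalarPart_symm W.smoothConn hι hG x) X Y)
    (fun h hh x => ?_) (fun l h x X Y => ?_)
  · obtain ⟨ψ, -, hψ⟩ := (cN.mem_iff h₀ hh₀ h).1 hh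
    rw [← traceFree_rescale (Real.exp_ne_zero (2 * ψ x)) (hψ x)]
    exact trG_traceFree hn h _
  · obtain ⟨ψ, -, hψ⟩ := (cN.mem_iff h₀ hh₀ h.1).1 h.2
    rw [inducedMobius_eq hn hι hc W g h hm, traceFree_rescale (Real.exp_ne_zero (2 * ψ x)) (hψ x)]
    rfl

include hn hι hc in
/-- The expression of the induced Möbius operator through the ambient Hessian of an extension of
`l`. Here the Gauss formula contributes the derivative along `B`, whose trace-free part is the
derivative along `B₀`. -/
theorem inducedMobius_eq_ambientMobius (l : LSection cN) (lM : LSection c) (x : N)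
    (X Y : TangentSpace (𝓡 n) x) (hl : RestrictsNear ι lM l x) :
    inducedMobius g.1 ι W.cov.toFun l h x X Y = ambientMobius ι W.cov.toFun lM g h.1 x X Y := by
  have hlx : l.toFun h x = Real.exp (logFactor g.1 ι h.1 x) * lM.toFun g (ι x) :=
    (hl g h).self_of_nhds
  have hlin := ((W.smoothForm_lForm g.2).lineDeriv (lM.smooth g)).lin (ι x)
  have h1 : opP g.1 ι W.cov.toFun l h x = fun v w => Real.exp (logFactor g.1 ι h.1 x) *
      ((hessian (lForm W.cov.toFun g.1) W.cov.toFun (lM.toFun g) (ι x) (dmap ι x v) (dmap ι x w) +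
        IsLinearMap.mk' _ hlin (fundForm g.1 ι W.cov.toFun x v w)) +
      lM.toFun g (ι x) * schouten W.cov.toFun g.1 (ι x) (dmap ι x v) (dmap ι x w)) := by
    ext v w
    rw [opP, hessian_restrict hn hι hc W g h (lM.smooth g) (hl g h), hlx, IsLinearMap.mk'_apply]
    ring
  rw [inducedMobius, h1, traceFree_mul, traceFree_add, traceFree_add, traceFree_mul,
    traceFree_fundForm (Real.exp_pos _) ((hc.logFactor_spec hn g.2 h.2).2 x), hlx,
    IsLinearMap.mk'_apply, ambientMobius]
  ring

/-! ### Independence of the choices -/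

include hn hι hc in
/-- The induced Möbius operator does not depend on the auxiliary metric. -/
theorem inducedMobius_rescale (hm : m ≠ 0) (g' : c.metrics) (l : LSection cN) :
    inducedMobius g'.1 ι W.cov.toFun l = inducedMobius g.1 ι W.cov.toFun l := by
  obtain ⟨ψ, -, hψ⟩ := (c.mem_iff g.1 g.2 g'.1).1 g'.2
  have hG := hc.isInner g.2
  ext h x X Y
  have h1 : scalarPart g'.1 ι W.cov.toFun x = scalarPart (n := n) g.1 ι W.cov.toFun x := by
    ext v w
    rw [scalarPart, scalarPart, schoutenSym_rescale hψ, meanCurv_rescale hG hψ,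
      fundForm_rescale hG hψ]
  rw [inducedMobius_eq hn hι hc W g h hm, inducedMobius_eq hn hι hc W g' h hm,
    inducedConn_rescale hG hψ, h1]

section Change

variable {D D' : Conn m M} {θ : Π p : M, TangentSpace (𝓡 m) p → ℝ}
  {T : Π p : M, TangentSpace (𝓡 m) p} {g₁ : Metric m M}

/-- The fundamental form changes by `-c ⊗ T^⊥`. -/
theorem ConnChange.fundForm_eq (hD : SmoothConn D) (hD' : SmoothConn D')
    (hι : Manifold.IsSmoothEmbedding (𝓡 n) (𝓡 m) ∞ ι)
    (hG : ∀ x : N, IsInner (pullInner (n := n) g₁ ι x)) (hT : ConnChange D D' g₁ θ T) (x : N)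
    (v w : TangentSpace (𝓡 n) x) : fundForm g₁ ι D' x v w =
      fundForm g₁ ι D x v w - pullInner g₁ ι x v w • norProj (n := n) g₁ ι x (T (ι x)) := by
  have : T2Space N := hι.isEmbedding.t2Space
  obtain ⟨Y, hY, -, rfl⟩ := exists_smoothField_extend w
  obtain ⟨Y', hY', hYY⟩ := exists_smoothField_extension hι (hY.dmap hι.contMDiff) x
  have h1 : alongDeriv ι D' (fun y => dmap ι y (Y y)) x v =
      alongDeriv ι D (fun y => dmap ι y (Y y)) x v +
        dmap ι x (θ (ι x) (dmap ι x v) • Y x + θ (ι x) (dmap ι x (Y x)) • v) +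
        (-pullInner g₁ ι x v (Y x)) • T (ι x) := by
    rw [alongDeriv_eq hD hι.contMDiff hY' hYY, alongDeriv_eq hD' hι.contMDiff hY' hYY,
      hT.eq Y' hY', hYY.self_of_nhds, map_add, map_smul, map_smul, pullInner]
    module
  rw [(isLinearMap_and_fundForm_apply hD hι hG x v).2 Y hY,
    (isLinearMap_and_fundForm_apply hD' hι hG x v).2 Y hY, h1, norProj_add, norProj_add,
    norProj_dmap hG, norProj_smul]
  module

theorem ConnChange.meanVec_eq (hn : n ≠ 0) (hD : SmoothConn D) (hD' : SmoothConn D')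
    (hι : Manifold.IsSmoothEmbedding (𝓡 n) (𝓡 m) ∞ ι)
    (hG : ∀ x : N, IsInner (pullInner (n := n) g₁ ι x)) (hT : ConnChange D D' g₁ θ T) (x : N) :
    meanVec (n := n) g₁ ι D' x =
      meanVec (n := n) g₁ ι D x - norProj (n := n) g₁ ι x (T (ι x)) := by
  have hn' : (n : ℝ) ≠ 0 := Nat.cast_ne_zero.2 hn
  have h1 : fundForm g₁ ι D' x = fun v w : TangentSpace (𝓡 n) x =>
      fundForm g₁ ι D x v w - pullInner g₁ ι x v w • norProj (n := n) g₁ ι x (T (ι x)) := by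
    ext1 v
    ext1 w
    exact hT.fundForm_eq hD hD' hι hG x v w
  have h2 := trG_map (G := pullInner (n := n) g₁ ι x)
    (LinearMap.toSpanSingleton ℝ _ (norProj (n := n) g₁ ι x (T (ι x)))) (pullInner g₁ ι x)
  simp only [LinearMap.toSpanSingleton_apply] at h2
  rw [meanVec, meanVec, h1, trG_sub, h2, trG_self (hG x), smul_sub, smul_smul,
    one_div_mul_cancel hn', one_smul]

theorem ConnChange.fundFormZero_eq (hn : n ≠ 0) (hD : SmoothConn D) (hD' : SmoothConn D')
    (hι : Manifold.IsSmoothEmbedding (𝓡 n) (𝓡 m) ∞ ι)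
    (hG : ∀ x : N, IsInner (pullInner (n := n) g₁ ι x)) (hT : ConnChange D D' g₁ θ T) (x : N)
    (v w : TangentSpace (𝓡 n) x) : fundFormZero g₁ ι D' x v w = fundFormZero g₁ ι D x v w := by
  rw [fundFormZero, fundFormZero, hT.fundForm_eq hD hD' hι hG, hT.meanVec_eq hn hD hD' hι hG]
  module

/-- The change of `H(B₀)`. The form `B₀` does not change, and it is normal, so that `g(T^⊥, B₀) =
θ(B₀)`. -/
theorem ConnChange.meanCurv_fundFormZero_eq (hn : n ≠ 0) (hD : SmoothConn D) (hD' : SmoothConn D')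
    (hι : Manifold.IsSmoothEmbedding (𝓡 n) (𝓡 m) ∞ ι)
    (hG : ∀ x : N, IsInner (pullInner (n := n) g₁ ι x)) (hT : ConnChange D D' g₁ θ T) (x : N)
    (v w : TangentSpace (𝓡 n) x) :
    meanCurv (n := n) g₁ ι D' x (fundFormZero g₁ ι D' x v w) =
      meanCurv (n := n) g₁ ι D x (fundFormZero g₁ ι D x v w) -
        θ (ι x) (fundFormZero g₁ ι D x v w) := by
  have h1 : ∀ u : TangentSpace (𝓡 n) x,
      g₁.inner (ι x) (dmap ι x u) (fundFormZero g₁ ι D x v w) = 0 := by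
    intro u
    rw [g₁.symm, fundFormZero, map_sub, map_smul, sub_apply, smul_apply, inner_fundForm_dmap hG,
      inner_meanVec_dmap hG, smul_zero, sub_zero]
  rw [meanCurv, meanCurv, hT.fundFormZero_eq hn hD hD' hι hG, hT.meanVec_eq hn hD hD' hι hG,
    norProj, map_sub, map_sub, sub_apply, sub_apply, hT.dual, h1, sub_zero]

end Change

include hn hι hc in
/-- The induced Möbius operator does not depend on the Weyl structure: the changes `tf(∇θ - θ ⊗ θ) +
θ(B₀)` of the intrinsic Hessian, `-tf(∇θ - θ ⊗ θ)` of the restricted Schouten-Weyl tensor and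
`-θ(B₀)` of `H(B₀)` add up to zero. -/
theorem inducedMobius_change (hm : 3 ≤ m) (W' : WeylStructure c) (l : LSection cN) :
    inducedMobius g.1 ι W'.cov.toFun l = inducedMobius g.1 ι W.cov.toFun l := by
  have : T2Space N := hι.isEmbedding.t2Space
  have hm0 : m ≠ 0 := by lia
  have hG := hc.isInner g.2
  ext h x X Y
  obtain ⟨T, hT⟩ := W.exists_connChange hm0 W' g.2
  set θ : Π p : M, TangentSpace (𝓡 m) p → ℝ := fun p v =>
    lForm W'.cov.toFun g.1 p v - lForm W.cov.toFun g.1 p v with hθ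
  have hh := (hc.logFactor_spec hn g.2 h.2).2 x
  obtain ⟨κ, hκ⟩ := hT.exists_schoutenSym_eq hm W.smoothConn W'.smoothConn (W.compat g.2) (ι x)
  have h1 := hessZero_change hn (inducedWeyl hn hι hc W g) (inducedWeyl hn hι hc W' g) l h x X Y
  change hessZero (inducedConn g.1 ι W'.cov.toFun) l h x X Y =
    hessZero (inducedConn g.1 ι W.cov.toFun) l h x X Y + l.toFun h x *
      traceFree h.1 x (fun u v => symPart (nablaForm (inducedConn g.1 ι W.cov.toFun)
        (fun x v => lForm (inducedConn g.1 ι W'.cov.toFun) h.1 x v -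
          lForm (inducedConn g.1 ι W.cov.toFun) h.1 x v) x) u v -
        (lForm (inducedConn g.1 ι W'.cov.toFun) h.1 x u -
          lForm (inducedConn g.1 ι W.cov.toFun) h.1 x u) *
        (lForm (inducedConn g.1 ι W'.cov.toFun) h.1 x v -
          lForm (inducedConn g.1 ι W.cov.toFun) h.1 x v)) X Y at h1
  have h2 : ∀ y (v : TangentSpace (𝓡 n) y), lForm (inducedConn g.1 ι W'.cov.toFun) h.1 y v -
      lForm (inducedConn g.1 ι W.cov.toFun) h.1 y v = θ (ι y) (dmap ι y v) := by
    intro y v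
    rw [lForm_inducedConn hn hι hc W g h, lForm_inducedConn hn hι hc W' g h, restrictedLForm,
      restrictedLForm, hθ]
    ring
  simp only [h2] at h1
  -- the fundamental form contributes the derivative of `θ` in the normal direction
  have h3 : (fun u v : TangentSpace (𝓡 n) x => symPart (nablaForm (inducedConn g.1 ι W.cov.toFun)
      (fun y v => θ (ι y) (dmap ι y v)) x) u v - θ (ι x) (dmap ι x u) * θ (ι x) (dmap ι x v)) =
      fun u v => (symPart (nablaForm W.cov.toFun θ (ι x)) (dmap ι x u) (dmap ι x v) -
        θ (ι x) (dmap ι x u) * θ (ι x) (dmap ι x v)) +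
        IsLinearMap.mk' _ (hT.form.lin (ι x)) (fundForm g.1 ι W.cov.toFun x u v) := by
    ext u v
    rw [symPart, symPart, nablaForm_pullback W.smoothConn hι hG hT.form,
      nablaForm_pullback W.smoothConn hι hG hT.form, fundForm_symm W.smoothConn hι hG x v u,
      IsLinearMap.mk'_apply]
    ring
  rw [h3, traceFree_add, traceFree_fundForm (Real.exp_pos _) hh, IsLinearMap.mk'_apply] at h1
  have h4 : traceFree h.1 x (fun v w : TangentSpace (𝓡 n) x =>
      schoutenSym W'.cov.toFun g.1 (ι x) (dmap ι x v) (dmap ι x w)) X Y =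
      traceFree h.1 x (fun v w =>
        schoutenSym W.cov.toFun g.1 (ι x) (dmap ι x v) (dmap ι x w)) X Y -
      traceFree h.1 x (fun u v =>
        symPart (nablaForm W.cov.toFun θ (ι x)) (dmap ι x u) (dmap ι x v) -
        θ (ι x) (dmap ι x u) * θ (ι x) (dmap ι x v)) X Y := by
    rw [← traceFree_sub]
    refine traceFree_congr_mod hn h.1 (κ := κ * Real.exp (-(2 * logFactor g.1 ι h.1 x)))
      (fun v w => ?_) X Y
    rw [hκ, hh, mul_assoc, ← mul_assoc (Real.exp _), ← Real.exp_add, neg_add_cancel, Real.exp_zero,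
      one_mul, pullInner]
    ring
  rw [inducedMobius_eq hn hι hc W g h hm0, inducedMobius_eq hn hι hc W' g h hm0, h1,
    traceFree_scalarPart (Real.exp_pos _) hh, traceFree_scalarPart (Real.exp_pos _) hh, h4,
    hT.meanCurv_fundFormZero_eq hn W.smoothConn W'.smoothConn hι hG]
  ring

/-! ### The comparison with a Möbius structure of the submanifold -/

include hn hι hc in
/-- If `hN` is `s - F / 2` up to a multiple of the metric, then the Faraday forms of `N` and of the
ambient Weyl structure cancel in the relative Schouten-Weyl tensor, and the term with `c(H, H)` is
pure trace. -/
theorem traceFree_relSchouten (hm : m ≠ 0) (x : N)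
    {hN s : TangentSpace (𝓡 n) x → TangentSpace (𝓡 n) x → ℝ} {κ : ℝ}
    (hs : ∀ v w, hN v w = s v w + κ * h.1.inner x v w -
      (1 / 2) * faraday (inducedConn g.1 ι W.cov.toFun) x v w)
    (X Y : TangentSpace (𝓡 n) x) :
    traceFree h.1 x (relSchouten g.1 ι W.cov.toFun x hN) X Y =
      traceFree h.1 x (scalarPart g.1 ι W.cov.toFun x) X Y - traceFree h.1 x s X Y := by
  have hh := (hc.logFactor_spec hn g.2 h.2).2 x
  obtain ⟨L, hL⟩ := exists_linearMap_meanCurv (n := n) (ι := ι) g.1 W.cov.toFun x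
  have h1 : ∀ v w : TangentSpace (𝓡 n) x, relSchouten g.1 ι W.cov.toFun x hN v w =
      ((schoutenSym W.cov.toFun g.1 (ι x) (dmap ι x v) (dmap ι x w) - s v w) +
        L (fundFormZero g.1 ι W.cov.toFun x v w)) +
      ((1 / 2) * g.1.inner (ι x) (meanVec (n := n) g.1 ι W.cov.toFun x)
        (meanVec (n := n) g.1 ι W.cov.toFun x) * Real.exp (-(2 * logFactor g.1 ι h.1 x)) - κ) *
        h.1.inner x v w := by
    intro v w
    have h2 : pullInner g.1 ι x v w =
        Real.exp (-(2 * logFactor g.1 ι h.1 x)) * h.1.inner x v w := by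
      rw [hh, ← mul_assoc, ← Real.exp_add, neg_add_cancel, Real.exp_zero, one_mul]
    rw [relSchouten, hs, faraday_inducedConn hn hι hc W g hm, schouten, h2, hL]
    ring
  rw [traceFree_congr_mod hn h.1 h1, traceFree_add, traceFree_sub,
    traceFree_fundFormZero hn (Real.exp_pos _) hh,
    traceFree_scalarPart (Real.exp_pos _) hh, hL]
  ring

include hn hι hc in
/-- The canonical Möbius operator may be computed with the induced Weyl structure, whose Hessian
then cancels. -/
theorem inducedMobius_sub_canonicalMobius (hm : m ≠ 0) (hn3 : 3 ≤ n) (WN : WeylStructure cN)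
    (l : LSection cN) (x : N) (X Y : TangentSpace (𝓡 n) x) :
    inducedMobius g.1 ι W.cov.toFun l h x X Y - canonicalMobius WN.cov.toFun l h x X Y =
      traceFree h.1 x (relSchouten g.1 ι W.cov.toFun x
        (schouten (inducedConn g.1 ι W.cov.toFun) h.1 x)) X Y * l.toFun h x := by
  have : T2Space N := hι.isEmbedding.t2Space
  have h1 : canonicalMobius WN.cov.toFun l h x X Y =
      canonicalMobius (inducedConn g.1 ι W.cov.toFun) l h x X Y :=
    canonicalMobius_eq hn3 (inducedWeyl hn hι hc W g) WN l h x X Y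
  rw [h1, canonicalMobius, inducedMobius_eq hn hι hc W g h hm,
    traceFree_relSchouten hn hι hc W g h hm x (κ := 0)
      (s := schoutenSym (inducedConn g.1 ι W.cov.toFun) h.1 x)
      (fun v w => by rw [schouten]; ring)]
  ring

include hn hι hc in
/-- The tensor `mobiusSchoutenZero` exists for the induced Weyl structure, as it does for every Weyl
structure, so that the choice in its definition is a genuine one. -/
theorem inducedMobius_sub_mobius (hm : m ≠ 0) {P : LSection cN → LForm cN}
    (hP : IsMobiusStructure cN P) (l : LSection cN) (x : N) (X Y : TangentSpace (𝓡 n) x) :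
    inducedMobius g.1 ι W.cov.toFun l h x X Y - P l h x X Y =
      traceFree h.1 x (relSchouten g.1 ι W.cov.toFun x
        (surfaceSchouten P (inducedConn g.1 ι W.cov.toFun) h.1 x)) X Y * l.toFun h x := by
  have : T2Space N := hι.isEmbedding.t2Space
  have hex : ∃ b : Π x : N, TangentSpace (𝓡 n) x →L[ℝ] TangentSpace (𝓡 n) x →L[ℝ] ℝ,
      ∀ l g' x X Y, P l g' x X Y = hessZero (inducedConn g.1 ι W.cov.toFun) l g' x X Y +
        b x X Y * l.toFun g' x := hP.exists_eq hn (inducedWeyl hn hι hc W g)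
  have hb : ∀ l g' x X Y, P l g' x X Y = hessZero (inducedConn g.1 ι W.cov.toFun) l g' x X Y +
      mobiusSchoutenZero P (inducedConn g.1 ι W.cov.toFun) x X Y * l.toFun g' x := by
    rw [mobiusSchoutenZero, dif_pos hex]
    exact hex.choose_spec
  rw [traceFree_relSchouten hn hι hc W g h hm x
      (κ := (1 / 4) * scal (inducedConn g.1 ι W.cov.toFun) h.1 x)
      (s := fun v w => mobiusSchoutenZero P (inducedConn g.1 ι W.cov.toFun) x v w)
      (fun v w => by rw [surfaceSchouten]),
    sub_mul, hP.traceFree_mul_eq hn (inducedWeyl hn hι hc W g) hb,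
    inducedMobius_eq hn hι hc W g h hm, hb]
  ring

end InducedMobius

end ConfGeom

theorem proposition4p13 {m n : ℕ} (hn : 2 ≤ n) (hnm : n < m)
    {M : Type*} [TopologicalSpace M] [T2Space M] [SecondCountableTopology M]
    [ChartedSpace (EuclideanSpace ℝ (Fin m)) M] [IsManifold (𝓡 m) ∞ M]
    {N : Type*} [TopologicalSpace N]
    [ChartedSpace (EuclideanSpace ℝ (Fin n)) N] [IsManifold (𝓡 n) ∞ N]
    (c : ConfGeom.ConformalStructure m M) (cN : ConfGeom.ConformalStructure n N)
    (ι : N → M) (hι : Manifold.IsSmoothEmbedding (𝓡 n) (𝓡 m) ∞ ι)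
    (hc : ConfGeom.IsInducedConformal ι c cN) :
    -- the operator depends neither on the Weyl structure nor on the auxiliary metric
    (∀ (W W' : ConfGeom.WeylStructure c) (g g' : c.metrics) (l : ConfGeom.LSection cN),
      ConfGeom.inducedMobius (g : ConfGeom.Metric m M) ι W.cov.toFun l =
        ConfGeom.inducedMobius (g' : ConfGeom.Metric m M) ι W'.cov.toFun l) ∧
    -- it is a Möbius structure
    (∀ (W : ConfGeom.WeylStructure c) (g : c.metrics),
      ConfGeom.IsMobiusStructure cN
        (ConfGeom.inducedMobius (g : ConfGeom.Metric m M) ι W.cov.toFun)) ∧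
    -- the two expressions of the operator agree
    (∀ (W : ConfGeom.WeylStructure c) (g : c.metrics) (h : cN.metrics)
      (l : ConfGeom.LSection cN) (lM : ConfGeom.LSection c) (x : N)
      (X Y : TangentSpace (𝓡 n) x), ConfGeom.RestrictsNear ι lM l x →
        ConfGeom.inducedMobius (g : ConfGeom.Metric m M) ι W.cov.toFun l h x X Y =
          ConfGeom.ambientMobius ι W.cov.toFun lM g h x X Y) ∧
    -- comparison with the canonical Möbius structure of `N`, in dimension at least three
    (3 ≤ n → ∀ (W : ConfGeom.WeylStructure c) (WN : ConfGeom.WeylStructure cN) (g : c.metrics)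
      (h : cN.metrics) (l : ConfGeom.LSection cN) (x : N) (X Y : TangentSpace (𝓡 n) x),
        ConfGeom.inducedMobius (g : ConfGeom.Metric m M) ι W.cov.toFun l h x X Y
            - ConfGeom.canonicalMobius WN.cov.toFun l h x X Y =
          ConfGeom.traceFree (h : ConfGeom.Metric n N) x
            (ConfGeom.relSchouten (g : ConfGeom.Metric m M) ι W.cov.toFun x
              (ConfGeom.schouten (ConfGeom.inducedConn (g : ConfGeom.Metric m M) ι W.cov.toFun)
                (h : ConfGeom.Metric n N) x)) X Y * l.toFun h x) ∧
    -- comparison with an arbitrary Möbius structure of `N`, in dimension two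
    (n = 2 → ∀ P : ConfGeom.LSection cN → ConfGeom.LForm cN, ConfGeom.IsMobiusStructure cN P →
      ∀ (W : ConfGeom.WeylStructure c) (g : c.metrics)
        (h : cN.metrics) (l : ConfGeom.LSection cN) (x : N) (X Y : TangentSpace (𝓡 n) x),
        ConfGeom.inducedMobius (g : ConfGeom.Metric m M) ι W.cov.toFun l h x X Y
            - P l h x X Y =
          ConfGeom.traceFree (h : ConfGeom.Metric n N) x
            (ConfGeom.relSchouten (g : ConfGeom.Metric m M) ι W.cov.toFun x
              (ConfGeom.surfaceSchouten P
                (ConfGeom.inducedConn (g : ConfGeom.Metric m M) ι W.cov.toFun)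
                (h : ConfGeom.Metric n N) x)) X Y * l.toFun h x) := by
  have hn0 : n ≠ 0 := by lia
  have hm0 : m ≠ 0 := by lia
  refine ⟨fun W W' g g' l => ?_, fun W g => ?_, fun W g h l lM x X Y hl => ?_,
    fun hn3 W WN g h l x X Y => ?_, fun _ P hP W g h l x X Y => ?_⟩
  · rw [ConfGeom.inducedMobius_rescale hn0 hι hc W' g hm0 g' l,
      ConfGeom.inducedMobius_change hn0 hι hc W g (by lia) W' l]
  · exact ConfGeom.inducedMobius_isMobiusStructure hn0 hι hc W g hm0
  · exact ConfGeom.inducedMobius_eq_ambientMobius hn0 hι hc W g h l lM x X Y hl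
  · exact ConfGeom.inducedMobius_sub_canonicalMobius hn0 hι hc W g h hm0 hn3 WN l x X Y
  · exact ConfGeom.inducedMobius_sub_mobius hn0 hι hc W g h hm0 hP l x X Y
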